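/- Let $\Gamma$ be a totally ordered abelian group (written additively) and $A=\mathbb{Z}[\Gamma]$ its group ring, with basis $\{e^\gamma\mid\gamma\in\Gamma\}$ and involution $\overline{\sum a_\gamma e^\gamma}=\sum a_\gamma e^{-\gamma}$; let $A_{<0}$ be the span of the $e^\gamma$ with $\gamma<0$. Let $n\ge 2$ and let $W_n$ be a Coxeter group of type $B_n$ with generators $t,s_1,\dots,s_{n-1}$ (in this order along the diagram, $ts_1$ of order $4$) and length function $\ell$. Let $L:W_n\to\Gamma$ be a weight function (that is, $L(ww')=L(w)+L(w')$ whenever $\ell(ww')=\ell(w)+\ell(w')$), positive on the generators, with $L(t)=b$ and $L(s_1)=\dots=L(s_{n-1})=a$, and assume that $b>(n-1)a$ (the asymptotic case). Let $\mathcal H_n$ be the corresponding Iwahori–Hecke algebra over $A$, with basis $\{T_w\mid w\in W_n\}$ and, for every generator $s$ and $q_s=e^{L(s)}$, $T_sT_w=T_{sw}$ if $\ell(sw)>\ell(w)$ and $T_sT_w=T_{sw}+(q_s-q_s^{-1})T_w$ if $\ell(sw)<\ell(w)$. Let $\{\mathbf C_w\}$ be its Kazhdan–Lusztig basis: $\mathbf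 C_w$ is the unique element that is fixed by the involution $\overline{\sum a_wT_w}=\sum\overline{a}_wT_{w^{-1}}^{-1}$ and congruent to $T_w$ modulo $\sum_y A_{<0}T_y$. For a set $I$ of generators, let $\le_{\mathcal L,I}$ be the reflexive and transitive relation on $W_n$ generated by: $x\leftarrow_{\mathcal L,I}y$ if $\mathbf C_x$ occurs with non-zero coefficient in $\mathbf C_s\mathbf C_y$ (expanded in the basis $\{\mathbf C_w\}$) for some $s\in I$. Write $\le_{\mathcal L}$ for $\le_{\mathcal L,I}$ with $I=\{t,s_1,\dots,s_{n-1}\}$ and, for $0\le l\le n$, write $\le_{\mathcal L,l}$ for $\le_{\mathcal L,\Sigma_{l,n-l}}$, where $\Sigma_{l,n-l}=\{s_1,\dots,s_{n-1}\}\setminus\{s_l\}$ if $1\le l\le n-1$ and $\Sigma_{0,n}=\Sigma_{n,0}=\{s_1,\dots,s_{n-1}\}$. For $w\in W_n$ let $\ell_t(w)$ be the number of occurrences of $t$ in a reduced expression of $w$. Let $\mathfrak S_n=\langle s_1,\dots,s_{n-1}\rangle$ and $\mathfrak S_{l,n-l}=\langle\Sigma_{l,n-l}\rangle$, let $X_{l,n-l}$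 be the set of elements $w\in\mathfrak S_n$ of minimal length in $w\mathfrak S_{l,n-l}$, and let $a_0=1$, $a_l=t(s_1t)(s_2s_1t)\cdots(s_{l-1}\cdots s_1t)$ for $l\geq 1$. Every $w\in W_n$ has a unique decomposition $w=a_w\,a_l\,\sigma_w\,b_w^{-1}$ with $l=\ell_t(w)$, $\sigma_w\in\mathfrak S_{l,n-l}$ and $a_w,b_w\in X_{l,n-l}$. **Theorem.** Let $x,y\in W_n$ be such that $l:=\ell_t(x)=\ell_t(y)$. Then $$x\le_{\mathcal L}y\quad\Longleftrightarrow\quad \sigma_xb_x^{-1}\le_{\mathcal L,l}\sigma_yb_y^{-1}.$$ -/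

import Mathlib

namespace KazhdanLusztig

set_option linter.unusedSectionVars false

section Exchange

variable {B W : Type*} [Group W] {M : CoxeterMatrix B} (cs : CoxeterSystem M W)

open Classical in
/-- The action of a generator on pairs `(t, ε)`, used only to prove the exchange property. -/
noncomputable def reflAct (i : B) : Function.End (W × ZMod 2) := fun p =>
  (cs.simple i * p.1 * cs.simple i, p.2 + if p.1 = cs.simple i then 1 else 0)

theorem end_mul_apply {X : Type*} (f g : Function.End X) (p : X) : (f * g) p = f (g p) := rfl

open Classical in
theorem reflAct_pow (i j : B) (k : ℕ) (t : W) (ε : ZMod 2) :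
    ((reflAct cs i * reflAct cs j) ^ k) (t, ε) =
      ((cs.simple i * cs.simple j) ^ k * t * ((cs.simple i * cs.simple j) ^ k)⁻¹,
        ε + ∑ r ∈ Finset.range (2 * k),
          if t = cs.simple j * (cs.simple i * cs.simple j) ^ r then 1 else 0) := by
  induction k with
  | zero => simp; rfl
  | succ k ih =>
    have key : ∀ r : ℕ, cs.simple j * (cs.simple i * cs.simple j) ^ r =
        ((cs.simple i * cs.simple j) ^ r)⁻¹ * cs.simple j := by
      intro r
      induction r with
      | zero => simp
      | succ r ihr =>
        rw [pow_succ, ← mul_assoc, ihr, ← pow_succ, pow_succ', mul_inv_rev, mul_inv_rev]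
        simp [mul_assoc]
    rw [pow_succ', end_mul_apply, ih, end_mul_apply]
    set ρ := cs.simple i * cs.simple j with hρ
    have h1 : ρ ^ k * t * (ρ ^ k)⁻¹ = cs.simple j ↔ t = cs.simple j * ρ ^ (2 * k) := by
      rw [two_mul, pow_add, ← mul_assoc, key, mul_inv_eq_iff_eq_mul, eq_comm,
        ← inv_mul_eq_iff_eq_mul, eq_comm, ← mul_assoc]
    have h2 : cs.simple j * (ρ ^ k * t * (ρ ^ k)⁻¹) * cs.simple j = cs.simple i ↔
        t = cs.simple j * ρ ^ (2 * k + 1) := by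
      have : cs.simple j * ρ ^ (2 * k + 1) =
          (ρ ^ k)⁻¹ * (cs.simple j * cs.simple i * cs.simple j) * ρ ^ k := by
        have : 2 * k + 1 = k + (1 + k) := by ring
        rw [this, pow_add, pow_add, ← mul_assoc, key, pow_one, hρ]
        simp [mul_assoc]
      rw [this]
      constructor
      · intro h
        rw [← h]
        simp [mul_assoc]
      · intro h
        rw [h]
        simp [mul_assoc]
    simp only [reflAct, h1, h2]
    refine Prod.ext ?_ ?_
    · simp [pow_succ', hρ, mul_assoc]
    · show _ = _
      rw [show 2 * (k + 1) = 2 * k + 1 + 1 by ring, Finset.sum_range_succ, Finset.sum_range_succ]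
      simp only [add_assoc]

theorem reflAct_liftable : M.IsLiftable (reflAct cs) := by
  classical
  intro i j
  funext p
  obtain ⟨t, ε⟩ := p
  rw [reflAct_pow, cs.simple_mul_simple_pow, two_mul, Finset.sum_range_add]
  simp only [pow_add, cs.simple_mul_simple_pow, one_mul, CharTwo.add_self_eq_zero]
  simp
  rfl

open Classical in
theorem lift_reflAct (ω : List B) (t : W) (ε : ZMod 2) :
    cs.lift ⟨reflAct cs, reflAct_liftable cs⟩ (cs.wordProd ω)⁻¹ (t, ε) =
      ((cs.wordProd ω)⁻¹ * t * cs.wordProd ω, ε + ((cs.leftInvSeq ω).count t : ℕ)) := by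
  induction ω generalizing t ε with
  | nil => simp; rfl
  | cons i ω ih =>
    have hc : (List.map (⇑(MulAut.conj (cs.simple i))) (cs.leftInvSeq ω)).count t =
        (cs.leftInvSeq ω).count (cs.simple i * t * cs.simple i) := by
      rw [← List.count_map_of_injective (cs.leftInvSeq ω) _
        (MulAut.conj (cs.simple i)).injective (cs.simple i * t * cs.simple i)]
      simp [mul_assoc]
    rw [cs.wordProd_cons, mul_inv_rev, map_mul, end_mul_apply,
      cs.inv_simple, cs.lift_apply_simple, reflAct, ih, CoxeterSystem.leftInvSeq, List.count_cons,
      hc]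
    refine Prod.ext ?_ ?_
    · simp [mul_assoc]
    · simp only [beq_iff_eq, eq_comm (a := t)]
      push_cast
      ring

/-- Exchange property: a left descent of `w` occurs in the left inversion sequence of any word. -/
theorem simple_mem_leftInvSeq (ω : List B) (i : B)
    (h : cs.length (cs.simple i * cs.wordProd ω) < cs.length (cs.wordProd ω)) :
    cs.simple i ∈ cs.leftInvSeq ω := by
  classical
  obtain ⟨ω', hω', he⟩ := cs.exists_isReduced (cs.simple i * cs.wordProd ω)
  have hn : cs.simple i ∉ cs.leftInvSeq ω' := by
    intro hm
    have := (cs.isLeftInversion_of_mem_leftInvSeq hω' hm).2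
    rw [← he, cs.simple_mul_simple_cancel_left] at this
    omega
  have h1 := lift_reflAct cs (i :: ω') (cs.simple i) 0
  have h2 := lift_reflAct cs ω (cs.simple i) 0
  rw [cs.wordProd_cons, ← he, cs.simple_mul_simple_cancel_left, h2] at h1
  have h3 := congrArg Prod.snd h1
  have hn' : cs.simple i ∉ List.map (⇑(MulAut.conj (cs.simple i))) (cs.leftInvSeq ω') := by
    intro hm
    obtain ⟨u, hu, hu'⟩ := List.mem_map.1 hm
    apply hn
    have : u = cs.simple i := by
      have := congrArg (fun z => cs.simple i * z * cs.simple i) hu'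
      simpa [mul_assoc] using this
    rwa [← this]
  by_contra hc
  simp [CoxeterSystem.leftInvSeq, List.count_eq_zero_of_not_mem hc,
    List.count_eq_zero_of_not_mem hn'] at h3

theorem mem_leftInvSeq_congr {ω ω' : List B} (h : cs.IsReduced ω) (h' : cs.IsReduced ω')
    (he : cs.wordProd ω = cs.wordProd ω') (t : W) :
    t ∈ cs.leftInvSeq ω ↔ t ∈ cs.leftInvSeq ω' := by
  classical
  have h1 := congrArg Prod.snd (lift_reflAct cs ω t 0)
  have h2 := congrArg Prod.snd (lift_reflAct cs ω' t 0)
  rw [← he, h1] at h2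
  by_cases hm : t ∈ cs.leftInvSeq ω <;> by_cases hm' : t ∈ cs.leftInvSeq ω' <;>
    simp_all [List.count_eq_zero_of_not_mem, List.count_eq_one_of_mem h.nodup_leftInvSeq,
      List.count_eq_one_of_mem h'.nodup_leftInvSeq]

theorem mul_eq_mul_of_length (i j : B) (w : W)
    (h1 : cs.length w < cs.length (cs.simple i * w))
    (h2 : cs.length (cs.simple i * (w * cs.simple j)) < cs.length (w * cs.simple j)) :
    cs.simple i * w = w * cs.simple j := by
  obtain ⟨ω, hω, rfl⟩ := cs.exists_isReduced w
  have hm := simple_mem_leftInvSeq cs (ω.concat j) i (by rwa [cs.wordProd_concat])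
  rw [cs.leftInvSeq_concat, List.concat_eq_append, List.mem_append, List.mem_singleton] at hm
  rcases hm with hm | hm
  · have := (cs.isLeftInversion_of_mem_leftInvSeq hω hm).2
    omega
  · rw [hm]; group

end Exchange

section Coefficients

/-- The group ring `A = ℤ[Γ]`, with basis `e^γ` for `γ ∈ Γ`. -/
abbrev Coef (Γ : Type*) : Type _ := AddMonoidAlgebra ℤ Γ

variable {Γ : Type*} [AddCommGroup Γ] [LinearOrder Γ] [IsOrderedAddMonoid Γ]

/-- The basis element `e^γ` of `A`. -/
noncomputable def expo (γ : Γ) : Coef Γ := AddMonoidAlgebra.single γ 1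

/-- The bar involution `∑ a_γ e^γ ↦ ∑ a_γ e^{-γ}` of `A`. -/
noncomputable def conj : Coef Γ →+* Coef Γ :=
  AddMonoidAlgebra.mapDomainRingHom ℤ (negAddMonoidHom : Γ →+ Γ)

/-- The subgroup `A_{<0}` of `A`, spanned by the `e^γ` with `γ < 0`. -/
def negPart (Γ : Type*) [AddCommGroup Γ] [LinearOrder Γ] : AddSubgroup (Coef Γ) where
  carrier := {p | ∀ γ, 0 ≤ γ → p.coeff γ = 0}
  zero_mem' := by intro γ _; simp
  add_mem' := by
    intro p q hp hq γ hγ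
    simp [hp γ hγ, hq γ hγ]
  neg_mem' := by
    intro p hp γ hγ
    simp [hp γ hγ]

theorem expo_zero : expo (0 : Γ) = 1 := rfl

theorem expo_mul (γ δ : Γ) : expo γ * expo δ = expo (γ + δ) := by
  simp [expo, AddMonoidAlgebra.single_mul_single]

theorem conj_expo (γ : Γ) : conj (expo γ) = expo (-γ) := by
  simp [conj, expo]

theorem coeff_conj (p : Coef Γ) (γ : Γ) : (conj p).coeff γ = p.coeff (-γ) := by
  have := Finsupp.mapDomain_apply (M := ℤ) (neg_injective (G := Γ)) p.coeff (-γ)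
  rw [neg_neg] at this
  exact this

theorem expo_mem_negPart {γ : Γ} (h : γ < 0) : expo γ ∈ negPart Γ := by
  intro δ hδ
  simp only [expo, AddMonoidAlgebra.coeff_single]
  exact Finsupp.single_eq_of_ne (by intro he; subst he; exact absurd h (not_lt.2 hδ))

theorem eq_zero_of_conj_eq {p : Coef Γ} (h : conj p = p) (hp : p ∈ negPart Γ) : p = 0 := by
  ext γ
  rcases le_or_gt 0 γ with hγ | hγ
  · simpa using hp γ hγ
  · rw [← h, coeff_conj]
    simpa using hp (-γ) (by simpa using hγ.le)

theorem exists_selfConj (p : Coef Γ) : ∃ μ : Coef Γ, conj μ = μ ∧ p - μ ∈ negPart Γ := by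
  classical
  refine ⟨AddMonoidAlgebra.ofCoeff (Finsupp.onFinset
    (p.coeff.support ∪ p.coeff.support.image (fun γ => -γ)) (fun γ => p.coeff |γ|) ?_), ?_, ?_⟩
  · intro γ hγ
    rw [Finset.mem_union, Finset.mem_image]
    rcases abs_choice γ with h | h
    · left; rw [h] at hγ; simpa using hγ
    · right; exact ⟨-γ, by rw [h] at hγ; simpa using hγ, neg_neg γ⟩
  · ext γ
    rw [coeff_conj]
    simp
  · intro γ hγ
    simp [abs_of_nonneg hγ]

end Coefficients

section HeckeAlgebra

variable {B W : Type*} [Group W] {M : CoxeterMatrix B}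

/-- A positive weight function on the Coxeter group `W` with values in `Γ`: a function `L` that is
additive on products `w w'` such that `l(w w') = l(w) + l(w')`, and positive on the generators. -/
structure WeightFunction (cs : CoxeterSystem M W) (Γ : Type*) [AddCommGroup Γ] [LinearOrder Γ] where
  toFun : W → Γ
  map_mul : ∀ w w' : W, cs.length (w * w') = cs.length w + cs.length w' →
    toFun (w * w') = toFun w + toFun w'
  pos : ∀ i : B, 0 < toFun (cs.simple i)

variable {cs : CoxeterSystem M W} {Γ : Type*} [AddCommGroup Γ] [LinearOrder Γ]
  [IsOrderedAddMonoid Γ]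

instance : CoeFun (WeightFunction cs Γ) (fun _ => W → Γ) := ⟨WeightFunction.toFun⟩

variable (L : WeightFunction cs Γ)

/-- The element `q_s - q_s⁻¹` of `A`, where `q_s = e^{L(s)}`. -/
noncomputable def xi (i : B) : Coef Γ := expo (L (cs.simple i)) - expo (-L (cs.simple i))

/-- The operator on the free `A`-module with basis `(T_w)` that describes the left multiplication
by `T_s`: it sends `T_w` to `T_{sw}` if `l(sw) > l(w)` and to `T_{sw} + (q_s - q_s⁻¹) T_w`
otherwise. -/
noncomputable def leftOp (i : B) : Module.End (Coef Γ) (W →₀ Coef Γ) :=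
  Finsupp.linearCombination (Coef Γ) fun w =>
    if cs.length w < cs.length (cs.simple i * w) then
      Finsupp.single (cs.simple i * w) (1 : Coef Γ)
    else Finsupp.single (cs.simple i * w) (1 : Coef Γ) + xi L i • Finsupp.single w (1 : Coef Γ)

/-- The right-handed version of `leftOp`. -/
noncomputable def rightOp (i : B) : Module.End (Coef Γ) (W →₀ Coef Γ) :=
  Finsupp.linearCombination (Coef Γ) fun w =>
    if cs.length w < cs.length (w * cs.simple i) then
      Finsupp.single (w * cs.simple i) (1 : Coef Γ)
    else Finsupp.single (w * cs.simple i) (1 : Coef Γ) + xi L i • Finsupp.single w (1 : Coef Γ)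

/-- The generic Iwahori-Hecke algebra `H = H(W, S, L)` over `A`, as the algebra of operators on the
free `A`-module with basis `(T_w)` generated by the left multiplications by the `T_s`. Its
identification with that free module is `heckeEquiv` below, and the multiplication rule of the
basis `T` is `T_simple_mul_of_lt` and `T_simple_mul_of_gt`. -/
noncomputable abbrev Hecke : Type _ := ↥(Algebra.adjoin (Coef Γ) (Set.range (leftOp L)))

noncomputable instance : Ring (Hecke L) := Algebra.semiringToRing (Coef Γ)

theorem leftOp_single (i : B) (w : W) : leftOp L i (Finsupp.single w 1) =
    Finsupp.single (cs.simple i * w) 1 +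
      (if cs.length w < cs.length (cs.simple i * w) then 0 else xi L i) • Finsupp.single w 1 := by
  simp only [leftOp, Finsupp.linearCombination_single, one_smul]
  split_ifs <;> simp

theorem rightOp_single (i : B) (w : W) : rightOp L i (Finsupp.single w 1) =
    Finsupp.single (w * cs.simple i) 1 +
      (if cs.length w < cs.length (w * cs.simple i) then 0 else xi L i) • Finsupp.single w 1 := by
  simp only [rightOp, Finsupp.linearCombination_single, one_smul]
  split_ifs <;> simp

theorem leftOp_single_lt {i : B} {w : W} (h : cs.length w < cs.length (cs.simple i * w)) :
    leftOp L i (Finsupp.single w 1) = Finsupp.single (cs.simple i * w) 1 := by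
  simp [leftOp_single, h]

theorem rightOp_single_lt {i : B} {w : W} (h : cs.length w < cs.length (w * cs.simple i)) :
    rightOp L i (Finsupp.single w 1) = Finsupp.single (w * cs.simple i) 1 := by
  simp [rightOp_single, h]

theorem xi_eq_of_mul_eq {i j : B} {w : W} (h : cs.simple i * w = w * cs.simple j) :
    xi L i = xi L j := by
  have key : L (cs.simple i) = L (cs.simple j) := by
    rcases cs.length_simple_mul w i with h1 | h1
    · have e1 := L.map_mul (cs.simple i) w (by rw [h1, cs.length_simple]; ring)
      have e2 := L.map_mul w (cs.simple j) (by rw [← h, h1, cs.length_simple])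
      rw [h, e2, add_comm] at e1
      exact (add_right_cancel e1).symm
    · have e1 := L.map_mul (cs.simple i) (cs.simple i * w)
        (by rw [cs.simple_mul_simple_cancel_left, cs.length_simple]; omega)
      have e2 := L.map_mul (w * cs.simple j) (cs.simple j)
        (by rw [cs.simple_mul_simple_cancel_right, ← h, cs.length_simple]; omega)
      rw [cs.simple_mul_simple_cancel_left] at e1
      rw [cs.simple_mul_simple_cancel_right, e1, h, add_comm] at e2
      exact add_left_cancel e2
  rw [xi, xi, key]

theorem module_swap {R N : Type*} [CommRing R] [AddCommGroup N] [Module R N] (c d : R)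
    (x y z u : N) : x + c • y + d • (z + c • u) = x + d • z + c • (y + d • u) := by
  module

theorem leftOp_rightOp (i j : B) : leftOp L i * rightOp L j = rightOp L j * leftOp L i := by
  refine Finsupp.lhom_ext' fun w => LinearMap.ext_ring ?_
  simp only [LinearMap.comp_apply, Finsupp.lsingle_apply, Module.End.mul_apply]
  rw [leftOp_single, rightOp_single, map_add, map_add, map_smul, map_smul, leftOp_single,
    leftOp_single, rightOp_single, rightOp_single]
  by_cases h : cs.simple i * w = w * cs.simple j
  · have h1 : cs.simple i * (w * cs.simple j) = w := by
      rw [← h, cs.simple_mul_simple_cancel_left]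
    have h2 : cs.simple i * w * cs.simple j = w := by
      rw [h, cs.simple_mul_simple_cancel_right]
    rw [h1, h2, h, xi_eq_of_mul_eq L h]
  · have hl : cs.length w < cs.length (cs.simple i * w) ↔
        cs.length (w * cs.simple j) < cs.length (cs.simple i * (w * cs.simple j)) := by
      constructor
      · intro h1
        by_contra h2
        exact h (mul_eq_mul_of_length cs i j w h1
          (lt_of_le_of_ne (not_lt.1 h2) (cs.length_simple_mul_ne _ _)))
      · intro h1
        by_contra h2
        have := mul_eq_mul_of_length cs i j (w * cs.simple j) h1
          (by
            rw [cs.simple_mul_simple_cancel_right]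
            exact lt_of_le_of_ne (not_lt.1 h2) (cs.length_simple_mul_ne _ _))
        rw [cs.simple_mul_simple_cancel_right] at this
        apply h
        rw [← cs.simple_mul_simple_cancel_left (w := w * cs.simple j) i, this]
    have hr : cs.length w < cs.length (w * cs.simple j) ↔
        cs.length (cs.simple i * w) < cs.length (cs.simple i * w * cs.simple j) := by
      have a1 := cs.length_simple_mul w i
      have a2 := cs.length_mul_simple w j
      have a3 := cs.length_simple_mul (w * cs.simple j) i
      have a4 := cs.length_mul_simple (cs.simple i * w) j
      rw [mul_assoc] at a4 ⊢
      omega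
    rw [if_congr hl.symm rfl rfl, if_congr hr.symm rfl rfl, mul_assoc]
    exact module_swap _ _ _ _ _ _

theorem commute_rightOp (h : Hecke L) (j : B) :
    (h : Module.End (Coef Γ) (W →₀ Coef Γ)) * rightOp L j = rightOp L j * h := by
  obtain ⟨h, hh⟩ := h
  induction hh using Algebra.adjoin_induction with
  | mem x hx => obtain ⟨i, rfl⟩ := hx; exact leftOp_rightOp L i j
  | algebraMap r => exact Algebra.commutes r _
  | add x y _ _ hx hy =>
    have hx' : x * rightOp L j = rightOp L j * x := hx
    have hy' : y * rightOp L j = rightOp L j * y := hy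
    show (x + y) * rightOp L j = rightOp L j * (x + y)
    rw [add_mul, mul_add, hx', hy']
  | mul x y _ _ hx hy =>
    have hx' : x * rightOp L j = rightOp L j * x := hx
    have hy' : y * rightOp L j = rightOp L j * y := hy
    show (x * y) * rightOp L j = rightOp L j * (x * y)
    rw [mul_assoc, hy', ← mul_assoc, hx', mul_assoc]

/-- Evaluation of an element of `H` at `T_1`. -/
noncomputable def evalOne : Hecke L →ₗ[Coef Γ] (W →₀ Coef Γ) :=
  (LinearMap.applyₗ (Finsupp.single 1 1)) ∘ₗ
    (Algebra.adjoin (Coef Γ) (Set.range (leftOp L))).val.toLinearMap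

theorem evalOne_apply (h : Hecke L) :
    evalOne L h = (h : Module.End (Coef Γ) (W →₀ Coef Γ)) (Finsupp.single 1 1) := rfl

theorem evalOne_injective : Function.Injective (evalOne L) := by
  refine (injective_iff_map_eq_zero _).2 fun h hh => ?_
  rw [evalOne_apply] at hh
  apply Subtype.ext
  refine Finsupp.lhom_ext' fun w => LinearMap.ext_ring ?_
  simp only [LinearMap.comp_apply, Finsupp.lsingle_apply]
  show (h : Module.End (Coef Γ) (W →₀ Coef Γ)) (Finsupp.single w 1) = 0
  induction hn : cs.length w generalizing w with
  | zero => rw [cs.length_eq_zero_iff.1 hn, hh]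
  | succ n ih =>
    obtain ⟨j, hj⟩ := cs.exists_rightDescent_of_ne_one (w := w)
      (by rintro rfl; simp at hn)
    have h1 := cs.isRightDescent_iff.1 hj
    have h2 := rightOp_single_lt L (i := j) (w := w * cs.simple j)
      (by rw [cs.simple_mul_simple_cancel_right]; omega)
    rw [cs.simple_mul_simple_cancel_right] at h2
    rw [← h2, ← Module.End.mul_apply, commute_rightOp, Module.End.mul_apply,
      ih (w * cs.simple j) (by omega), map_zero]

theorem evalOne_surjective : Function.Surjective (evalOne L) := by
  have key : ∀ w : W, ∃ h : Hecke L, evalOne L h = Finsupp.single w 1 := by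
    intro w
    induction hn : cs.length w generalizing w with
    | zero => exact ⟨1, by rw [cs.length_eq_zero_iff.1 hn]; rfl⟩
    | succ n ih =>
      obtain ⟨i, hi⟩ := cs.exists_leftDescent_of_ne_one (w := w) (by rintro rfl; simp at hn)
      have h1 := cs.isLeftDescent_iff.1 hi
      obtain ⟨h, hh⟩ := ih (cs.simple i * w) (by omega)
      have h2 := leftOp_single_lt L (i := i) (w := cs.simple i * w)
        (by rw [cs.simple_mul_simple_cancel_left]; omega)
      rw [cs.simple_mul_simple_cancel_left] at h2
      refine ⟨⟨leftOp L i, Algebra.subset_adjoin ⟨i, rfl⟩⟩ * h, ?_⟩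
      rw [← h2, ← hh]
      rfl
  intro x
  induction x using Finsupp.induction_linear with
  | zero => exact ⟨0, map_zero _⟩
  | add f g hf hg =>
    obtain ⟨f', rfl⟩ := hf
    obtain ⟨g', rfl⟩ := hg
    exact ⟨f' + g', map_add _ _ _⟩
  | single w a =>
    obtain ⟨h, hh⟩ := key w
    exact ⟨a • h, by rw [map_smul, hh, Finsupp.smul_single, smul_eq_mul, mul_one]⟩

/-- `H` is free over `A`, with coordinates indexed by `W`. -/
noncomputable def heckeEquiv : Hecke L ≃ₗ[Coef Γ] (W →₀ Coef Γ) :=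
  LinearEquiv.ofBijective (evalOne L) ⟨evalOne_injective L, evalOne_surjective L⟩

/-- The basis `(T_w)` of `H`. -/
noncomputable def T : Module.Basis W (Coef Γ) (Hecke L) := Module.Basis.ofRepr (heckeEquiv L)

theorem T_repr (h : Hecke L) :
    (T L).repr h = (h : Module.End (Coef Γ) (W →₀ Coef Γ)) (Finsupp.single 1 1) := rfl

theorem T_apply_single (w : W) :
    (T L w : Module.End (Coef Γ) (W →₀ Coef Γ)) (Finsupp.single 1 1) = Finsupp.single w 1 := by
  rw [← T_repr, Module.Basis.repr_self]

theorem T_simple (i : B) : (T L (cs.simple i) : Module.End (Coef Γ) (W →₀ Coef Γ)) =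
    leftOp L i := by
  have : T L (cs.simple i) = ⟨leftOp L i, Algebra.subset_adjoin ⟨i, rfl⟩⟩ := by
    apply (T L).repr.injective
    rw [Module.Basis.repr_self, T_repr]
    show _ = leftOp L i (Finsupp.single 1 1)
    rw [leftOp_single_lt L (by simp), mul_one]
  rw [this]

theorem T_one : T L 1 = 1 := by
  apply (T L).repr.injective
  rw [Module.Basis.repr_self, T_repr]
  rfl

theorem T_repr_simple_mul (i : B) (h : Hecke L) :
    (T L).repr (T L (cs.simple i) * h) = leftOp L i ((T L).repr h) := by
  rw [T_repr, T_repr, ← T_simple]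
  rfl

/-- `T_s T_w = T_{sw}` if `l(sw) > l(w)`. -/
theorem T_simple_mul_of_lt {i : B} {w : W} (h : cs.length w < cs.length (cs.simple i * w)) :
    T L (cs.simple i) * T L w = T L (cs.simple i * w) := by
  apply (T L).repr.injective
  rw [T_repr_simple_mul, Module.Basis.repr_self, Module.Basis.repr_self, leftOp_single_lt L h]

/-- `T_s T_w = T_{sw} + (q_s - q_s⁻¹) T_w` if `l(sw) < l(w)`. -/
theorem T_simple_mul_of_gt {i : B} {w : W} (h : cs.length (cs.simple i * w) < cs.length w) :
    T L (cs.simple i) * T L w = T L (cs.simple i * w) + xi L i • T L w := by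
  apply (T L).repr.injective
  rw [T_repr_simple_mul, map_add, map_smul, Module.Basis.repr_self, Module.Basis.repr_self,
    leftOp_single, if_neg (not_lt.2 h.le)]

/-- The bar involution of `H`: `∑ a_w T_w ↦ ∑ bar(a_w) (T_{w⁻¹})⁻¹`. -/
noncomputable def bar (h : Hecke L) : Hecke L :=
  ((T L).repr h).sum fun w p => conj p • Ring.inverse (T L w⁻¹)

theorem simple_eq_mul {i : B} {w : W} : cs.simple i * (cs.simple i * w) = w :=
  cs.simple_mul_simple_cancel_left i

theorem T_simple_mul_self (i : B) :
    T L (cs.simple i) * T L (cs.simple i) = 1 + xi L i • T L (cs.simple i) := by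
  rw [T_simple_mul_of_gt L (by simp), cs.simple_mul_simple_self, T_one]

theorem T_mul {x y : W} (h : cs.length (x * y) = cs.length x + cs.length y) :
    T L x * T L y = T L (x * y) := by
  induction hn : cs.length x generalizing x with
  | zero => rw [cs.length_eq_zero_iff.1 hn, T_one, one_mul, one_mul]
  | succ n ih =>
    obtain ⟨i, hi⟩ := cs.exists_leftDescent_of_ne_one (w := x) (by rintro rfl; simp at hn)
    have h1 := cs.isLeftDescent_iff.1 hi
    have h2 := cs.length_mul_le (cs.simple i * x) y
    have h3 := cs.length_simple_mul (x * y) i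
    rw [mul_assoc] at h2
    have h4 := ih (x := cs.simple i * x) (by rw [mul_assoc]; omega) (by omega)
    have h5 := T_simple_mul_of_lt L (i := i) (w := cs.simple i * x)
      (by rw [cs.simple_mul_simple_cancel_left]; omega)
    have h6 := T_simple_mul_of_lt L (i := i) (w := cs.simple i * (x * y))
      (by rw [cs.simple_mul_simple_cancel_left]; omega)
    rw [cs.simple_mul_simple_cancel_left] at h5 h6
    rw [← h5, mul_assoc, h4, mul_assoc, h6]

theorem T_simple_mul_inv (i : B) :
    T L (cs.simple i) * (T L (cs.simple i) - xi L i • (1 : Hecke L)) = 1 := by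
  rw [mul_sub, T_simple_mul_self, mul_smul_comm, mul_one, add_sub_cancel_right]

theorem T_simple_inv_mul (i : B) :
    (T L (cs.simple i) - xi L i • (1 : Hecke L)) * T L (cs.simple i) = 1 := by
  rw [sub_mul, T_simple_mul_self, smul_mul_assoc, one_mul, add_sub_cancel_right]

theorem isUnit_T (w : W) : IsUnit (T L w) := by
  induction hn : cs.length w generalizing w with
  | zero => rw [cs.length_eq_zero_iff.1 hn, T_one]; exact isUnit_one
  | succ n ih =>
    obtain ⟨i, hi⟩ := cs.exists_leftDescent_of_ne_one (w := w) (by rintro rfl; simp at hn)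
    have h1 := cs.isLeftDescent_iff.1 hi
    have h5 := T_simple_mul_of_lt L (i := i) (w := cs.simple i * w)
      (by rw [cs.simple_mul_simple_cancel_left]; omega)
    rw [cs.simple_mul_simple_cancel_left] at h5
    rw [← h5]
    exact IsUnit.mul ⟨⟨_, _, T_simple_mul_inv L i, T_simple_inv_mul L i⟩, rfl⟩
      (ih _ (by omega))

theorem inverse_T_simple (i : B) :
    Ring.inverse (T L (cs.simple i)) = T L (cs.simple i) - xi L i • (1 : Hecke L) :=
  Ring.inverse_unit ⟨_, _, T_simple_mul_inv L i, T_simple_inv_mul L i⟩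

theorem inverse_T_mul {i : B} {w : W} (h : cs.length w < cs.length (cs.simple i * w)) :
    Ring.inverse (T L (cs.simple i * w)⁻¹) =
      (T L (cs.simple i) - xi L i • (1 : Hecke L)) * Ring.inverse (T L w⁻¹) := by
  have h1 := cs.length_simple_mul w i
  rw [mul_inv_rev, cs.inv_simple, ← T_mul L (by
    rw [← cs.length_inv, cs.length_inv w, cs.length_simple, mul_inv_rev, inv_inv, cs.inv_simple]
    omega), ← inverse_T_simple]
  obtain ⟨u, hu⟩ := isUnit_T L w⁻¹
  obtain ⟨v, hv⟩ := isUnit_T L (cs.simple i)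
  rw [← hu, ← hv, ← Units.val_mul, Ring.inverse_unit, Ring.inverse_unit, Ring.inverse_unit,
    mul_inv_rev, Units.val_mul]

theorem bar_add (h k : Hecke L) : bar L (h + k) = bar L h + bar L k := by
  rw [bar, bar, bar, map_add, Finsupp.sum_add_index']
  · intro w; rw [map_zero, zero_smul]
  · intro w p q; rw [map_add, add_smul]

theorem bar_smul (p : Coef Γ) (h : Hecke L) : bar L (p • h) = conj p • bar L h := by
  rw [bar, bar, map_smul, Finsupp.sum_smul_index, Finsupp.smul_sum]
  · simp only [map_mul, mul_smul]
  · intro w; rw [map_zero, zero_smul]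

/-- The bar involution as a semilinear map. -/
noncomputable def barHom : Hecke L →ₛₗ[(conj : Coef Γ →+* Coef Γ)] Hecke L where
  toFun := bar L
  map_add' := bar_add L
  map_smul' := bar_smul L

theorem barHom_apply (h : Hecke L) : barHom L h = bar L h := rfl

theorem bar_T (w : W) : bar L (T L w) = Ring.inverse (T L w⁻¹) := by
  rw [bar, Module.Basis.repr_self, Finsupp.sum_single_index, map_one, one_smul]
  rw [map_zero, zero_smul]

theorem conj_xi (i : B) : conj (xi L i) = -xi L i := by
  rw [xi, map_sub, conj_expo, conj_expo, neg_neg, neg_sub]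

theorem bar_T_simple_mul (i : B) (h : Hecke L) :
    bar L (T L (cs.simple i) * h) = (T L (cs.simple i) - xi L i • (1 : Hecke L)) * bar L h := by
  have key : (barHom L).comp (LinearMap.mulLeft (Coef Γ) (T L (cs.simple i))) =
      (LinearMap.mulLeft (Coef Γ) (T L (cs.simple i) - xi L i • (1 : Hecke L))).comp
        (barHom L) := by
    refine (T L).ext fun w => ?_
    simp only [LinearMap.comp_apply, LinearMap.mulLeft_apply, barHom_apply]
    rcases lt_or_gt_of_ne (cs.length_simple_mul_ne w i) with h1 | h1
    · have h2 := inverse_T_mul L (i := i) (w := cs.simple i * w)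
        (by rwa [cs.simple_mul_simple_cancel_left])
      rw [cs.simple_mul_simple_cancel_left] at h2
      rw [T_simple_mul_of_gt L h1, bar_add, bar_smul, bar_T, bar_T, conj_xi, h2]
      set X := Ring.inverse ((T L) (cs.simple i * w)⁻¹)
      have h4 : ∀ Z : Hecke L, T L (cs.simple i) * Z - xi L i • Z =
          (T L (cs.simple i) - xi L i • (1 : Hecke L)) * Z := by
        intro Z
        rw [sub_mul, smul_mul_assoc, one_mul]
      have h3 : (T L (cs.simple i) - xi L i • (1 : Hecke L)) *
          ((T L (cs.simple i) - xi L i • (1 : Hecke L)) * X) =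
          ((T L (cs.simple i) - xi L i • (1 : Hecke L)) * T L (cs.simple i)) * X -
          xi L i • ((T L (cs.simple i) - xi L i • (1 : Hecke L)) * X) := by
        generalize T L (cs.simple i) - xi L i • (1 : Hecke L) = Y at *
        calc Y * (Y * X) = Y * (T L (cs.simple i) * X - xi L i • X) := by rw [h4]
          _ = _ := by rw [mul_sub, mul_smul_comm, mul_assoc]
      rw [h3, T_simple_inv_mul, one_mul, neg_smul, ← sub_eq_add_neg]
    · rw [T_simple_mul_of_lt L h1, bar_T, bar_T, inverse_T_mul L h1]
  exact LinearMap.congr_fun key h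

/-- The elements of `H` in the span of the `T_y` with `l(y) < n`. -/
noncomputable def low (n : ℕ) : Submodule (Coef Γ) (Hecke L) :=
  Submodule.span (Coef Γ) (T L '' {y | cs.length y < n})

theorem low_mono {m n : ℕ} (h : m ≤ n) : low L m ≤ low L n :=
  Submodule.span_mono (Set.image_mono fun _ hy => lt_of_lt_of_le hy h)

theorem T_mem_low {w : W} {n : ℕ} (h : cs.length w < n) : T L w ∈ low L n :=
  Submodule.subset_span ⟨w, h, rfl⟩

theorem repr_of_mem_low {h : Hecke L} {n : ℕ} (hh : h ∈ low L n) {y : W} (hy : n ≤ cs.length y) :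
    (T L).repr h y = 0 := by
  by_contra hc
  have := (T L).mem_span_image.1 hh (Finsupp.mem_support_iff.2 hc)
  exact absurd this (not_lt.2 hy)

theorem T_simple_mul_mem_low (i : B) {h : Hecke L} {n : ℕ} (hh : h ∈ low L n) :
    T L (cs.simple i) * h ∈ low L (n + 1) := by
  have : low L n ≤ (low L (n + 1)).comap (LinearMap.mulLeft (Coef Γ) (T L (cs.simple i))) := by
    rw [low, Submodule.span_le]
    rintro _ ⟨w, hw, rfl⟩
    have hw' : cs.length w < n := hw
    show T L (cs.simple i) * T L w ∈ low L (n + 1)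
    have h1 := cs.length_simple_mul w i
    rcases lt_or_gt_of_ne (cs.length_simple_mul_ne w i) with h2 | h2
    · rw [T_simple_mul_of_gt L h2]
      exact add_mem (T_mem_low L (by omega)) (Submodule.smul_mem _ _ (T_mem_low L (by omega)))
    · rw [T_simple_mul_of_lt L h2]
      exact T_mem_low L (by omega)
  exact this hh

theorem inverse_T_sub_mem_low (w : W) :
    Ring.inverse (T L w⁻¹) - T L w ∈ low L (cs.length w) := by
  induction hn : cs.length w generalizing w with
  | zero =>
    rw [cs.length_eq_zero_iff.1 hn, inv_one, T_one, Ring.inverse_one, sub_self]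
    exact zero_mem _
  | succ n ih =>
    obtain ⟨i, hi⟩ := cs.exists_leftDescent_of_ne_one (w := w) (by rintro rfl; simp at hn)
    have h1 := cs.isLeftDescent_iff.1 hi
    obtain ⟨u, rfl⟩ : ∃ u, w = cs.simple i * u :=
      ⟨cs.simple i * w, (cs.simple_mul_simple_cancel_left i).symm⟩
    rw [cs.simple_mul_simple_cancel_left] at h1
    have h2 : cs.length u < cs.length (cs.simple i * u) := by omega
    have h3 := ih u (by omega)
    rw [inverse_T_mul L h2, ← T_simple_mul_of_lt L h2]
    have h4 : (T L (cs.simple i) - xi L i • (1 : Hecke L)) * Ring.inverse (T L u⁻¹) -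
        T L (cs.simple i) * T L u = T L (cs.simple i) * (Ring.inverse (T L u⁻¹) - T L u) -
          xi L i • ((Ring.inverse (T L u⁻¹) - T L u) + T L u) := by
      rw [sub_mul, smul_mul_assoc, one_mul, mul_sub, sub_add_cancel]
      abel
    rw [h4]
    exact sub_mem (T_simple_mul_mem_low L i h3) (Submodule.smul_mem _ _
      (add_mem (low_mono L (Nat.le_succ n) h3) (T_mem_low L (by omega))))

/-- An element of `H` fixed by the bar involution with coefficients in `A_{<0}` vanishes. -/
theorem eq_zero_of_bar_eq {h : Hecke L} (hb : bar L h = h)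
    (hn : ∀ y, (T L).repr h y ∈ negPart Γ) : h = 0 := by
  by_contra hc
  have hs : ((T L).repr h).support.Nonempty := by
    rw [Finsupp.support_nonempty_iff]
    exact fun h0 => hc ((T L).repr.map_eq_zero_iff.1 h0)
  obtain ⟨y, hy, hmax⟩ := Finset.exists_max_image _ cs.length hs
  have h1 : (T L).repr (bar L h) y = conj ((T L).repr h y) := by
    rw [bar, Finsupp.sum, map_sum, Finset.sum_apply', Finset.sum_eq_single y]
    · have := repr_of_mem_low L (inverse_T_sub_mem_low L y) le_rfl
      rw [map_sub, Module.Basis.repr_self, Finsupp.sub_apply, Finsupp.single_eq_same,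
        sub_eq_zero] at this
      rw [map_smul, Finsupp.smul_apply, this, smul_eq_mul, mul_one]
    · intro w hw hwy
      have := repr_of_mem_low L (inverse_T_sub_mem_low L w) (hmax w hw)
      rw [map_sub, Module.Basis.repr_self, Finsupp.sub_apply,
        Finsupp.single_eq_of_ne hwy.symm, sub_zero] at this
      rw [map_smul, Finsupp.smul_apply, this, smul_zero]
    · intro h2
      exact absurd hy h2
  rw [hb] at h1
  exact (Finsupp.mem_support_iff.1 hy) (eq_zero_of_conj_eq h1.symm (hn y))

/-- The defining property of the Kazhdan-Lusztig basis element `C_w`: it is fixed by the bar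
involution and congruent to `T_w` modulo `H_{<0} = ∑_y A_{<0} T_y`. -/
def IsKL (w : W) (c : Hecke L) : Prop :=
  bar L c = c ∧ ∀ y, (T L).repr (c - T L w) y ∈ negPart Γ

theorem IsKL.unique {w : W} {c d : Hecke L} (hc : IsKL L w c) (hd : IsKL L w d) : c = d := by
  rw [← sub_eq_zero]
  apply eq_zero_of_bar_eq L
  · have := map_sub (barHom L) c d
    simp only [barHom_apply] at this
    rw [this, hc.1, hd.1]
  · intro y
    have : c - d = (c - T L w) - (d - T L w) := by abel
    rw [this, map_sub, Finsupp.sub_apply]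
    exact sub_mem (hc.2 y) (hd.2 y)

theorem exists_isKL_of_step {w : W}
    (hC : ∀ z, cs.length z < cs.length w → ∃ c, IsKL L z c ∧ c - T L z ∈ low L (cs.length z))
    (k : ℕ) (hk : k ≤ cs.length w) (h : Hecke L) (hb : bar L h = h)
    (hl : h - T L w ∈ low L (cs.length w))
    (hn : ∀ y, k ≤ cs.length y → (T L).repr (h - T L w) y ∈ negPart Γ) :
    ∃ c, IsKL L w c ∧ c - T L w ∈ low L (cs.length w) := by
  induction k generalizing h with
  | zero => exact ⟨h, ⟨hb, fun y => hn y (Nat.zero_le _)⟩, hl⟩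
  | succ k ih =>
    classical
    choose C hC1 hC2 using hC
    choose μ hμ1 hμ2 using fun p : Coef Γ => exists_selfConj p
    set f := (T L).repr (h - T L w) with hf
    let S := f.support.filter fun z => cs.length z = k
    have hS : ∀ z : {z // z ∈ S}, cs.length z.1 < cs.length w := fun z => by
      have := (Finset.mem_filter.1 z.2).2
      omega
    let D : Hecke L := ∑ z ∈ S.attach, μ (f z.1) • C z.1 (hS z)
    have hDlow : D ∈ low L (k + 1) := by
      refine sum_mem fun z _ => Submodule.smul_mem _ _ ?_
      have hz := (Finset.mem_filter.1 z.2).2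
      have h1 := add_mem (low_mono L (Nat.le_succ _) (hC2 z.1 (hS z)))
        (T_mem_low L (Nat.lt_succ_self (cs.length z.1)))
      rw [sub_add_cancel, hz] at h1
      exact h1
    have hDbar : bar L D = D := by
      have h1 := map_sum (barHom L) (fun z => μ (f z.1) • C z.1 (hS z)) S.attach
      simp only [barHom_apply] at h1
      rw [h1]
      refine Finset.sum_congr rfl fun z _ => ?_
      rw [bar_smul, hμ1, (hC1 z.1 (hS z)).1]
    have hDrepr : ∀ y, cs.length y = k → (T L).repr D y = if y ∈ S then μ (f y) else 0 := by
      intro y hy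
      have h1 : ∀ z : {z // z ∈ S}, (T L).repr (μ (f z.1) • C z.1 (hS z)) y =
          if z.1 = y then μ (f y) else 0 := by
        intro z
        have hz := (Finset.mem_filter.1 z.2).2
        have h2 := repr_of_mem_low L (hC2 z.1 (hS z)) (y := y) (by omega)
        rw [map_sub, Module.Basis.repr_self, Finsupp.sub_apply, sub_eq_zero] at h2
        rw [map_smul, Finsupp.smul_apply, h2, Finsupp.single_apply]
        split_ifs with h3
        · rw [h3, smul_eq_mul, mul_one]
        · rw [smul_zero]
      rw [map_sum, Finset.sum_apply', Finset.sum_congr rfl fun z _ => h1 z,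
        Finset.sum_attach S (fun z => if z = y then μ (f y) else 0), Finset.sum_ite_eq' S y]
    have hDlow' := low_mono L hk hDlow
    have hsplit : h - D - T L w = (h - T L w) - D := by abel
    refine ih (by omega) (h - D) ?_ ?_ ?_
    · have h1 := map_sub (barHom L) h D
      simp only [barHom_apply] at h1
      rw [h1, hb, hDbar]
    · rw [hsplit]
      exact sub_mem hl hDlow'
    · intro y hy
      rw [hsplit, map_sub, Finsupp.sub_apply, ← hf]
      rcases Nat.lt_or_ge k (cs.length y) with h1 | h1
      · rw [repr_of_mem_low L hDlow h1, sub_zero]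
        exact hn y h1
      · have h2 : cs.length y = k := le_antisymm h1 hy
        rw [hDrepr y h2]
        split_ifs with h3
        · exact hμ2 (f y)
        · have h4 : f y = 0 := by
            by_contra h5
            exact h3 (Finset.mem_filter.2 ⟨Finsupp.mem_support_iff.2 h5, h2⟩)
          rw [h4, sub_zero]
          exact zero_mem _

theorem exists_isKL (w : W) : ∃ c, IsKL L w c ∧ c - T L w ∈ low L (cs.length w) := by
  induction hn : cs.length w using Nat.strong_induction_on generalizing w with
  | _ n ih =>
    by_cases hw : w = 1
    · subst hw
      refine ⟨1, ⟨?_, ?_⟩, ?_⟩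
      · rw [← T_one, bar_T, inv_one, T_one, Ring.inverse_one]
      · intro y
        rw [T_one, sub_self, map_zero]
        exact zero_mem _
      · rw [T_one, sub_self]
        exact zero_mem _
    · obtain ⟨i, hi⟩ := cs.exists_leftDescent_of_ne_one hw
      have h1 := cs.isLeftDescent_iff.1 hi
      obtain ⟨u, rfl⟩ : ∃ u, w = cs.simple i * u :=
        ⟨cs.simple i * w, (cs.simple_mul_simple_cancel_left i).symm⟩
      rw [cs.simple_mul_simple_cancel_left] at h1
      have h2 : cs.length u < cs.length (cs.simple i * u) := by omega
      obtain ⟨c, hc1, hc2⟩ := ih (cs.length u) (by omega) u rfl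
      subst hn
      set ε : Coef Γ := expo (-L (cs.simple i)) with hε
      have hX : (T L (cs.simple i) + ε • (1 : Hecke L)) * c - T L (cs.simple i * u) =
          T L (cs.simple i) * (c - T L u) + ε • ((c - T L u) + T L u) := by
        rw [← T_simple_mul_of_lt L h2, add_mul, smul_mul_assoc, one_mul, mul_sub, sub_add_cancel]
        abel
      refine exists_isKL_of_step L (fun z hz => ih (cs.length z) hz z rfl)
        (cs.length (cs.simple i * u)) le_rfl ((T L (cs.simple i) + ε • (1 : Hecke L)) * c)
        ?_ ?_ ?_
      · rw [add_mul, bar_add, bar_T_simple_mul, smul_mul_assoc, one_mul, bar_smul, hc1.1, sub_mul,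
          smul_mul_assoc, one_mul, hε, conj_expo, neg_neg, xi, sub_smul]
        abel
      · rw [hX, ← h1]
        exact add_mem (T_simple_mul_mem_low L i hc2) (Submodule.smul_mem _ _
          (add_mem (low_mono L (Nat.le_succ _) hc2) (T_mem_low L (by omega))))
      · intro y hy
        have h3 : (T L (cs.simple i) + ε • (1 : Hecke L)) * c - T L (cs.simple i * u) ∈
            low L (cs.length (cs.simple i * u)) := by
          rw [hX, ← h1]
          exact add_mem (T_simple_mul_mem_low L i hc2) (Submodule.smul_mem _ _
            (add_mem (low_mono L (Nat.le_succ _) hc2) (T_mem_low L (by omega))))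
        rw [repr_of_mem_low L h3 hy]
        exact zero_mem _

/-- The Kazhdan-Lusztig element `C_w`, the unique element with the property `IsKL L w`. -/
noncomputable def klElt (w : W) : Hecke L := (exists_isKL L w).choose

theorem isKL_klElt (w : W) : IsKL L w (klElt L w) := (exists_isKL L w).choose_spec.1

theorem klElt_sub_mem_low (w : W) : klElt L w - T L w ∈ low L (cs.length w) :=
  (exists_isKL L w).choose_spec.2

theorem linearCombination_klElt_injective :
    Function.Injective (Finsupp.linearCombination (Coef Γ) (klElt L)) := by
  refine (injective_iff_map_eq_zero _).2 fun f hf => ?_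
  by_contra hc
  obtain ⟨y, hy, hmax⟩ := Finset.exists_max_image f.support cs.length
    (Finsupp.support_nonempty_iff.2 hc)
  have h1 : (T L).repr (Finsupp.linearCombination (Coef Γ) (klElt L) f) y = f y := by
    rw [Finsupp.linearCombination_apply, Finsupp.sum, map_sum, Finset.sum_apply',
      Finset.sum_eq_single y]
    · have := repr_of_mem_low L (klElt_sub_mem_low L y) le_rfl
      rw [map_sub, Module.Basis.repr_self, Finsupp.sub_apply, Finsupp.single_eq_same,
        sub_eq_zero] at this
      rw [map_smul, Finsupp.smul_apply, this, smul_eq_mul, mul_one]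
    · intro w hw hwy
      have := repr_of_mem_low L (klElt_sub_mem_low L w) (hmax w hw)
      rw [map_sub, Module.Basis.repr_self, Finsupp.sub_apply,
        Finsupp.single_eq_of_ne hwy.symm, sub_zero] at this
      rw [map_smul, Finsupp.smul_apply, this, smul_zero]
    · intro h2
      exact absurd hy h2
  rw [hf, map_zero, Finsupp.zero_apply] at h1
  exact (Finsupp.mem_support_iff.1 hy) h1.symm

theorem linearCombination_klElt_surjective :
    Function.Surjective (Finsupp.linearCombination (Coef Γ) (klElt L)) := by
  have key : ∀ n : ℕ, low L n ≤ LinearMap.range (Finsupp.linearCombination (Coef Γ) (klElt L)) := by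
    intro n
    induction n with
    | zero => simp [low]
    | succ n ih =>
      rw [low, Submodule.span_le]
      rintro _ ⟨w, hw, rfl⟩
      have hw' : cs.length w < n + 1 := hw
      have h1 : T L w = klElt L w - (klElt L w - T L w) := by abel
      rw [h1]
      refine sub_mem ⟨Finsupp.single w 1, by simp⟩ (ih ?_)
      exact low_mono L (by omega) (klElt_sub_mem_low L w)
  intro h
  have h1 : h ∈ LinearMap.range (Finsupp.linearCombination (Coef Γ) (klElt L)) := by
    rw [← (T L).linearCombination_repr h, Finsupp.linearCombination_apply]
    exact sum_mem fun w _ => Submodule.smul_mem _ _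
      (key (cs.length w + 1) (T_mem_low L (Nat.lt_succ_self _)))
  exact h1

/-- The Kazhdan-Lusztig basis `(C_w)` of `H`. -/
noncomputable def C : Module.Basis W (Coef Γ) (Hecke L) :=
  Module.Basis.ofRepr (LinearEquiv.ofBijective _
    ⟨linearCombination_klElt_injective L, linearCombination_klElt_surjective L⟩).symm

theorem C_apply (w : W) : C L w = klElt L w := by
  have : C L w = Finsupp.linearCombination (Coef Γ) (klElt L) (Finsupp.single w 1) := rfl
  rw [this, Finsupp.linearCombination_single, one_smul]

/-- The structure constant `h_{x,y,z}`: the coefficient of `C_z` in `C_x C_y`. -/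
noncomputable def structConst (x y z : W) : Coef Γ := (C L).repr (C L x * C L y) z

/-- The relation `x ←_{L,I} y`: `C_x` occurs in `C_s C_y` for some `s ∈ I`. Here the subset `I` of
the generating set is given by indices. -/
def LeftStep (I : Set B) (x y : W) : Prop :=
  ∃ i ∈ I, structConst L (cs.simple i) y x ≠ 0

/-- The relative Kazhdan-Lusztig left pre-order `x ≤_{L,I} y` on `W`: there is a sequence
`x = x_0, x_1, …, x_k = y` in `W` with `x_{i-1} ←_{L,I} x_i` for all `i`. -/
def RelLeftLE (I : Set B) : W → W → Prop := Relation.ReflTransGen (LeftStep L I)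

/-- The Kazhdan-Lusztig left pre-order `x ≤_L y` on `W`. -/
def LeftLE : W → W → Prop := RelLeftLE L Set.univ

end HeckeAlgebra

section TypeB

/-- The Coxeter matrix of type `B_n`, with the generators `t, s_1, …, s_{n-1}` indexed by
`0, 1, …, n - 1` in this order along the diagram, whose double bond joins `t` and `s_1`. -/
def typeB (n : ℕ) : CoxeterMatrix (Fin n) := (CoxeterMatrix.B n).reindex Fin.revPerm

theorem typeB_apply {n : ℕ} (i j : Fin n) : typeB n i j =
    if i = j then 1
    else if (i : ℕ) = 0 ∧ (j : ℕ) = 1 ∨ (i : ℕ) = 1 ∧ (j : ℕ) = 0 then 4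
    else if (i : ℕ) + 1 = j ∨ (j : ℕ) + 1 = i then 3 else 2 := by
  have hi := i.2
  have hj := j.2
  simp only [typeB, CoxeterMatrix.reindex_apply, CoxeterMatrix.B, Fin.revPerm_symm,
    Fin.revPerm_apply, Matrix.of_apply, Fin.rev_inj, Fin.val_rev]
  by_cases h : i = j
  · simp [h]
  · have h' : (i : ℕ) ≠ j := fun h0 => h (Fin.ext h0)
    rw [if_neg h, if_neg h]
    refine if_congr ?_ rfl (if_congr ?_ rfl rfl) <;> omega

variable {n : ℕ} {W : Type*} [Group W] (cs : CoxeterSystem (typeB n) W)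

/-- The sign character of `W_n` with `t ↦ -1` and `s_k ↦ 1`, used only to see that the `t`-length
is well defined. -/
def tSignGen (i : Fin n) : ℤˣ := if (i : ℕ) = 0 then -1 else 1

theorem tSignGen_liftable : (typeB n).IsLiftable (tSignGen : Fin n → ℤˣ) := by
  intro i j
  rw [typeB_apply]
  have h1 : ∀ u : ℤˣ, u ^ 4 = 1 := fun u => by
    rw [show 4 = 2 * 2 by rfl, pow_mul, Int.units_sq]
  split_ifs with h2 h3 h4
  · rw [h2, pow_one, Int.units_mul_self]
  · exact h1 _
  · have hi : (i : ℕ) ≠ 0 := by omega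
    have hj : (j : ℕ) ≠ 0 := by omega
    simp [tSignGen, hi, hj]
  · exact Int.units_sq _

theorem countP_leftInvSeq (ω : List (Fin n)) :
    (cs.leftInvSeq ω).countP
        (fun t => decide (cs.lift ⟨tSignGen, tSignGen_liftable⟩ t = (-1 : ℤˣ))) =
      ω.countP fun i : Fin n => decide ((i : ℕ) = 0) := by
  induction ω with
  | nil => rfl
  | cons i ω ih =>
    have h1 : ((fun t => decide (cs.lift ⟨tSignGen, tSignGen_liftable⟩ t = (-1 : ℤˣ))) ∘
        (MulAut.conj (cs.simple i))) =
        fun t => decide (cs.lift ⟨tSignGen, tSignGen_liftable⟩ t = (-1 : ℤˣ)) := by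
      funext t
      simp only [Function.comp_apply, MulAut.conj_apply, map_mul, map_inv, mul_inv_cancel_comm]
    rw [CoxeterSystem.leftInvSeq, List.countP_cons, List.countP_cons, List.countP_map, h1, ih,
      cs.lift_apply_simple]
    by_cases h : (i : ℕ) = 0
    · simp [tSignGen, h]
    · simp [tSignGen, h]

/-- The generators of `W_n`: `gen cs 0 = t` and `gen cs k = s_k` for `1 ≤ k ≤ n - 1` (and the
value `1` for `k ≥ n`, which is never used). -/
def gen (k : ℕ) : W := if h : k < n then cs.simple ⟨k, h⟩ else 1

/-- The `t`-length `l_t(w)`: the number of occurrences of `t` in a reduced expression of `w`. -/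
noncomputable def tLength (w : W) : ℕ :=
  (cs.exists_isReduced w).choose.countP fun i : Fin n => decide ((i : ℕ) = 0)

/-- The `t`-length can be read off from any reduced expression. -/
theorem tLength_eq {ω : List (Fin n)} (hω : cs.IsReduced ω) :
    tLength cs (cs.wordProd ω) = ω.countP fun i : Fin n => decide ((i : ℕ) = 0) := by
  classical
  have hs := (cs.exists_isReduced (cs.wordProd ω)).choose_spec
  rw [tLength, ← countP_leftInvSeq cs, ← countP_leftInvSeq cs]
  apply List.Perm.countP_eq
  exact (List.perm_ext_iff_of_nodup hs.1.nodup_leftInvSeq hω.nodup_leftInvSeq).2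
    (mem_leftInvSeq_congr cs hs.1 hω hs.2.symm)

/-- The product `s_k s_{k-1} ⋯ s_1 t`. -/
def descProd : ℕ → W
  | 0 => gen cs 0
  | k + 1 => gen cs (k + 1) * descProd k

/-- The element `a_l = t (s_1 t) (s_2 s_1 t) ⋯ (s_{l-1} s_{l-2} ⋯ s_1 t)`. -/
def aElt : ℕ → W
  | 0 => 1
  | l + 1 => aElt l * descProd cs l

/-- The (indices of the) set `Σ_{l,n-l} = {s_1, …, s_{n-1}} \ {s_l}`; for `l = 0` and `l = n` this
is `{s_1, …, s_{n-1}}`. -/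
def youngGens (n l : ℕ) : Set (Fin n) := {i | (i : ℕ) ≠ 0 ∧ (i : ℕ) ≠ l}

/-- The Young subgroup `S_{l,n-l} = ⟨Σ_{l,n-l}⟩`; for `l = 0` this is `S_n = ⟨s_1, …, s_{n-1}⟩`. -/
def young (l : ℕ) : Subgroup W := Subgroup.closure (cs.simple '' youngGens n l)

/-- The set `X_{l,n-l}` of distinguished left coset representatives of `S_{l,n-l}` in `S_n`: the
elements `w` of `S_n` that have minimal length in `w S_{l,n-l}`. -/
def minReps (l : ℕ) : Set W :=
  {w | w ∈ young cs 0 ∧ ∀ u ∈ young cs l, cs.length w ≤ cs.length (w * u)}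

/-- The triple `p = (a, σ, b)` gives the decomposition `w = a a_l σ b⁻¹` with `l = l_t(w)`,
`σ ∈ S_{l,n-l}` and `a, b ∈ X_{l,n-l}`. -/
def IsDecomp (w : W) (p : W × W × W) : Prop :=
  p.1 ∈ minReps cs (tLength cs w) ∧ p.2.1 ∈ young cs (tLength cs w) ∧
    p.2.2 ∈ minReps cs (tLength cs w) ∧
    w = p.1 * aElt cs (tLength cs w) * p.2.1 * p.2.2⁻¹

/-- The unique triple `(a_w, σ_w, b_w)` with `IsDecomp cs w (a_w, σ_w, b_w)`. -/
noncomputable def decomp (w : W) : W × W × W := Classical.epsilon (IsDecomp cs w)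

/-- The component `σ_w` of `w = a_w a_l σ_w b_w⁻¹`. -/
noncomputable def sigmaPart (w : W) : W := (decomp cs w).2.1

/-- The component `b_w` of `w = a_w a_l σ_w b_w⁻¹`. -/
noncomputable def bPart (w : W) : W := (decomp cs w).2.2

end TypeB

end KazhdanLusztig

namespace KazhdanLusztig

set_option linter.unusedSectionVars false

/-! ### Degrees in the coefficient ring A and the augmentation. -/

section Degree

variable {Γ : Type*} [AddCommGroup Γ] [LinearOrder Γ] [IsOrderedAddMonoid Γ]

/-! Write c_l for the explicit product `aHecke L l`. The left pre-order on elements with l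
occurrences of t is reduced to the relative pre-order on 𝔖_n by a new basis adapted to w = a · a_l ·
v with v = σ_w b_w⁻¹.

In the asymptotic range c_l is C_{a_l}. It is bar invariant by the Hecke relations
(`bar_aHecke_succ`). In the expansion of c_l, and more generally of T_a c_l T_w with w ∈ 𝔖_n and a a
coset representative, every term other than T_{a a_l w} has lost some number m ≥ 1 of sign changes,
which costs m·b, while the factors ξ_s with s ≠ t gain at most m(n-1)a; as b > (n-1)a, these terms
lie in H_{<0} (`T_mul_aHecke_mul_T_sub_mem`). Hence C_{a_l w} = c_l C_w, and by an abstract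
triangularity argument (`kl_triangular`) C_{a a_l w} equals T_a c_l C_w up to terms T_{a'} c_l
C_{w'} with ℓ(a') < ℓ(a) and w' ≤_{L,l} w.

From left to right: c_l intertwines the generators in Σ_{l,n-l} among themselves, and T_t c_l = e^b
c_l for l ≥ 1. So the span of the C_{a a_l w'} with w' ≤_{L,l} w is stable under every T_s, except
that T_t T_{s_1 ⋯ s_l} c_l produces c_{l+1}, whose terms have more occurrences of t. Modulo those it
is a left ideal (`IsAsymptotic.Ts_mul_C_mem`), and uniqueness of the decomposition gives the claim.

From right to left: one uses the chain a a_l w ≤ a_l w ≤ a_l v ≤ d a_l v. The middle step is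
multiplication by c_l. The first holds because C_{a a_l w} has coefficient 1 in T_a C_{a_l w}. The
last needs a non-zero coefficient in the opposite direction, which is found by specialising e^γ ↦ 1.
Modulo larger t-length, the T_d c_l C_w with d ∈ 𝔖_n become simultaneous eigenvectors of the
reflections that change one sign. After multiplication by T_{a⁻¹}, the product of the operators 1 +
r_j for j ≤ l kills each T_{a'} c_l C_{w'} with a' ≠ a and multiplies the term belonging to a by 2^l
(`IsAsymptotic.signProj_mul_C_sub_mem`). -/

theorem exists_of_coeff_mul_ne {p r : Coef Γ} {γ : Γ} (h : (p * r).coeff γ ≠ 0) :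
    ∃ α β, α + β = γ ∧ p.coeff α ≠ 0 ∧ r.coeff β ≠ 0 := by
  classical
  have := AddMonoidAlgebra.support_coeff_mul_subset p r (Finsupp.mem_support_iff.2 h)
  obtain ⟨α, hα, β, hβ, h⟩ := Finset.mem_add.1 this
  exact ⟨α, β, h, Finsupp.mem_support_iff.1 hα, Finsupp.mem_support_iff.1 hβ⟩

/-- The subgroup of `A` spanned by the `e^δ` with `δ ≤ γ`. -/
def degLE (γ : Γ) : AddSubgroup (Coef Γ) where
  carrier := {p | ∀ δ, γ < δ → p.coeff δ = 0}
  zero_mem' := by intro γ _; simp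
  add_mem' := by
    intro p r hp hr γ hγ
    simp [hp γ hγ, hr γ hγ]
  neg_mem' := by
    intro p hp γ hγ
    simp [hp γ hγ]

theorem degLE_mono {γ δ : Γ} (h : γ ≤ δ) : degLE γ ≤ degLE δ :=
  fun _ hp _ hx => hp _ (lt_of_le_of_lt h hx)

theorem mul_mem_degLE {γ δ : Γ} {p r : Coef Γ} (hp : p ∈ degLE γ) (hr : r ∈ degLE δ) :
    p * r ∈ degLE (γ + δ) := by
  intro x hx
  by_contra hc
  obtain ⟨α, β, h, h1, h2⟩ := exists_of_coeff_mul_ne hc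
  have h3 : α ≤ γ := not_lt.1 fun h => h1 (hp _ h)
  have h4 : β ≤ δ := not_lt.1 fun h => h2 (hr _ h)
  exact absurd (add_le_add h3 h4) (by rw [h]; exact not_le.2 hx)

theorem expo_mem_degLE {γ δ : Γ} (h : γ ≤ δ) : expo γ ∈ degLE δ := by
  intro x hx
  simp only [expo, AddMonoidAlgebra.coeff_single]
  exact Finsupp.single_eq_of_ne (by rintro rfl; exact absurd h (not_le.2 hx))

theorem degLE_le_negPart {γ : Γ} (h : γ < 0) : degLE γ ≤ negPart Γ :=
  fun _ hp _ hx => hp _ (lt_of_lt_of_le h hx)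

theorem negPart_mul_mem {p r : Coef Γ} (hp : p ∈ negPart Γ) (hr : r ∈ negPart Γ) :
    p * r ∈ negPart Γ := by
  intro x hx
  by_contra hc
  obtain ⟨α, β, h, h1, h2⟩ := exists_of_coeff_mul_ne hc
  have h3 : α < 0 := not_le.1 fun h => h1 (hp _ h)
  have h4 : β < 0 := not_le.1 fun h => h2 (hr _ h)
  exact absurd (add_neg h3 h4) (by rw [h]; exact not_lt.2 hx)

/-- The augmentation `A → ℤ`, `e^γ ↦ 1`. -/
noncomputable def augmentation (Γ : Type*) [AddCommGroup Γ] : Coef Γ →+* ℤ :=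
  (AddMonoidAlgebra.lift ℤ ℤ Γ (1 : Multiplicative Γ →* ℤ)).toRingHom

theorem augmentation_expo (γ : Γ) : augmentation Γ (expo γ) = 1 := by
  simp [augmentation, expo]

end Degree

/-! ### Hecke algebras of arbitrary Coxeter groups: bar, inversion, and triangularity of
Kazhdan-Lusztig bases. -/

section General

variable {B W : Type*} [Group W] {M : CoxeterMatrix B}
variable {cs : CoxeterSystem M W} {Γ : Type*} [AddCommGroup Γ] [LinearOrder Γ]
  [IsOrderedAddMonoid Γ]
variable (L : WeightFunction cs Γ)

theorem T_repr_mul_simple (i : B) (h : Hecke L) :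
    (T L).repr (h * T L (cs.simple i)) = rightOp L i ((T L).repr h) := by
  have h1 : rightOp L i (Finsupp.single 1 1) = Finsupp.single (cs.simple i) 1 := by
    rw [rightOp_single_lt L (by simp), one_mul]
  rw [T_repr, T_repr, ← Module.End.mul_apply, ← commute_rightOp, Module.End.mul_apply, h1,
    ← T_apply_single L (cs.simple i)]
  rfl

theorem T_mul_simple_of_lt {i : B} {w : W} (h : cs.length w < cs.length (w * cs.simple i)) :
    T L w * T L (cs.simple i) = T L (w * cs.simple i) := by
  apply (T L).repr.injective
  rw [T_repr_mul_simple, Module.Basis.repr_self, Module.Basis.repr_self, rightOp_single_lt L h]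

theorem T_mul_simple_of_gt {i : B} {w : W} (h : cs.length (w * cs.simple i) < cs.length w) :
    T L w * T L (cs.simple i) = T L (w * cs.simple i) + xi L i • T L w := by
  apply (T L).repr.injective
  rw [T_repr_mul_simple, map_add, map_smul, Module.Basis.repr_self, Module.Basis.repr_self,
    rightOp_single, if_neg (not_lt.2 h.le)]

/-- The element `T_s`. -/
noncomputable abbrev Ts (i : B) : Hecke L := T L (cs.simple i)

/-- The inverse of `T_s`. -/
noncomputable def Tinv (i : B) : Hecke L := T L (cs.simple i) - xi L i • (1 : Hecke L)

theorem Ts_mul_Tinv (i : B) : Ts L i * Tinv L i = 1 := T_simple_mul_inv L i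

theorem Tinv_mul_Ts (i : B) : Tinv L i * Ts L i = 1 := T_simple_inv_mul L i

theorem bar_one : bar L 1 = 1 := by
  rw [← T_one, bar_T, inv_one, T_one, Ring.inverse_one]

theorem bar_sub (h k : Hecke L) : bar L (h - k) = bar L h - bar L k := map_sub (barHom L) h k

theorem bar_zero : bar L 0 = 0 := map_zero (barHom L)

theorem bar_Ts_mul (i : B) (h : Hecke L) : bar L (Ts L i * h) = Tinv L i * bar L h :=
  bar_T_simple_mul L i h

theorem bar_Tinv_mul (i : B) (h : Hecke L) : bar L (Tinv L i * h) = Ts L i * bar L h := by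
  rw [Tinv, sub_mul, bar_sub, bar_T_simple_mul, smul_mul_assoc, one_mul, bar_smul, conj_xi,
    sub_mul, smul_mul_assoc, one_mul]
  module

/-- Each T_w is a product of T_s, so linear statements about H only need to survive left
multiplication by one generator. -/
theorem hecke_induction {p : Hecke L → Prop} (h : Hecke L) (h0 : p 0) (one : p 1)
    (add : ∀ x y, p x → p y → p (x + y)) (smul : ∀ (c : Coef Γ) x, p x → p (c • x))
    (mul : ∀ i x, p x → p (Ts L i * x)) : p h := by
  have key : ∀ w : W, p (T L w) := by
    intro w
    induction hn : cs.length w generalizing w with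
    | zero => rw [cs.length_eq_zero_iff.1 hn, T_one]; exact one
    | succ n ih =>
      obtain ⟨i, hi⟩ := cs.exists_leftDescent_of_ne_one (w := w) (by rintro rfl; simp at hn)
      have h1 := cs.isLeftDescent_iff.1 hi
      have h5 := T_simple_mul_of_lt L (i := i) (w := cs.simple i * w)
        (by rw [cs.simple_mul_simple_cancel_left]; omega)
      rw [cs.simple_mul_simple_cancel_left] at h5
      rw [← h5]
      exact mul _ _ (ih _ (by omega))
  rw [← (T L).linearCombination_repr h, Finsupp.linearCombination_apply]
  exact Finset.sum_induction _ p add h0 fun w _ => smul _ _ (key w)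

theorem bar_mul (h k : Hecke L) : bar L (h * k) = bar L h * bar L k := by
  induction h using hecke_induction with
  | h0 => rw [bar_zero, zero_mul, zero_mul, bar_zero]
  | one => rw [bar_one, one_mul, one_mul]
  | add x y hx hy => rw [add_mul, bar_add, hx, hy, bar_add, add_mul]
  | smul c x hx => rw [smul_mul_assoc, bar_smul, hx, bar_smul, smul_mul_assoc]
  | mul i x hx => rw [mul_assoc, bar_Ts_mul, hx, bar_Ts_mul, mul_assoc]

/-- The linear map `T_w ↦ T_{w⁻¹}`. -/
noncomputable def flip : Hecke L →ₗ[Coef Γ] Hecke L :=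
  (T L).constr (Coef Γ) fun w => T L w⁻¹

theorem flip_T (w : W) : flip L (T L w) = T L w⁻¹ := by
  rw [flip, Module.Basis.constr_basis]

theorem flip_one : flip L 1 = 1 := by
  rw [← T_one, flip_T, inv_one]

/-- The right multiplication rule is the mirror image of the left one because ℓ(w⁻¹) = ℓ(w). This
makes `flip` an anti-automorphism. -/
theorem flip_Ts_mul (i : B) (h : Hecke L) : flip L (Ts L i * h) = flip L h * Ts L i := by
  have key : (flip L).comp (LinearMap.mulLeft (Coef Γ) (Ts L i)) =
      (LinearMap.mulRight (Coef Γ) (Ts L i)).comp (flip L) := by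
    refine (T L).ext fun w => ?_
    simp only [LinearMap.comp_apply, LinearMap.mulLeft_apply, LinearMap.mulRight_apply, flip_T]
    have e : (cs.simple i * w)⁻¹ = w⁻¹ * cs.simple i := by rw [mul_inv_rev, cs.inv_simple]
    have l1 : cs.length (w⁻¹ * cs.simple i) = cs.length (cs.simple i * w) := by
      rw [← e, cs.length_inv]
    rcases lt_or_gt_of_ne (cs.length_simple_mul_ne w i) with h1 | h1
    · rw [T_simple_mul_of_gt L h1, map_add, map_smul, flip_T, flip_T, e,
        T_mul_simple_of_gt L (by rwa [l1, cs.length_inv])]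
    · rw [T_simple_mul_of_lt L h1, flip_T, e, T_mul_simple_of_lt L (by rwa [l1, cs.length_inv])]
  exact LinearMap.congr_fun key h

theorem flip_mul (h k : Hecke L) : flip L (h * k) = flip L k * flip L h := by
  induction h using hecke_induction with
  | h0 => simp
  | one => simp [flip_one]
  | add x y hx hy => rw [add_mul, map_add, hx, hy, map_add, mul_add]
  | smul c x hx => rw [smul_mul_assoc, map_smul, hx, map_smul, mul_smul_comm]
  | mul i x hx => rw [mul_assoc, flip_Ts_mul, hx, flip_Ts_mul, mul_assoc]

theorem inverse_flip {h : Hecke L} (hh : IsUnit h) :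
    Ring.inverse (flip L h) = flip L (Ring.inverse h) := by
  have h1 : flip L h * flip L (Ring.inverse h) = 1 := by
    rw [← flip_mul, Ring.inverse_mul_cancel _ hh, flip_one]
  have h2 : flip L (Ring.inverse h) * flip L h = 1 := by
    rw [← flip_mul, Ring.mul_inverse_cancel _ hh, flip_one]
  exact Ring.inverse_unit ⟨flip L h, flip L (Ring.inverse h), h1, h2⟩

theorem bar_flip (h : Hecke L) : bar L (flip L h) = flip L (bar L h) := by
  have key : (barHom L).comp (flip L) = (flip L).comp (barHom L) := by
    refine (T L).ext fun w => ?_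
    simp only [LinearMap.comp_apply, barHom_apply, flip_T, bar_T, inv_inv]
    rw [← inverse_flip L (isUnit_T L _), flip_T, inv_inv]
  exact LinearMap.congr_fun key h

/-- The subgroup `H_{<0} = ∑_y A_{<0} T_y`. -/
def negH : AddSubgroup (Hecke L) where
  carrier := {h | ∀ y, (T L).repr h y ∈ negPart Γ}
  zero_mem' := by intro y; simp [zero_mem]
  add_mem' := by
    intro p r hp hr y
    simpa using add_mem (hp y) (hr y)
  neg_mem' := by
    intro p hp y
    simpa using hp y

theorem smul_T_mem_negH {p : Coef Γ} (hp : p ∈ negPart Γ) (w : W) : p • T L w ∈ negH L := by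
  classical
  intro y
  rw [map_smul, Module.Basis.repr_self, Finsupp.smul_apply, Finsupp.single_apply]
  split_ifs
  · simpa using hp
  · simp [zero_mem]

theorem smul_mem_negH {p : Coef Γ} (hp : p ∈ negPart Γ) {h : Hecke L} (hh : h ∈ negH L) :
    p • h ∈ negH L := by
  intro y
  rw [map_smul, Finsupp.smul_apply]
  exact negPart_mul_mem hp (hh y)

theorem smul_C_mem_negH {p : Coef Γ} (hp : p ∈ negPart Γ) (w : W) : p • C L w ∈ negH L := by
  have h1 : p • C L w = p • (C L w - T L w) + p • T L w := by module
  rw [h1, C_apply]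
  exact add_mem (smul_mem_negH L hp (isKL_klElt L w).2) (smul_T_mem_negH L hp w)

theorem C_eq_of {w : W} {c : Hecke L} (hb : bar L c = c) (hn : c - T L w ∈ negH L) :
    C L w = c := by
  rw [C_apply]
  exact IsKL.unique L (isKL_klElt L w) ⟨hb, hn⟩

theorem bar_C (w : W) : bar L (C L w) = C L w := by
  rw [C_apply]; exact (isKL_klElt L w).1

theorem C_sub_T_mem (w : W) : C L w - T L w ∈ negH L := by
  rw [C_apply]; exact (isKL_klElt L w).2

/-- The map `flip` commutes with bar and merely permutes coefficients, so it respects both defining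
properties of C_w. Its use is for the involution a_l, where it turns a relation for left
multiplication on C_{a_l} into one for right multiplication. -/
theorem flip_C (w : W) : flip L (C L w) = C L w⁻¹ := by
  refine (C_eq_of L ?_ ?_).symm
  · rw [bar_flip, bar_C]
  · intro y
    have h1 := C_sub_T_mem L w y⁻¹
    have h2 : ∀ h : Hecke L, (T L).repr (flip L h) y = (T L).repr h y⁻¹ := by
      intro h
      have h3 : (Finsupp.lapply y).comp ((T L).repr.toLinearMap.comp (flip L)) =
          (Finsupp.lapply y⁻¹).comp (T L).repr.toLinearMap := by
        classical
        refine (T L).ext fun w => ?_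
        simp only [LinearMap.comp_apply, flip_T, LinearEquiv.coe_coe, Module.Basis.repr_self,
          Finsupp.lapply_apply, Finsupp.single_apply, inv_eq_iff_eq_inv]
      exact LinearMap.congr_fun h3 h
    rw [← flip_T, ← map_sub, h2]
    exact h1

theorem C_simple (i : B) :
    C L (cs.simple i) = Ts L i + expo (-L (cs.simple i)) • (1 : Hecke L) := by
  apply C_eq_of
  · have := bar_Ts_mul L i 1
    rw [bar_one, mul_one, mul_one] at this
    rw [bar_add, bar_smul, bar_one, this, conj_expo, neg_neg, Tinv, xi]
    module
  · rw [add_sub_cancel_left, ← T_one]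
    exact smul_T_mem_negH L (expo_mem_negPart (by simpa using L.pos i)) 1

/-- Replace each coefficient of X - b by a bar-fixed one with the same part in degrees ≥ 0 and
subtract the resulting combination Y of the C_y from X. Then X - Y is bar fixed and still congruent
to T_z, so it is C_z, and the whole correction stays in the span of the chosen C_y. -/
theorem C_sub_mem_of_bar_eq {b X : Hecke L} {z : W} {S : Set W} (hX : bar L X = X)
    (hXb : X - b ∈ Submodule.span (Coef Γ) (C L '' S)) (hb : b - T L z ∈ negH L) :
    C L z - b ∈ Submodule.span (Coef Γ) (C L '' S) := by
  choose μ hμ1 hμ2 using fun p : Coef Γ => exists_selfConj p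
  set d := (C L).repr (X - b) with hd
  have hS : ∀ y ∈ d.support, y ∈ S := fun y hy => (C L).mem_span_image.1 hXb hy
  set Y : Hecke L := ∑ y ∈ d.support, μ (d y) • C L y with hY
  have hsum : X - b = ∑ y ∈ d.support, d y • C L y := by
    conv_lhs => rw [← (C L).linearCombination_repr (X - b)]
    rfl
  have hYbar : bar L Y = Y := by
    have h1 := map_sum (barHom L) (fun y => μ (d y) • C L y) d.support
    simp only [barHom_apply] at h1
    rw [hY, h1]
    exact Finset.sum_congr rfl fun y _ => by rw [bar_smul, hμ1, bar_C]
  have hYS : Y ∈ Submodule.span (Coef Γ) (C L '' S) :=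
    sum_mem fun y hy => Submodule.smul_mem _ _ (Submodule.subset_span ⟨y, hS y hy, rfl⟩)
  have hC : C L z = X - Y := by
    apply C_eq_of
    · rw [bar_sub, hX, hYbar]
    · have h1 : X - Y - T L z = (b - T L z) + ∑ y ∈ d.support, (d y - μ (d y)) • C L y := by
        simp only [sub_smul, Finset.sum_sub_distrib]
        rw [← hsum, ← hY]
        abel
      rw [h1]
      exact add_mem hb (sum_mem fun y _ => smul_C_mem_negH L (hμ2 _) y)
  have h2 : C L z - b = (X - b) - Y := by rw [hC]; abel
  rw [h2]
  exact sub_mem hXb hYS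

/-- Comparison of a family `b` of elements of `H` that are congruent to elements of the basis `T`
with the corresponding elements of the Kazhdan-Lusztig basis. -/
theorem kl_triangular {ι : Type*} (b : ι → Hecke L) (z : ι → W) (r : ι → ℕ)
    (hb : ∀ j, b j - T L (z j) ∈ negH L)
    (h0 : ∀ j, r j = 0 → bar L (b j) = b j)
    (hs : ∀ j, r j ≠ 0 → ∃ i j', r j' + 1 = r j ∧ Ts L i * b j' = b j ∧
      ∀ k, ∀ h ∈ Submodule.span (Coef Γ) (b '' {j | r j < k}),
        Ts L i * h ∈ Submodule.span (Coef Γ) (b '' {j | r j < k + 1})) (k : ℕ) :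
    Submodule.span (Coef Γ) (C L '' (z '' {j | r j < k})) =
        Submodule.span (Coef Γ) (b '' {j | r j < k}) ∧
      ∀ j, r j ≤ k → C L (z j) - b j ∈ Submodule.span (Coef Γ) (b '' {j' | r j' < r j}) := by
  induction k with
  | zero =>
    refine ⟨by simp, fun j hj => ?_⟩
    have h1 : C L (z j) = b j := C_eq_of L (h0 j (by omega)) (hb j)
    rw [h1, sub_self]
    exact zero_mem _
  | succ k ih =>
    obtain ⟨ih1, ih2⟩ := ih
    have hmono : ∀ {m n : ℕ}, m ≤ n → Submodule.span (Coef Γ) (b '' {j | r j < m}) ≤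
        Submodule.span (Coef Γ) (b '' {j | r j < n}) := fun h =>
      Submodule.span_mono (Set.image_mono fun j hj => lt_of_lt_of_le hj h)
    have hspan : Submodule.span (Coef Γ) (C L '' (z '' {j | r j < k + 1})) =
        Submodule.span (Coef Γ) (b '' {j | r j < k + 1}) := by
      apply le_antisymm
      · rw [Submodule.span_le]
        rintro _ ⟨_, ⟨j, hj, rfl⟩, rfl⟩
        have hj' : r j < k + 1 := hj
        have h1 := ih2 j (by omega)
        rw [← sub_add_cancel (C L (z j)) (b j)]
        exact add_mem (hmono (by omega) h1) (Submodule.subset_span ⟨j, hj, rfl⟩)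
      · rw [Submodule.span_le]
        rintro _ ⟨j, hj, rfl⟩
        have hj' : r j < k + 1 := hj
        have h1 := hmono (show r j ≤ k by omega) (ih2 j (by omega))
        rw [← ih1] at h1
        have h2 := Submodule.span_mono (R := Coef Γ) (Set.image_mono (f := C L)
          (Set.image_mono (f := z) (show {j | r j < k} ⊆ {j | r j < k + 1} from
            fun j (hj : r j < k) => Nat.lt_succ_of_lt hj))) h1
        rw [← sub_sub_cancel (C L (z j)) (b j)]
        exact sub_mem (Submodule.subset_span ⟨z j, ⟨j, hj, rfl⟩, rfl⟩) h2
    refine ⟨hspan, fun j hj => ?_⟩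
    rcases Nat.lt_or_ge (r j) (k + 1) with h | h
    · exact ih2 j (by omega)
    have hrj : r j = k + 1 := le_antisymm hj h
    obtain ⟨i, j', h1, h2, h3⟩ := hs j (by omega)
    have h4 := ih2 j' (by omega)
    rw [hrj, ← hspan]
    -- The product C_s C_{z_{j'}} is bar fixed for free, and modulo the lower filtration step it
    -- agrees with T_s b_{j'} = b_j. No information on the bar involution in terms of the family b
    -- is needed.
    refine C_sub_mem_of_bar_eq L (X := C L (cs.simple i) * C L (z j')) ?_ ?_ (hb j)
    · rw [bar_mul, bar_C, bar_C]
    · rw [hspan]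
      have h5 : C L (cs.simple i) * C L (z j') - b j = Ts L i * (C L (z j') - b j') +
          expo (-L (cs.simple i)) • ((C L (z j') - b j') + b j') := by
        rw [C_simple, ← h2, add_mul, smul_mul_assoc, one_mul, mul_sub, sub_add_cancel]
        abel
      rw [h5]
      refine add_mem ?_ (Submodule.smul_mem _ _ (add_mem ?_ ?_))
      · exact hmono (by omega) (h3 _ _ h4)
      · exact hmono (by omega) h4
      · exact Submodule.subset_span ⟨j', show r j' < k + 1 by omega, rfl⟩

/-- Stability of a span of Kazhdan-Lusztig elements under left multiplication. -/
theorem Ts_mul_mem_span {I : Set B} {P : Set W} (hP : ∀ x y, LeftStep L I x y → y ∈ P → x ∈ P)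
    {i : B} (hi : i ∈ I) {h : Hecke L} (hh : h ∈ Submodule.span (Coef Γ) (C L '' P)) :
    Ts L i * h ∈ Submodule.span (Coef Γ) (C L '' P) := by
  have key : Submodule.span (Coef Γ) (C L '' P) ≤
      (Submodule.span (Coef Γ) (C L '' P)).comap (LinearMap.mulLeft (Coef Γ) (Ts L i)) := by
    rw [Submodule.span_le]
    rintro _ ⟨y, hy, rfl⟩
    show Ts L i * C L y ∈ Submodule.span (Coef Γ) (C L '' P)
    have h1 : Ts L i * C L y = C L (cs.simple i) * C L y - expo (-L (cs.simple i)) • C L y := by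
      rw [C_simple, add_mul, smul_mul_assoc, one_mul, add_sub_cancel_right]
    rw [h1]
    refine sub_mem ?_ (Submodule.smul_mem _ _ (Submodule.subset_span ⟨y, hy, rfl⟩))
    rw [(C L).mem_span_image]
    intro x hx
    exact hP x y ⟨i, hi, Finsupp.mem_support_iff.1 hx⟩ hy
  exact key hh

/-- C_s differs from T_s by a scalar, so stability of P can be tested with T_s. All upper bounds for
the pre-orders are obtained through this lemma. -/
theorem mem_of_leftStep {P : Submodule (Coef Γ) (Hecke L)} {I : Set B} {x y : W} {S : Set W}
    (h : LeftStep L I x y) (hP : ∀ i ∈ I, Ts L i * C L y ∈ P) (hy : C L y ∈ P)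
    (hS : P ≤ Submodule.span (Coef Γ) (C L '' S)) : x ∈ S := by
  obtain ⟨i, hi, h⟩ := h
  have h1 : C L (cs.simple i) * C L y ∈ P := by
    rw [C_simple, add_mul, smul_mul_assoc, one_mul]
    exact add_mem (hP i hi) (Submodule.smul_mem _ _ hy)
  exact (C L).mem_span_image.1 (hS h1) (Finsupp.mem_support_iff.2 h)

/-- Every Kazhdan-Lusztig element that occurs in `h C_y` lies below `y`. -/
theorem leftLE_of_coeff_ne {x y : W} (h : Hecke L) (hx : (C L).repr (h * C L y) x ≠ 0) :
    LeftLE L x y := by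
  have key : ∀ k : Hecke L, k * C L y ∈ Submodule.span (Coef Γ) (C L '' {x | LeftLE L x y}) := by
    intro k
    induction k using hecke_induction with
    | h0 => rw [zero_mul]; exact zero_mem _
    | one => rw [one_mul]; exact Submodule.subset_span ⟨y, Relation.ReflTransGen.refl, rfl⟩
    | add x y hx hy => rw [add_mul]; exact add_mem hx hy
    | smul c x hx => rw [smul_mul_assoc]; exact Submodule.smul_mem _ _ hx
    | mul i x hx =>
      rw [mul_assoc]
      refine Ts_mul_mem_span L (I := Set.univ) ?_ (Set.mem_univ i) hx
      intro u v huv hv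
      exact Relation.ReflTransGen.head huv hv
  exact (C L).mem_span_image.1 (key h) (Finsupp.mem_support_iff.2 hx)

/-! ### Specialisation at e^γ ↦ 1. -/

/-- The kernel of the augmentation. -/
noncomputable abbrev augIdeal (Γ : Type*) [AddCommGroup Γ] : Ideal (Coef Γ) :=
  RingHom.ker (augmentation Γ)

/-- The submodule of `H` of the elements with coefficients in the kernel of the augmentation. -/
noncomputable def augH : Submodule (Coef Γ) (Hecke L) :=
  augIdeal Γ • (⊤ : Submodule (Coef Γ) (Hecke L))

theorem smul_mem_augH {c : Coef Γ} (hc : augmentation Γ c = 0) (h : Hecke L) : c • h ∈ augH L :=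
  Submodule.smul_mem_smul hc trivial

theorem xi_smul_mem_augH (i : B) (h : Hecke L) : xi L i • h ∈ augH L :=
  smul_mem_augH L (by rw [xi, map_sub, augmentation_expo, augmentation_expo, sub_self]) h

theorem mul_mem_augH (h : Hecke L) {k : Hecke L} (hk : k ∈ augH L) : h * k ∈ augH L := by
  induction hk using Submodule.smul_induction_on' with
  | smul r hr n _ => rw [mul_smul_comm]; exact smul_mem_augH L hr _
  | add x _ y _ hx hy => rw [mul_add]; exact add_mem hx hy

theorem mem_augH_mul {k : Hecke L} (hk : k ∈ augH L) (h : Hecke L) : k * h ∈ augH L := by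
  induction hk using Submodule.smul_induction_on' with
  | smul r hr n _ => rw [smul_mul_assoc]; exact smul_mem_augH L hr _
  | add x _ y _ hx hy => rw [add_mul]; exact add_mem hx hy

theorem coeff_of_mem_augH {k : Hecke L} (hk : k ∈ augH L) (w : W) :
    augmentation Γ ((C L).repr k w) = 0 := by
  induction hk using Submodule.smul_induction_on' with
  | smul r hr n _ =>
    rw [map_smul, Finsupp.smul_apply, smul_eq_mul, map_mul, RingHom.mem_ker.1 hr, zero_mul]
  | add x _ y _ hx hy => rw [map_add, Finsupp.add_apply, map_add, hx, hy, add_zero]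

theorem Ts_mul_T_sub_mem (i : B) (w : W) : Ts L i * T L w - T L (cs.simple i * w) ∈ augH L := by
  rcases lt_or_gt_of_ne (cs.length_simple_mul_ne w i) with h1 | h1
  · rw [T_simple_mul_of_gt L h1, add_sub_cancel_left]
    exact xi_smul_mem_augH L i _
  · rw [T_simple_mul_of_lt L h1, sub_self]
    exact zero_mem _

/-- Every ξ_s has augmentation zero, so modulo `augH` the multiplication of the T_w is that of the
group ring. -/
theorem T_mul_T_sub_mem (v w : W) : T L v * T L w - T L (v * w) ∈ augH L := by
  induction hn : cs.length v generalizing v with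
  | zero => rw [cs.length_eq_zero_iff.1 hn, T_one, one_mul, one_mul, sub_self]; exact zero_mem _
  | succ n ih =>
    obtain ⟨i, hi⟩ := cs.exists_leftDescent_of_ne_one (w := v) (by rintro rfl; simp at hn)
    have h1 := cs.isLeftDescent_iff.1 hi
    have h2 := T_simple_mul_of_lt L (i := i) (w := cs.simple i * v)
      (by rw [cs.simple_mul_simple_cancel_left]; omega)
    rw [cs.simple_mul_simple_cancel_left] at h2
    have h3 := mul_mem_augH L (Ts L i) (ih (cs.simple i * v) (by omega))
    have h4 := Ts_mul_T_sub_mem L i (cs.simple i * v * w)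
    have h5 := add_mem h3 h4
    rw [mul_sub, sub_add_sub_cancel, ← mul_assoc, h2, ← mul_assoc,
      cs.simple_mul_simple_cancel_left] at h5
    exact h5

end General

/-! ### The realisation of type B by signed permutations of ℤ. -/

section SignedPermutations

open Equiv

/-- The generators of the group of signed permutations of `ℤ`. -/
def sgen (k : ℕ) : Perm ℤ :=
  if k = 0 then swap 1 (-1) else swap (k : ℤ) (k + 1) * swap (-k : ℤ) (-k - 1)

theorem sgen_zero_apply (x : ℤ) :
    x = 1 ∧ sgen 0 x = -1 ∨ x = -1 ∧ sgen 0 x = 1 ∨ x ≠ 1 ∧ x ≠ -1 ∧ sgen 0 x = x := by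
  rw [sgen, if_pos rfl, swap_apply_def]
  split_ifs <;> omega

theorem sgen_apply {k : ℕ} (hk : k ≠ 0) (x : ℤ) :
    x = k ∧ sgen k x = k + 1 ∨ x = k + 1 ∧ sgen k x = k ∨ x = -k ∧ sgen k x = -k - 1 ∨
      x = -k - 1 ∧ sgen k x = -k ∨
      x ≠ k ∧ x ≠ k + 1 ∧ x ≠ -k ∧ x ≠ -k - 1 ∧ sgen k x = x := by
  rw [sgen, if_neg hk, Perm.mul_apply, swap_apply_def (-k : ℤ), swap_apply_def]
  split_ifs <;> omega

theorem sgen_mul_self (k : ℕ) : sgen k * sgen k = 1 := by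
  ext x
  rw [Perm.mul_apply, Perm.one_apply]
  rcases Nat.eq_zero_or_pos k with rfl | hk
  · have h1 := sgen_zero_apply x
    have h2 := sgen_zero_apply (sgen 0 x)
    omega
  · have h1 := sgen_apply hk.ne' x
    have h2 := sgen_apply hk.ne' (sgen k x)
    omega

theorem sgen_sgen (k : ℕ) (x : ℤ) : sgen k (sgen k x) = x := by
  rw [← Perm.mul_apply, sgen_mul_self, Perm.one_apply]

theorem sgen_inv (k : ℕ) : (sgen k)⁻¹ = sgen k := inv_eq_of_mul_eq_one_left (sgen_mul_self k)

theorem sgen_neg (k : ℕ) (x : ℤ) : sgen k (-x) = -sgen k x := by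
  rcases Nat.eq_zero_or_pos k with rfl | hk
  · have h1 := sgen_zero_apply x
    have h2 := sgen_zero_apply (-x)
    omega
  · have h1 := sgen_apply hk.ne' x
    have h2 := sgen_apply hk.ne' (-x)
    omega

theorem conj_sgen (f : Perm ℤ) {k : ℕ} (hk : k ≠ 0) :
    f * sgen k * f⁻¹ = swap (f k) (f (k + 1)) * swap (f (-k)) (f (-k - 1)) := by
  rw [sgen, if_neg hk, swap_apply_apply, swap_apply_apply]
  group

theorem conj_sgen_zero (f : Perm ℤ) : f * sgen 0 * f⁻¹ = swap (f 1) (f (-1)) := by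
  rw [sgen, if_pos rfl, swap_apply_apply]

theorem sgen_comm {i j : ℕ} (h : i + 1 < j) : sgen i * sgen j = sgen j * sgen i := by
  have h1 := conj_sgen (sgen i) (k := j) (by omega)
  have e : ∀ x : ℤ, x = j ∨ x = j + 1 ∨ x = -j ∨ x = -j - 1 → sgen i x = x := by
    intro x hx
    rcases Nat.eq_zero_or_pos i with rfl | hi
    · have := sgen_zero_apply x
      omega
    · have := sgen_apply hi.ne' x
      omega
  rw [e _ (by simp), e _ (by simp), e _ (by simp), e _ (by simp)] at h1
  rw [mul_inv_eq_iff_eq_mul] at h1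
  rw [h1, sgen.eq_1 j, if_neg (by omega)]

/-- Both sides are conjugates of one generator by the other, hence products of two transpositions
whose entries can be compared. -/
theorem sgen_braid {i : ℕ} (hi : i ≠ 0) :
    sgen i * sgen (i + 1) * sgen i = sgen (i + 1) * sgen i * sgen (i + 1) := by
  have h1 := conj_sgen (sgen i) (k := i + 1) (by omega)
  have h2 := conj_sgen (sgen (i + 1)) hi
  rw [sgen_inv] at h1 h2
  rw [h1, h2]
  have a1 := sgen_apply hi ((i + 1 : ℕ) : ℤ)
  have a2 := sgen_apply hi ((i + 1 : ℕ) + 1 : ℤ)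
  have a3 := sgen_apply hi (-(i + 1 : ℕ) : ℤ)
  have a4 := sgen_apply hi (-(i + 1 : ℕ) - 1 : ℤ)
  have b1 := sgen_apply (k := i + 1) (by omega) (i : ℤ)
  have b2 := sgen_apply (k := i + 1) (by omega) (i + 1 : ℤ)
  have b3 := sgen_apply (k := i + 1) (by omega) (-i : ℤ)
  have b4 := sgen_apply (k := i + 1) (by omega) (-i - 1 : ℤ)
  congr 2 <;> omega

theorem sgen_braid_four : sgen 0 * sgen 1 * sgen 0 * sgen 1 = sgen 1 * sgen 0 * sgen 1 * sgen 0 := by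
  have h1 := conj_sgen_zero (sgen 1)
  have h2 : sgen 0 * (sgen 1 * sgen 0 * (sgen 1)⁻¹) * (sgen 0)⁻¹ = sgen 1 * sgen 0 * (sgen 1)⁻¹ := by
    have a1 := sgen_apply (k := 1) one_ne_zero 1
    have a2 := sgen_apply (k := 1) one_ne_zero (-1)
    have e1 : sgen 1 1 = 2 := by omega
    have e2 : sgen 1 (-1) = -2 := by omega
    have a3 := sgen_zero_apply 2
    have a4 := sgen_zero_apply (-2)
    have e3 : sgen 0 2 = 2 := by omega
    have e4 : sgen 0 (-2) = -2 := by omega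
    rw [h1, e1, e2, ← swap_apply_apply, e3, e4]
  rw [mul_inv_eq_iff_eq_mul, sgen_inv] at h2
  simpa only [mul_assoc] using h2

theorem sgen_liftable (n : ℕ) : (typeB n).IsLiftable fun i : Fin n => sgen i := by
  intro i j
  have key : ∀ a b : ℕ, a + 1 = b → a ≠ 0 → (sgen a * sgen b) ^ 3 = 1 := by
    rintro a _ rfl ha
    have := sgen_braid ha
    calc (sgen a * sgen (a + 1)) ^ 3 =
        sgen a * sgen (a + 1) * sgen a * (sgen (a + 1) * sgen a * sgen (a + 1)) := by
          simp only [pow_succ, pow_zero, one_mul, mul_assoc]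
      _ = 1 := by
          rw [← this]
          simp only [mul_assoc]
          rw [← mul_assoc (sgen a) (sgen a), sgen_mul_self, one_mul,
            ← mul_assoc (sgen (a + 1)) (sgen (a + 1)), sgen_mul_self, one_mul, sgen_mul_self]
  have key4 : (sgen 0 * sgen 1) ^ 4 = 1 := by
    calc (sgen 0 * sgen 1) ^ 4 = sgen 0 * sgen 1 * sgen 0 * sgen 1 *
        (sgen 0 * sgen 1 * sgen 0 * sgen 1) := by
          simp only [pow_succ, pow_zero, one_mul, mul_assoc]
      _ = 1 := by
          conv_lhs => enter [2]; rw [sgen_braid_four]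
          simp only [mul_assoc]
          rw [← mul_assoc (sgen 1) (sgen 1), sgen_mul_self, one_mul,
            ← mul_assoc (sgen 0) (sgen 0), sgen_mul_self, one_mul,
            ← mul_assoc (sgen 1) (sgen 1), sgen_mul_self, one_mul, sgen_mul_self]
  have key2 : ∀ a b : ℕ, a + 1 < b → (sgen a * sgen b) ^ 2 = 1 := by
    intro a b h
    rw [pow_two]
    conv_lhs => enter [2]; rw [sgen_comm h]
    rw [mul_assoc, ← mul_assoc (sgen b) (sgen b), sgen_mul_self, one_mul, sgen_mul_self]
  have inv : ∀ (a b m : ℕ), (sgen a * sgen b) ^ m = 1 → (sgen b * sgen a) ^ m = 1 := by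
    intro a b m h
    have : sgen b * sgen a = (sgen a * sgen b)⁻¹ := by rw [mul_inv_rev, sgen_inv, sgen_inv]
    rw [this, inv_pow, h, inv_one]
  show (sgen i * sgen j) ^ typeB n i j = 1
  rw [typeB_apply]
  split_ifs with h1 h2 h3
  · rw [h1, pow_one, sgen_mul_self]
  · rcases h2 with ⟨h, h'⟩ | ⟨h, h'⟩ <;> rw [h, h']
    · exact key4
    · exact inv _ _ _ key4
  · rcases h3 with h | h
    · exact key _ _ h (by omega)
    · exact inv _ _ _ (key _ _ h (by omega))
  · rcases lt_trichotomy (i : ℕ) j with h | h | h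
    · exact key2 _ _ (by omega)
    · exact absurd (Fin.ext h) h1
    · exact inv _ _ _ (key2 _ _ (by omega))

end SignedPermutations

/-! ### Windows and the combinatorial notion of ascent. -/

section Window

variable {n : ℕ} {W : Type*} [Group W] (cs : CoxeterSystem (typeB n) W)

/-- The action of `W_n` on `ℤ` by signed permutations. -/
noncomputable def sperm : W →* Equiv.Perm ℤ :=
  cs.lift ⟨fun i : Fin n => sgen i, sgen_liftable n⟩

theorem sperm_simple (i : Fin n) : sperm cs (cs.simple i) = sgen i :=
  cs.lift_apply_simple (sgen_liftable n) i

/-- The inverse of the signed permutation attached to `w`. -/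
noncomputable def win (w : W) (x : ℤ) : ℤ := sperm cs w⁻¹ x

theorem win_one (x : ℤ) : win cs 1 x = x := by simp [win]

theorem win_mul (v w : W) (x : ℤ) : win cs (v * w) x = win cs w (win cs v x) := by
  simp [win]

theorem win_simple (i : Fin n) (x : ℤ) : win cs (cs.simple i) x = sgen i x := by
  rw [win, cs.inv_simple, sperm_simple]

theorem win_simple_mul (i : Fin n) (w : W) (x : ℤ) :
    win cs (cs.simple i * w) x = win cs w (sgen i x) := by
  rw [win_mul, win_simple]

theorem win_inv_win (w : W) (x : ℤ) : win cs w⁻¹ (win cs w x) = x := by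
  rw [← win_mul, mul_inv_cancel, win_one]

theorem win_win_inv (w : W) (x : ℤ) : win cs w (win cs w⁻¹ x) = x := by
  rw [← win_mul, inv_mul_cancel, win_one]

theorem win_injective (w : W) : Function.Injective (win cs w) :=
  Function.LeftInverse.injective (win_inv_win cs w)

theorem length_induction {p : W → Prop} (w : W) (h1 : p 1)
    (hs : ∀ i w, cs.length w < cs.length (cs.simple i * w) → p w → p (cs.simple i * w)) :
    p w := by
  induction hn : cs.length w generalizing w with
  | zero => rw [cs.length_eq_zero_iff.1 hn]; exact h1
  | succ m ih =>
    obtain ⟨i, hi⟩ := cs.exists_leftDescent_of_ne_one (w := w) (by rintro rfl; simp at hn)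
    have h2 := cs.isLeftDescent_iff.1 hi
    have h3 := hs i (cs.simple i * w) (by rw [cs.simple_mul_simple_cancel_left]; omega)
      (ih _ (by omega))
    rwa [cs.simple_mul_simple_cancel_left] at h3

theorem win_neg (w : W) (x : ℤ) : win cs w (-x) = -win cs w x := by
  induction w using length_induction cs generalizing x with
  | h1 => rw [win_one, win_one]
  | hs i w _ ih => rw [win_simple_mul, win_simple_mul, sgen_neg, ih]

theorem sgen_of_gt {k : ℕ} (hk : k < n) {x : ℤ} (hx : (n : ℤ) < x) : sgen k x = x := by
  rcases Nat.eq_zero_or_pos k with rfl | h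
  · have := sgen_zero_apply x
    omega
  · have := sgen_apply h.ne' x
    omega

theorem win_of_gt (w : W) {x : ℤ} (hx : (n : ℤ) < x) : win cs w x = x := by
  induction w using length_induction cs with
  | h1 => rw [win_one]
  | hs i w _ ih => rw [win_simple_mul, sgen_of_gt i.2 hx, ih]

theorem win_zero (w : W) : win cs w 0 = 0 := by
  have := win_neg cs w 0
  rw [neg_zero] at this
  omega

theorem win_ne_zero (w : W) {x : ℤ} (hx : x ≠ 0) : win cs w x ≠ 0 := by
  intro h
  rw [← win_zero cs w] at h
  exact hx (win_injective cs w h)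

theorem win_le (w : W) {x : ℤ} (hx : x ≤ n) : win cs w x ≤ n := by
  by_contra hc
  have h1 := win_of_gt cs w⁻¹ (not_le.1 hc)
  rw [win_inv_win] at h1
  omega

/-- The generator `s_i` is not a left descent of the signed permutation of `w`. -/
def Asc (i : ℕ) (w : W) : Prop := win cs w (sgen i (i + 1)) < win cs w (i + 1)

theorem asc_zero_iff (w : W) : Asc cs 0 w ↔ 0 < win cs w 1 := by
  have h1 := sgen_zero_apply 1
  have h2 : sgen 0 1 = -1 := by omega
  simp only [Asc, Nat.cast_zero, zero_add, h2, win_neg]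
  omega

theorem asc_iff {i : ℕ} (hi : i ≠ 0) (w : W) : Asc cs i w ↔ win cs w i < win cs w (i + 1) := by
  have h1 := sgen_apply hi (i + 1)
  have h2 : sgen i (i + 1) = i := by omega
  rw [Asc, h2]

theorem not_asc_simple_mul {i : Fin n} {w : W} (h : Asc cs i w) : ¬Asc cs i (cs.simple i * w) := by
  rw [Asc, win_simple_mul, win_simple_mul, sgen_sgen]
  exact not_lt.2 (le_of_lt h)

/-- Evaluation of the generators at integers that are given together with their value. -/
theorem sgen_eq {k : ℕ} {x y : ℤ}
    (h : k = 0 ∧ (x = 1 ∧ y = -1 ∨ x = -1 ∧ y = 1 ∨ x ≠ 1 ∧ x ≠ -1 ∧ y = x) ∨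
      k ≠ 0 ∧ (x = k ∧ y = k + 1 ∨ x = k + 1 ∧ y = k ∨ x = -k ∧ y = -k - 1 ∨
      x = -k - 1 ∧ y = -k ∨ x ≠ k ∧ x ≠ k + 1 ∧ x ≠ -k ∧ x ≠ -k - 1 ∧ y = x)) : sgen k x = y := by
  rcases Nat.eq_zero_or_pos k with rfl | hk
  · have := sgen_zero_apply x
    omega
  · have := sgen_apply hk.ne' x
    omega

/-- This and the next two lemmas on longer words treat a dihedral coset: if w is an ascent for both
letters, an alternating word in front of w that is still too short for the braid relation leaves the
other letter an ascent. Each is a comparison of window entries. -/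
theorem asc_simple_mul {i j : Fin n} (hij : i ≠ j) {w : W} (hi : Asc cs i w) (hj : Asc cs j w) :
    Asc cs i (cs.simple j * w) := by
  have hij' : (i : ℕ) ≠ j := fun h => hij (Fin.ext h)
  obtain ⟨i, hi'⟩ := i
  obtain ⟨j, hj'⟩ := j
  simp only at hi hj hij'
  rcases Nat.eq_zero_or_pos i with rfl | h0
  · rw [asc_zero_iff] at hi ⊢
    rw [asc_iff cs (by omega)] at hj
    rw [win_simple_mul]
    rcases Nat.eq_or_lt_of_le (show 1 ≤ j by omega) with rfl | h1
    · rw [sgen_eq (y := 2) (by simp)]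
      norm_num at hj
      omega
    · rwa [sgen_eq (k := j) (y := 1) (by omega)]
  · rw [asc_iff cs (i := i) (by omega)] at hi ⊢
    rw [win_simple_mul, win_simple_mul]
    simp only
    rcases Nat.eq_zero_or_pos j with rfl | h1
    · rw [asc_zero_iff] at hj
      rw [sgen_eq (k := 0) (x := i + 1) (y := i + 1) (by omega)]
      rcases Nat.eq_or_lt_of_le (show 1 ≤ i by omega) with rfl | h2
      · norm_num at hi ⊢
        rw [sgen_eq (y := -1) (by simp), win_neg]
        omega
      · rwa [sgen_eq (y := i) (by omega)]
    · rw [asc_iff cs (by omega)] at hj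
      rcases lt_trichotomy (i + 1) j with h2 | h2 | h2
      · rwa [sgen_eq (y := i) (by omega), sgen_eq (y := i + 1) (by omega)]
      · subst h2
        rw [sgen_eq (y := i) (by omega), sgen_eq (y := i + 1 + 1) (by push_cast; omega)]
        push_cast at hj
        omega
      · rcases Nat.eq_or_lt_of_le (show j + 1 ≤ i by omega) with h3 | h3
        · subst h3
          rw [sgen_eq (y := j) (by push_cast; omega),
            sgen_eq (y := (j + 1 : ℕ) + 1) (by push_cast; omega)]
          push_cast at *
          omega
        · rwa [sgen_eq (y := i) (by omega), sgen_eq (y := i + 1) (by omega)]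

end Window

/-! ### Ascents are length increases; faithfulness of the representation. -/

section Descents

variable {n : ℕ} {W : Type*} [Group W] (cs : CoxeterSystem (typeB n) W)

theorem asc_simple_mul_simple_mul {i j : Fin n} (hij : (i : ℕ) + 1 = j ∨ (j : ℕ) + 1 = i) {w : W}
    (hi : Asc cs i w) (hj : Asc cs j w) : Asc cs i (cs.simple j * (cs.simple i * w)) := by
  obtain ⟨i, hi'⟩ := i
  obtain ⟨j, hj'⟩ := j
  simp only at hi hj hij
  rcases hij with h | h
  · subst h
    rw [asc_iff cs (by omega)] at hj
    rcases Nat.eq_zero_or_pos i with rfl | h0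
    · rw [asc_zero_iff] at hi ⊢
      rw [win_simple_mul, win_simple_mul, sgen_eq (k := 0 + 1) (y := 2) (by simp),
        sgen_eq (k := 0) (y := 2) (by simp)]
      norm_num at hj
      omega
    · rw [asc_iff cs (i := i) (by omega)] at hi ⊢
      rw [win_simple_mul, win_simple_mul, win_simple_mul, win_simple_mul,
        sgen_eq (k := i + 1) (x := i) (y := i) (by push_cast; omega),
        sgen_eq (k := i + 1) (x := i + 1) (y := i + 2) (by push_cast; omega),
        sgen_eq (k := i) (x := i) (y := i + 1) (by omega),
        sgen_eq (k := i) (x := i + 2) (y := i + 2) (by omega)]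
      push_cast at hj
      rw [add_assoc] at hj
      exact hj
  · subst h
    rw [asc_iff cs (i := j + 1) (by omega)] at hi ⊢
    simp only [win_simple_mul]
    rcases Nat.eq_zero_or_pos j with rfl | h0
    · rw [asc_zero_iff] at hj
      norm_num at hi ⊢
      rw [sgen_eq (k := 0) (x := 1) (y := -1) (by simp), sgen_eq (k := 0) (x := 2) (y := 2) (by simp),
        sgen_eq (k := 1) (x := -1) (y := -2) (by simp), sgen_eq (k := 1) (x := 2) (y := 1) (by simp),
        win_neg]
      omega
    · rw [asc_iff cs (i := j) (by omega)] at hj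
      rw [sgen_eq (k := j) (x := (j + 1 : ℕ)) (y := j) (by push_cast; omega),
        sgen_eq (k := j) (x := (j + 1 : ℕ) + 1) (y := j + 2) (by push_cast; omega),
        sgen_eq (k := j + 1) (x := j) (y := j) (by push_cast; omega),
        sgen_eq (k := j + 1) (x := j + 2) (y := j + 1) (by push_cast; omega)]
      exact hj

theorem asc_simple_mul_three {i j : Fin n}
    (hij : (i : ℕ) = 0 ∧ (j : ℕ) = 1 ∨ (i : ℕ) = 1 ∧ (j : ℕ) = 0) {w : W}
    (hi : Asc cs i w) (hj : Asc cs j w) :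
    Asc cs i (cs.simple j * (cs.simple i * (cs.simple j * w))) := by
  obtain ⟨i, hi'⟩ := i
  obtain ⟨j, hj'⟩ := j
  simp only at hi hj hij
  rcases hij with ⟨rfl, rfl⟩ | ⟨rfl, rfl⟩
  · rw [asc_zero_iff] at hi ⊢
    simp only [win_simple_mul]
    rwa [sgen_eq (k := 1) (x := 1) (y := 2) (by simp), sgen_eq (k := 0) (x := 2) (y := 2) (by simp),
      sgen_eq (k := 1) (x := 2) (y := 1) (by simp)]
  · rw [asc_iff cs (i := 1) (by omega)] at hi ⊢
    simp only [win_simple_mul]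
    norm_num at hi ⊢
    rw [sgen_eq (k := 0) (x := 1) (y := -1) (by simp), sgen_eq (k := 0) (x := 2) (y := 2) (by simp),
      sgen_eq (k := 1) (x := -1) (y := -2) (by simp), sgen_eq (k := 1) (x := 2) (y := 1) (by simp),
      sgen_eq (k := 0) (x := -2) (y := -2) (by simp), sgen_eq (k := 0) (x := 1) (y := -1) (by simp),
      win_neg, win_neg]
    omega

theorem asc_one (i : Fin n) : Asc cs i 1 := by
  obtain ⟨i, hi⟩ := i
  rcases Nat.eq_zero_or_pos i with rfl | h
  · rw [asc_zero_iff, win_one]; norm_num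
  · rw [asc_iff cs h.ne', win_one, win_one]; omega

/-- A descent s_j of w starts the removal of the letters j, i, j, i, … until an element with both
letters ascending is reached. If as many letters come off as the order of s_i s_j, that braid
relation would shorten s_i w, contradicting the hypothesis; otherwise the dihedral lemmas above
apply to the remaining element. -/
theorem asc_of_length_lt {i : Fin n} {w : W} (h : cs.length w < cs.length (cs.simple i * w)) :
    Asc cs i w := by
  induction hn : cs.length w using Nat.strong_induction_on generalizing w i with
  | _ m ih =>
  subst hn
  rcases eq_or_ne w 1 with rfl | hw
  · exact asc_one cs i
  obtain ⟨j, hj⟩ := cs.exists_leftDescent_of_ne_one hw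
  have hj1 := cs.isLeftDescent_iff.1 hj
  have hij : i ≠ j := by rintro rfl; omega
  have hij' : (i : ℕ) ≠ j := fun h => hij (Fin.ext h)
  have up : ∀ {k : Fin n} {v : W}, cs.length (cs.simple k * v) < cs.length v →
      ∃ u, v = cs.simple k * u ∧ cs.length v = cs.length u + 1 ∧
        cs.length u < cs.length (cs.simple k * u) := by
    intro k v hv
    refine ⟨cs.simple k * v, (cs.simple_mul_simple_cancel_left k).symm, ?_, ?_⟩
    · rcases cs.length_simple_mul v k <;> omega
    · rwa [cs.simple_mul_simple_cancel_left]
  have case : ∀ {k : Fin n} {v : W}, cs.length (cs.simple k * v) < cs.length v ∨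
      cs.length v < cs.length (cs.simple k * v) := fun {k v} =>
    lt_or_gt_of_ne (cs.length_simple_mul_ne v k)
  have le : ∀ (k : Fin n) (v : W), cs.length (cs.simple k * v) ≤ cs.length v + 1 := fun k v => by
    rcases cs.length_simple_mul v k <;> omega
  obtain ⟨v1, rfl, l1, u1⟩ := up (k := j) (v := w) (by omega)
  have A1 := ih _ (by omega) u1 rfl
  rcases case (k := i) (v := v1) with c1 | c1
  swap
  · exact asc_simple_mul cs hij (ih _ (by omega) c1 rfl) A1
  obtain ⟨v2, rfl, l2, u2⟩ := up c1
  have A2 := ih _ (by omega) u2 rfl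
  have rel : ∀ m, m = typeB n i j → (cs.simple i * cs.simple j) ^ m = 1 := by
    rintro _ rfl; exact cs.simple_mul_simple_pow i j
  by_cases m2 : (i : ℕ) + 1 = j ∨ (j : ℕ) + 1 = i
  swap
  · exfalso
    have h2 := rel 2 (by rw [typeB_apply, if_neg hij, if_neg (by omega), if_neg m2])
    have h3 : cs.simple i * (cs.simple j * (cs.simple i * v2)) = cs.simple j * v2 := by
      have : cs.simple i * cs.simple j * cs.simple i = cs.simple j := by
        rw [pow_two] at h2
        have := eq_inv_of_mul_eq_one_left h2
        rw [mul_inv_rev, cs.inv_simple, cs.inv_simple] at this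
        rw [this, cs.simple_mul_simple_cancel_right]
      rw [← mul_assoc, ← mul_assoc, this]
    rw [h3] at h
    have := le j v2
    omega
  rcases case (k := j) (v := v2) with c2 | c2
  swap
  · exact asc_simple_mul_simple_mul cs m2 A2 (ih _ (by omega) c2 rfl)
  obtain ⟨v3, rfl, l3, u3⟩ := up c2
  have A3 := ih _ (by omega) u3 rfl
  by_cases m4 : (i : ℕ) = 0 ∧ (j : ℕ) = 1 ∨ (i : ℕ) = 1 ∧ (j : ℕ) = 0
  swap
  · exfalso
    have h2 := rel 3 (by rw [typeB_apply, if_neg hij, if_neg m4, if_pos m2])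
    have h3 : cs.simple i * (cs.simple j * (cs.simple i * (cs.simple j * v3))) =
        cs.simple j * (cs.simple i * v3) := by
      have : cs.simple i * cs.simple j * cs.simple i * cs.simple j =
          cs.simple j * cs.simple i := by
        rw [pow_succ, pow_two] at h2
        have := eq_inv_of_mul_eq_one_left h2
        rw [mul_inv_rev, cs.inv_simple, cs.inv_simple] at this
        rw [← this]; simp only [mul_assoc]
      have := congrArg (· * v3) this
      simpa only [mul_assoc] using this
    rw [h3] at h
    have := le j (cs.simple i * v3)
    have := le i v3
    omega
  rcases case (k := i) (v := v3) with c3 | c3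
  swap
  · exact asc_simple_mul_three cs m4 (ih _ (by omega) c3 rfl) A3
  exfalso
  obtain ⟨v4, rfl, l4, u4⟩ := up c3
  have h2 := rel 4 (by rw [typeB_apply, if_neg hij, if_pos m4])
  have h3 : cs.simple i * (cs.simple j * (cs.simple i * (cs.simple j * (cs.simple i * v4)))) =
      cs.simple j * (cs.simple i * (cs.simple j * v4)) := by
    have : cs.simple i * cs.simple j * cs.simple i * cs.simple j * cs.simple i =
        cs.simple j * cs.simple i * cs.simple j := by
      have h4 : cs.simple i * cs.simple j * (cs.simple i * cs.simple j) * cs.simple i *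
          (cs.simple j * (cs.simple i * cs.simple j)) = 1 := by
        rw [pow_succ, pow_succ, pow_two] at h2
        rw [← h2]; simp only [mul_assoc]
      have := eq_inv_of_mul_eq_one_left h4
      rw [mul_inv_rev, mul_inv_rev, cs.inv_simple, cs.inv_simple] at this
      rw [← this]; simp only [mul_assoc]
    have := congrArg (· * v4) this
    simpa only [mul_assoc] using this
  rw [h3] at h
  have := le j (cs.simple i * (cs.simple j * v4))
  have := le i (cs.simple j * v4)
  have := le j v4
  omega

theorem length_lt_iff (i : Fin n) (w : W) :
    cs.length w < cs.length (cs.simple i * w) ↔ Asc cs i w := by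
  refine ⟨asc_of_length_lt cs, fun h => ?_⟩
  by_contra hc
  have h1 := lt_of_le_of_ne (not_lt.1 hc) (cs.length_simple_mul_ne w i)
  have h2 := asc_of_length_lt cs (i := i) (w := cs.simple i * w)
    (by rwa [cs.simple_mul_simple_cancel_left])
  have h3 := not_asc_simple_mul cs h2
  rw [cs.simple_mul_simple_cancel_left] at h3
  exact h3 h

theorem length_gt_iff (i : Fin n) (w : W) :
    cs.length (cs.simple i * w) < cs.length w ↔ ¬Asc cs i w := by
  rw [← length_lt_iff]
  have := cs.length_simple_mul_ne w i
  omega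

theorem length_mul_lt_iff (i : Fin n) (w : W) :
    cs.length w < cs.length (w * cs.simple i) ↔ Asc cs i w⁻¹ := by
  rw [← length_lt_iff, ← cs.length_inv w, ← cs.length_inv (w * cs.simple i), mul_inv_rev,
    cs.inv_simple]

theorem eq_one_of_asc {w : W} (h : ∀ i : Fin n, Asc cs i w) : w = 1 := by
  by_contra hc
  obtain ⟨j, hj⟩ := cs.exists_leftDescent_of_ne_one hc
  exact (length_gt_iff cs j w).1 hj (h j)

theorem eq_one_of_win {w : W} (h : ∀ x, win cs w x = x) : w = 1 :=
  eq_one_of_asc cs fun i => by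
    have := asc_one cs i
    simp only [Asc, h, win_one] at this ⊢
    exact this

/-- An element acting trivially has no left descent, so it is 1; oddness of windows reduces the
comparison to positive positions. Identities in W_n are henceforth checked on windows. -/
theorem ext_win {v w : W} (h : ∀ x, 0 < x → win cs v x = win cs w x) : v = w := by
  have h' : ∀ x, win cs v x = win cs w x := by
    intro x
    rcases lt_trichotomy x 0 with hx | rfl | hx
    · have := h (-x) (by omega)
      rw [win_neg, win_neg] at this
      omega
    · rw [win_zero, win_zero]
    · exact h x hx
  rw [← mul_inv_eq_one]
  apply eq_one_of_win cs
  intro x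
  rw [win_mul, h', win_inv_win]

end Descents

/-! ### Young subgroups and their coset representatives in terms of windows. -/

section Young

variable {n : ℕ} {W : Type*} [Group W] (cs : CoxeterSystem (typeB n) W)

theorem sgen_pos {k : ℕ} (hk : k ≠ 0) {x : ℤ} (hx : 0 < x) : 0 < sgen k x := by
  have := sgen_apply hk x
  omega

theorem sgen_le_iff {k l : ℕ} (hk : k ≠ 0) (hl : k ≠ l) {x : ℤ} (hx : 0 < x) :
    sgen k x ≤ l ↔ x ≤ l := by
  have := sgen_apply hk x
  omega

theorem simple_mem_young {l : ℕ} {i : Fin n} (hi : i ∈ youngGens n l) :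
    cs.simple i ∈ young cs l :=
  Subgroup.subset_closure ⟨i, hi, rfl⟩

theorem win_of_mem_young {l : ℕ} {w : W} (hw : w ∈ young cs l) {x : ℤ} (hx : 0 < x) :
    0 < win cs w x ∧ (win cs w x ≤ l ↔ x ≤ l) := by
  induction hw using Subgroup.closure_induction generalizing x with
  | mem w hw =>
    obtain ⟨i, hi, rfl⟩ := hw
    rw [win_simple]
    exact ⟨sgen_pos hi.1 hx, sgen_le_iff hi.1 hi.2 hx⟩
  | one => rw [win_one]; exact ⟨hx, Iff.rfl⟩
  | mul v w _ _ hv hw =>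
    rw [win_mul]
    exact ⟨(hw (hv hx).1).1, (hw (hv hx).1).2.trans (hv hx).2⟩
  | inv w _ hw =>
    have hpos : 0 < win cs w⁻¹ x := by
      by_contra hc
      have h0 : win cs w⁻¹ x ≠ 0 := win_ne_zero cs _ hx.ne'
      have h1 := (hw (x := -win cs w⁻¹ x) (by omega)).1
      rw [win_neg, win_win_inv] at h1
      omega
    have := (hw hpos).2
    rw [win_win_inv] at this
    exact ⟨hpos, this.symm⟩

/-- Remove left descents one at a time: positivity forbids t, and stability of [1, l] forbids s_l,
so only letters from Σ_{l,n-l} come off and both conditions persist. -/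
theorem mem_young_of_win {l : ℕ} {w : W} (hp : ∀ x, 0 < x → 0 < win cs w x)
    (hl : ∀ x : ℤ, 0 < x → x ≤ l → win cs w x ≤ l) : w ∈ young cs l := by
  induction w using length_induction cs with
  | h1 => exact one_mem _
  | hs i w h ih =>
    have hi : (i : ℕ) ≠ 0 := by
      intro hi
      have h1 := hp 1 one_pos
      rw [length_lt_iff, hi, asc_zero_iff] at h
      rw [win_simple_mul, hi, sgen_eq (y := -1) (by simp), win_neg] at h1
      omega
    have hil : (i : ℕ) ≠ l := by
      rintro rfl
      rw [length_lt_iff, asc_iff cs hi] at h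
      simp only [win_simple_mul] at hp hl
      have h1 := hl i (by omega) le_rfl
      rw [sgen_eq (y := i + 1) (by omega)] at h1
      have hmaps : ∀ x ∈ Finset.Icc (1 : ℤ) i,
          win cs w (sgen i x) ∈ Finset.Icc (1 : ℤ) i := by
        intro x hx
        rw [Finset.mem_Icc] at hx ⊢
        exact ⟨hp x (by omega), hl x (by omega) (by omega)⟩
      -- By pigeonhole the block [1, l] is mapped onto itself. A descent at l would send l + 1 to a
      -- smaller positive value than l, hence also into [1, l], contradicting injectivity.
      have hsurj := Finset.surjOn_of_injOn_of_card_le _ hmaps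
        (fun x _ y _ hxy => (sgen i).injective (win_injective cs w hxy)) le_rfl
      have h3 := hp (i + 1) (by omega)
      rw [sgen_eq (y := i) (by omega)] at h3
      obtain ⟨x, hx, hx'⟩ := hsurj (Finset.mem_coe.2 (Finset.mem_Icc.2
        ⟨show 1 ≤ win cs w i by omega, show win cs w i ≤ i by omega⟩))
      have h4 := win_injective cs w hx'
      have h5 := Finset.mem_Icc.1 (Finset.mem_coe.1 hx)
      have h6 := sgen_apply hi x
      omega
    refine mul_mem (simple_mem_young cs ⟨hi, hil⟩) (ih ?_ ?_)
    · intro x hx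
      have := hp (sgen i x) (sgen_pos hi hx)
      rwa [win_simple_mul, sgen_sgen] at this
    · intro x hx hxl
      have := hl (sgen i x) (sgen_pos hi hx) ((sgen_le_iff hi hil hx).2 hxl)
      rwa [win_simple_mul, sgen_sgen] at this

theorem mem_young_zero {w : W} (hp : ∀ x, 0 < x → 0 < win cs w x) : w ∈ young cs 0 :=
  mem_young_of_win cs hp fun x hx hx' => by omega

theorem young_le (l : ℕ) : young cs l ≤ young cs 0 :=
  fun _ hw => mem_young_zero cs fun _ hx => (win_of_mem_young cs hw hx).1

theorem win_pos {w : W} (hw : w ∈ young cs 0) {x : ℤ} (hx : 0 < x) : 0 < win cs w x :=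
  (win_of_mem_young cs hw hx).1

theorem win_pos_iff {w : W} (hw : w ∈ young cs 0) (x : ℤ) : 0 < win cs w x ↔ 0 < x := by
  refine ⟨fun h => ?_, win_pos cs hw⟩
  have := win_pos cs (inv_mem hw) h
  rwa [win_inv_win] at this

theorem ne_zero_of_not_asc {w : W} (hw : w ∈ young cs 0) {i : Fin n} (h : ¬Asc cs i w) :
    (i : ℕ) ≠ 0 := by
  intro hi
  rw [hi, asc_zero_iff] at h
  exact h (win_pos cs hw one_pos)

theorem simple_mem_young_zero {i : Fin n} (hi : (i : ℕ) ≠ 0) : cs.simple i ∈ young cs 0 :=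
  simple_mem_young cs ⟨hi, hi⟩

/-- Elements of `S_n` all of whose right descents lie outside `S_{l,n-l}`. -/
structure IsRep (l : ℕ) (a : W) : Prop where
  mem : a ∈ young cs 0
  lt : ∀ i ∈ youngGens n l, cs.length a < cs.length (a * cs.simple i)

theorem isRep_of_mem_minReps {l : ℕ} {a : W} (ha : a ∈ minReps cs l) : IsRep cs l a :=
  ⟨ha.1, fun i hi => lt_of_le_of_ne (ha.2 _ (simple_mem_young cs hi))
    (cs.length_mul_simple_ne a i).symm⟩

theorem isRep_one (l : ℕ) : IsRep cs l 1 := ⟨one_mem _, fun i _ => by simp⟩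

variable {cs}

theorem IsRep.simple_mul {l : ℕ} {a : W} (ha : IsRep cs l a) {i : Fin n}
    (h : cs.length (cs.simple i * a) < cs.length a) : IsRep cs l (cs.simple i * a) := by
  refine ⟨mul_mem (simple_mem_young_zero cs (ne_zero_of_not_asc cs ha.mem
    ((length_gt_iff cs i a).1 h))) ha.mem, fun j hj => ?_⟩
  have h1 := ha.lt j hj
  have h2 := cs.length_simple_mul (a * cs.simple j) i
  rw [mul_assoc]
  omega

/-- Deodhar's lemma: if s_i a is no longer a representative, some s_j shortens it from the right
although it lengthens a, and the exchange property then forces s_i a = a s_j. -/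
theorem IsRep.simple_mul_or {l : ℕ} {a : W} (ha : IsRep cs l a) {i : Fin n} (hi : (i : ℕ) ≠ 0)
    (h : cs.length a < cs.length (cs.simple i * a)) :
    IsRep cs l (cs.simple i * a) ∨ ∃ j ∈ youngGens n l, cs.simple i * a = a * cs.simple j := by
  by_cases hc : ∀ j ∈ youngGens n l,
      cs.length (cs.simple i * a) < cs.length (cs.simple i * a * cs.simple j)
  · exact Or.inl ⟨mul_mem (simple_mem_young_zero cs hi) ha.mem, hc⟩
  · push Not at hc
    obtain ⟨j, hj, hc⟩ := hc
    have h1 := ha.lt j hj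
    have h2 := cs.length_mul_simple (cs.simple i * a) j
    have h3 := cs.length_simple_mul a i
    have h4 := cs.length_mul_simple a j
    refine Or.inr ⟨j, hj, mul_eq_mul_of_length cs i j a h ?_⟩
    rw [← mul_assoc]
    omega

theorem IsRep.win_lt {l : ℕ} {a : W} (ha : IsRep cs l a) {x y : ℤ} (hx : 0 < x) (hxy : x < y)
    (hy : y ≤ n) (hl : y ≤ l ∨ l < x) : win cs a⁻¹ x < win cs a⁻¹ y := by
  obtain ⟨k, rfl⟩ : ∃ k : ℕ, y = x + 1 + k := ⟨(y - x - 1).toNat, by omega⟩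
  have step : ∀ z : ℤ, 0 < z → z + 1 ≤ n → z ≠ l → win cs a⁻¹ z < win cs a⁻¹ (z + 1) := by
    intro z hz hzn hzl
    obtain ⟨m, rfl⟩ : ∃ m : ℕ, z = m := ⟨z.toNat, by omega⟩
    have h1 := ha.lt ⟨m, by omega⟩ ⟨show m ≠ 0 by omega, show m ≠ l by omega⟩
    rw [length_mul_lt_iff, asc_iff cs (show m ≠ 0 by omega)] at h1
    exact h1
  induction k with
  | zero => push_cast at *; rw [add_zero]; exact step x hx (by omega) (by omega)
  | succ k ih =>
    have h1 := ih (by omega) (by push_cast at *; omega) (by push_cast at *; omega)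
    have h2 := step (x + 1 + k) (by omega) (by push_cast at *; omega) (by push_cast at *; omega)
    push_cast
    rw [← add_assoc]
    exact h1.trans h2

/-- Since u⁻¹ preserves the blocks [1, l] and (l, n], on which both a⁻¹ and (au)⁻¹ increase, u⁻¹ has
no descent within a block; none is possible across the blocks either. -/
theorem IsRep.eq_one {l : ℕ} {a u : W} (ha : IsRep cs l a) (hu : u ∈ young cs l)
    (hau : IsRep cs l (a * u)) : u = 1 := by
  rw [← inv_eq_one]
  apply eq_one_of_asc cs
  intro i
  have hu' := inv_mem hu
  by_cases hi : (i : ℕ) = 0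
  · rw [hi, asc_zero_iff]
    exact (win_of_mem_young cs hu' one_pos).1
  rw [asc_iff cs hi]
  have p1 := win_of_mem_young cs hu' (x := i) (by omega)
  have p2 := win_of_mem_young cs hu' (x := i + 1) (by omega)
  by_cases hl : (i : ℕ) = l
  · rw [← hl] at p1 p2
    omega
  · have h1 := hau.win_lt (x := i) (y := i + 1) (by omega) (by omega) (by have := i.2; omega)
      (by omega)
    rw [mul_inv_rev, win_mul, win_mul] at h1
    by_contra hc
    have hne : win cs u⁻¹ i ≠ win cs u⁻¹ (i + 1) := fun h => by
      have := win_injective cs _ h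
      omega
    have h2 := ha.win_lt p2.1 (lt_of_le_of_ne (not_lt.1 hc) hne.symm)
      (win_le cs _ (by have := i.2; omega)) (by omega)
    omega

end Young

/-! ### The elements a_l, the t-length as a number of sign changes, and the decomposition a · a_l ·
v. -/

section Decomposition

variable {n : ℕ} {W : Type*} [Group W] (cs : CoxeterSystem (typeB n) W)

theorem gen_of_lt {k : ℕ} (h : k < n) : gen cs k = cs.simple ⟨k, h⟩ := dif_pos h

theorem win_gen_mul {k : ℕ} (h : k < n) (w : W) (x : ℤ) :
    win cs (gen cs k * w) x = win cs w (sgen k x) := by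
  rw [gen_of_lt cs h, win_simple_mul]

theorem win_gen {k : ℕ} (h : k < n) (x : ℤ) : win cs (gen cs k) x = sgen k x := by
  rw [gen_of_lt cs h, win_simple]

theorem win_descProd {l : ℕ} (hl : l < n) {x : ℤ} (hx : 0 < x) :
    win cs (descProd cs l) x = if x ≤ l then x + 1 else if x = l + 1 then -1 else x := by
  induction l generalizing x with
  | zero =>
    rw [descProd, win_gen cs hl]
    have := sgen_zero_apply x
    push_cast
    split_ifs <;> omega
  | succ l ih =>
    have h1 := sgen_apply (k := l + 1) (by omega) x
    rw [descProd, win_gen_mul cs hl, ih (by omega) (by omega)]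
    push_cast at *
    split_ifs <;> omega

theorem win_aElt {l : ℕ} (hl : l ≤ n) {x : ℤ} (hx : 0 < x) :
    win cs (aElt cs l) x = if x ≤ l then -(l + 1 - x) else x := by
  induction l generalizing x with
  | zero => rw [aElt, win_one, if_neg (by push_cast; omega)]
  | succ l ih =>
    rw [aElt, win_mul, ih (by omega) hx]
    split_ifs with h1 h2 h2
    · rw [win_neg, win_descProd cs (by omega) (by omega), if_pos (by omega)]
      push_cast; ring
    · push_cast at h2; omega
    · rw [win_descProd cs (by omega) hx, if_neg h1, if_pos (by push_cast at h2; omega)]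
      push_cast at *; omega
    · rw [win_descProd cs (by omega) hx, if_neg h1, if_neg (by push_cast at h2; omega)]

theorem aElt_mul_self {l : ℕ} (hl : l ≤ n) : aElt cs l * aElt cs l = 1 := by
  apply ext_win cs
  intro x hx
  rw [win_mul, win_one, win_aElt cs hl hx]
  split_ifs with h
  · rw [win_neg, win_aElt cs hl (by omega), if_pos (by omega)]
    ring
  · rw [win_aElt cs hl hx, if_neg h]

theorem aElt_inv {l : ℕ} (hl : l ≤ n) : (aElt cs l)⁻¹ = aElt cs l :=
  inv_eq_of_mul_eq_one_left (aElt_mul_self cs hl)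

/-- The element `s_1 s_2 ⋯ s_k`. -/
def ascProd : ℕ → W
  | 0 => 1
  | k + 1 => ascProd k * gen cs (k + 1)

theorem win_ascProd {k : ℕ} (hk : k < n) {x : ℤ} (hx : 0 < x) :
    win cs (ascProd cs k) x = if x = 1 then (k : ℤ) + 1 else if x ≤ k + 1 then x - 1 else x := by
  induction k generalizing x with
  | zero => rw [ascProd, win_one]; push_cast; split_ifs <;> omega
  | succ k ih =>
    rw [ascProd, win_mul, ih (by omega) hx, win_gen cs hk]
    apply sgen_eq
    push_cast
    split_ifs <;> omega

theorem win_ascProd_inv {k : ℕ} (hk : k < n) {x : ℤ} (hx : 0 < x) :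
    win cs (ascProd cs k)⁻¹ x = if x ≤ k then x + 1 else if x = k + 1 then 1 else x := by
  apply win_injective cs (ascProd cs k)
  rw [win_win_inv, win_ascProd cs hk (by split_ifs <;> omega)]
  split_ifs <;> omega

theorem ascProd_mem {k : ℕ} (hk : k < n) : ascProd cs k ∈ young cs 0 := by
  apply mem_young_zero
  intro x hx
  rw [win_ascProd cs hk hx]
  split_ifs <;> omega

theorem isRep_ascProd {k : ℕ} (hk : k < n) : IsRep cs k (ascProd cs k) := by
  refine ⟨ascProd_mem cs hk, fun i hi => ?_⟩
  have h1 : (i : ℕ) ≠ 0 := hi.1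
  have h2 : (i : ℕ) ≠ k := hi.2
  rw [length_mul_lt_iff, asc_iff cs h1, win_ascProd_inv cs hk (by omega),
    win_ascProd_inv cs hk (by omega)]
  split_ifs <;> omega

/-- The definition of a_l adds factors on the right. The recursion for C_{a_l} instead needs the new
factor t s_1 ⋯ s_l on the left, and windows identify the two products. -/
theorem aElt_succ {l : ℕ} (hl : l < n) :
    aElt cs (l + 1) = gen cs 0 * (ascProd cs l * aElt cs l) := by
  apply ext_win cs
  intro x hx
  rw [win_gen_mul cs (by omega), win_mul, win_aElt cs (by omega) hx]
  have h0 := sgen_zero_apply x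
  have hu : 0 < win cs (ascProd cs l) 1 := win_pos cs (ascProd_mem cs hl) one_pos
  by_cases h1 : x = 1
  · rw [show sgen 0 x = -1 by omega, win_neg, win_neg, win_aElt cs hl.le hu,
      win_ascProd cs hl one_pos]
    push_cast
    split_ifs <;> omega
  · rw [show sgen 0 x = x by omega, win_aElt cs hl.le (win_pos cs (ascProd_mem cs hl) hx),
      win_ascProd cs hl hx]
    push_cast
    split_ifs <;> omega

/-- The number of negative entries of the window of `w`. -/
noncomputable def negCount (w : W) : ℕ :=
  ((Finset.Icc (1 : ℤ) n).filter fun x => win cs w x < 0).card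

theorem negCount_simple_mul {i : Fin n} (hi : (i : ℕ) ≠ 0) (w : W) :
    negCount cs (cs.simple i * w) = negCount cs w := by
  have hb : ∀ x, x ∈ Finset.Icc (1 : ℤ) n → sgen i x ∈ Finset.Icc (1 : ℤ) n := by
    intro x hx
    rw [Finset.mem_Icc] at hx ⊢
    have := sgen_apply hi x
    have := i.2
    omega
  refine Finset.card_nbij' (sgen i) (sgen i) ?_ ?_ (fun x _ => sgen_sgen i x)
    (fun x _ => sgen_sgen i x)
  · intro x hx
    simp only [Finset.coe_filter, Set.mem_ofPred_eq, win_simple_mul] at hx ⊢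
    exact ⟨hb x hx.1, hx.2⟩
  · intro x hx
    simp only [Finset.coe_filter, Set.mem_ofPred_eq, win_simple_mul, sgen_sgen] at hx ⊢
    exact ⟨hb x hx.1, hx.2⟩

theorem negCount_simple_zero_mul {i : Fin n} (hi : (i : ℕ) = 0) {w : W} (h : 0 < win cs w 1) :
    negCount cs (cs.simple i * w) = negCount cs w + 1 := by
  have h1 : (Finset.Icc (1 : ℤ) n).filter (fun x => win cs (cs.simple i * w) x < 0) =
      insert 1 ((Finset.Icc (1 : ℤ) n).filter fun x => win cs w x < 0) := by
    ext x
    have := i.2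
    simp only [Finset.mem_filter, Finset.mem_insert, Finset.mem_Icc, win_simple_mul, hi]
    have h0 := sgen_zero_apply x
    by_cases hx : x = 1
    · have h2 := win_neg cs w 1
      rw [hx] at h0 ⊢
      rw [show sgen 0 1 = -1 by omega]
      omega
    · rcases h0 with h0 | h0 | h0
      · omega
      · omega
      · rw [h0.2.2]; omega
  rw [negCount, h1, Finset.card_insert_of_notMem, negCount]
  simp only [Finset.mem_filter, not_and]
  intro _
  omega

theorem tLength_one : tLength cs 1 = 0 := by
  have := tLength_eq cs (ω := []) (by simp [CoxeterSystem.IsReduced])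
  simpa using this

theorem tLength_simple_mul {i : Fin n} {w : W} (h : cs.length w < cs.length (cs.simple i * w)) :
    tLength cs (cs.simple i * w) = tLength cs w + if (i : ℕ) = 0 then 1 else 0 := by
  obtain ⟨ω, hω, rfl⟩ := cs.exists_isReduced w
  have hω' : cs.IsReduced (i :: ω) := by
    have h1 := cs.length_simple_mul (cs.wordProd ω) i
    have h2 : cs.length (cs.wordProd ω) = ω.length := hω
    show cs.length (cs.wordProd (i :: ω)) = _
    rw [cs.wordProd_cons, List.length_cons]
    omega
  rw [← cs.wordProd_cons, tLength_eq cs hω', tLength_eq cs hω, List.countP_cons]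
  simp

theorem negCount_one : negCount cs 1 = 0 := by
  rw [negCount, Finset.card_eq_zero, Finset.filter_eq_empty_iff]
  intro x hx
  rw [Finset.mem_Icc] at hx
  rw [win_one]
  omega

/-- Only t changes signs, and in a reduced word each t is an ascent of what follows it, so it
creates one new negative entry. -/
theorem tLength_eq_negCount (w : W) : tLength cs w = negCount cs w := by
  induction w using length_induction cs with
  | h1 => rw [tLength_one, negCount_one]
  | hs i w h ih =>
    rw [tLength_simple_mul cs h, ih]
    split_ifs with hi
    · rw [length_lt_iff, hi, asc_zero_iff] at h
      rw [negCount_simple_zero_mul cs hi h]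
    · rw [negCount_simple_mul cs hi, add_zero]

theorem negCount_young_mul {u : W} (hu : u ∈ young cs 0) (w : W) :
    negCount cs (u * w) = negCount cs w := by
  induction u using length_induction cs generalizing w with
  | h1 => rw [one_mul]
  | hs i u h ih =>
    have hi : (i : ℕ) ≠ 0 := by
      refine ne_zero_of_not_asc cs hu ?_
      rw [← length_gt_iff, cs.simple_mul_simple_cancel_left]
      exact h
    have hu' := mul_mem (simple_mem_young_zero cs hi) hu
    rw [cs.simple_mul_simple_cancel_left] at hu'
    rw [mul_assoc, negCount_simple_mul cs hi, ih hu']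

theorem win_lt_zero_iff {u : W} (hu : u ∈ young cs 0) (x : ℤ) : win cs u x < 0 ↔ x < 0 := by
  have := win_pos_iff cs hu (-x)
  rw [win_neg] at this
  omega

theorem negCount_mul_young {u : W} (hu : u ∈ young cs 0) (w : W) :
    negCount cs (w * u) = negCount cs w := by
  simp only [negCount, win_mul, win_lt_zero_iff cs hu]

theorem negCount_of_iff {l : ℕ} (hl : l ≤ n) {w : W}
    (h : ∀ x : ℤ, 0 < x → x ≤ n → (win cs w x < 0 ↔ x ≤ l)) : negCount cs w = l := by
  have : (Finset.Icc (1 : ℤ) n).filter (fun x => win cs w x < 0) = Finset.Icc (1 : ℤ) l := by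
    ext x
    simp only [Finset.mem_filter, Finset.mem_Icc]
    constructor
    · rintro ⟨h1, h2⟩
      exact ⟨h1.1, (h x (by omega) h1.2).1 h2⟩
    · rintro ⟨h1, h2⟩
      exact ⟨⟨h1, by omega⟩, (h x (by omega) (by omega)).2 h2⟩
  rw [negCount, this]
  simp

theorem win_aElt_lt_zero_iff {l : ℕ} (hl : l ≤ n) {x : ℤ} (hx : 0 < x) :
    win cs (aElt cs l) x < 0 ↔ x ≤ l := by
  rw [win_aElt cs hl hx]
  split_ifs <;> omega

theorem negCount_aElt {l : ℕ} (hl : l ≤ n) : negCount cs (aElt cs l) = l :=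
  negCount_of_iff cs hl fun _ hx _ => win_aElt_lt_zero_iff cs hl hx

theorem tLength_mul_aElt_mul {l : ℕ} (hl : l ≤ n) {a w : W} (ha : a ∈ young cs 0)
    (hw : w ∈ young cs 0) : tLength cs (a * aElt cs l * w) = l := by
  rw [tLength_eq_negCount, negCount_mul_young cs hw, negCount_young_mul cs ha, negCount_aElt cs hl]

theorem tLength_le (w : W) : tLength cs w ≤ n := by
  rw [tLength_eq_negCount, negCount]
  refine (Finset.card_filter_le _ _).trans ?_
  simp

theorem aElt_conj_mem {l : ℕ} (hl : l ≤ n) {u : W} (hu : u ∈ young cs l) :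
    aElt cs l * u * aElt cs l ∈ young cs l := by
  have key : ∀ x : ℤ, 0 < x → 0 < win cs (aElt cs l * u * aElt cs l) x ∧
      (x ≤ l → win cs (aElt cs l * u * aElt cs l) x ≤ l) := by
    intro x hx
    rw [win_mul, win_mul, win_aElt cs hl hx]
    split_ifs with h
    · have h1 := win_of_mem_young cs hu (x := l + 1 - x) (by omega)
      rw [win_neg, win_neg, win_aElt cs hl h1.1]
      split_ifs <;> omega
    · have h1 := win_of_mem_young cs hu hx
      rw [win_aElt cs hl h1.1]
      split_ifs <;> omega
  exact mem_young_of_win cs (fun x hx => (key x hx).1) fun x hx => (key x hx).2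

/-- The sign pattern of a_l w is that of a_l, negative exactly on [1, l], because w preserves signs.
Comparing patterns shows that a'⁻¹ a preserves [1, l], hence lies in the Young subgroup, and two
representatives of the same coset coincide. -/
theorem IsRep.eq_of_mul_aElt_mul {l : ℕ} (hl : l ≤ n) {a a' w w' : W} (ha : IsRep cs l a)
    (ha' : IsRep cs l a') (hw : w ∈ young cs 0) (hw' : w' ∈ young cs 0)
    (h : a * aElt cs l * w = a' * aElt cs l * w') : a = a' ∧ w = w' := by
  have hd : a'⁻¹ * a ∈ young cs 0 := mul_mem (inv_mem ha'.mem) ha.mem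
  have hv : w' * w⁻¹ ∈ young cs 0 := mul_mem hw' (inv_mem hw)
  have h1 : a'⁻¹ * a * aElt cs l = aElt cs l * (w' * w⁻¹) := by
    rw [← mul_assoc, eq_mul_inv_iff_mul_eq, mul_assoc, mul_assoc, inv_mul_eq_iff_eq_mul,
      ← mul_assoc, h, mul_assoc]
  have h2 : a'⁻¹ * a ∈ young cs l := by
    refine mem_young_of_win cs (fun x hx => win_pos cs hd hx) fun x hx hxl => ?_
    rw [← win_aElt_lt_zero_iff cs hl (win_pos cs hd hx), ← win_mul, h1, win_mul,
      win_lt_zero_iff cs hv]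
    exact (win_aElt_lt_zero_iff cs hl hx).2 hxl
  have h3 := ha'.eq_one h2 (by rwa [mul_inv_cancel_left])
  have h4 : a = a' := (inv_mul_eq_one.1 h3).symm
  subst h4
  exact ⟨rfl, mul_left_cancel h⟩

theorem exists_minReps (l : ℕ) {u : W} (hu : u ∈ young cs 0) :
    ∃ a ∈ minReps cs l, ∃ v ∈ young cs l, u = a * v := by
  obtain ⟨v, -, hv⟩ := (measure fun v : young cs l => cs.length (u * v)).wf.has_min Set.univ
    ⟨1, trivial⟩
  refine ⟨u * v, ⟨mul_mem hu (young_le cs l v.2), fun v' hv' => ?_⟩, (v : W)⁻¹, inv_mem v.2,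
    by rw [mul_inv_cancel_right]⟩
  have h1 := hv (v * ⟨v', hv'⟩) trivial
  rw [mul_assoc]
  exact not_lt.1 h1

theorem exists_young_mul (w : W) :
    ∃ u ∈ young cs 0, ∃ z, w = u * z ∧ ∀ i : Fin n, (i : ℕ) ≠ 0 → Asc cs i z := by
  obtain ⟨v, -, hv⟩ := (measure fun v : young cs 0 => cs.length (v * w)).wf.has_min Set.univ
    ⟨1, trivial⟩
  refine ⟨(v : W)⁻¹, inv_mem v.2, v * w, by rw [inv_mul_cancel_left], fun i hi => ?_⟩
  by_contra hc
  rw [← length_gt_iff, ← mul_assoc] at hc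
  exact hv (⟨_, simple_mem_young_zero cs hi⟩ * v) trivial hc

theorem win_lt_of_asc {z : W} (hz : ∀ i : Fin n, (i : ℕ) ≠ 0 → Asc cs i z) {x y : ℤ} (hx : 0 < x)
    (hxy : x < y) (hy : y ≤ n) : win cs z x < win cs z y := by
  obtain ⟨k, rfl⟩ : ∃ k : ℕ, y = x + 1 + k := ⟨(y - x - 1).toNat, by omega⟩
  have step : ∀ u : ℤ, 0 < u → u + 1 ≤ n → win cs z u < win cs z (u + 1) := by
    intro u hu hun
    obtain ⟨m, rfl⟩ : ∃ m : ℕ, u = m := ⟨u.toNat, by omega⟩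
    have h1 := hz ⟨m, by omega⟩ (show m ≠ 0 by omega)
    rw [asc_iff cs (show m ≠ 0 by omega)] at h1
    exact h1
  induction k with
  | zero => push_cast at *; rw [add_zero]; exact step x hx (by omega)
  | succ k ih =>
    have h1 := ih (by omega) (by push_cast at *; omega)
    have h2 := step (x + 1 + k) (by omega) (by push_cast at *; omega)
    push_cast
    rw [← add_assoc]
    exact h1.trans h2

theorem win_lt_zero_iff_of_asc {z : W} (hz : ∀ i : Fin n, (i : ℕ) ≠ 0 → Asc cs i z) {x : ℤ}
    (hx : 0 < x) (hxn : x ≤ n) : win cs z x < 0 ↔ x ≤ negCount cs z := by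
  constructor
  · intro h
    have hsub : Finset.Icc 1 x ⊆ (Finset.Icc (1 : ℤ) n).filter fun x => win cs z x < 0 := by
      intro y hy
      rw [Finset.mem_Icc] at hy
      simp only [Finset.mem_filter, Finset.mem_Icc]
      refine ⟨⟨hy.1, by omega⟩, ?_⟩
      rcases eq_or_lt_of_le hy.2 with rfl | h1
      · exact h
      · exact (win_lt_of_asc cs hz (by omega) h1 hxn).trans h
    have := Finset.card_le_card hsub
    rw [Int.card_Icc] at this
    rw [negCount]
    omega
  · intro h
    by_contra hc
    have hsub : ((Finset.Icc (1 : ℤ) n).filter fun x => win cs z x < 0) ⊆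
        Finset.Icc 1 (x - 1) := by
      intro y hy
      simp only [Finset.mem_filter, Finset.mem_Icc] at hy ⊢
      refine ⟨hy.1.1, ?_⟩
      by_contra h1
      rcases eq_or_lt_of_le (show x ≤ y by omega) with rfl | h2
      · exact hc hy.2
      · have := win_lt_of_asc cs hz hx h2 hy.1.2
        omega
    have := Finset.card_le_card hsub
    rw [Int.card_Icc] at this
    rw [negCount] at h
    omega

/-- Sorting the window by some u ∈ 𝔖_n leaves an increasing z whose negative entries are exactly the
first l, so that a_l z has no sign change left. -/
theorem exists_isDecomp (w : W) : ∃ p, IsDecomp cs w p := by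
  obtain ⟨u, hu, z, rfl, hz⟩ := exists_young_mul cs w
  set l := tLength cs (u * z) with hl
  have hln : l ≤ n := tLength_le cs _
  have hlz : negCount cs z = l := by
    rw [hl, tLength_eq_negCount, negCount_young_mul cs hu]
  obtain ⟨a, ha, v, hv, rfl⟩ := exists_minReps cs l hu
  have hpos : aElt cs l * z ∈ young cs 0 := by
    refine mem_young_zero cs fun x hx => ?_
    rw [win_mul, win_aElt cs hln hx]
    split_ifs with h1
    · have h2 := win_lt_zero_iff_of_asc cs hz (x := l + 1 - x) (by omega) (by omega)
      rw [win_neg]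
      omega
    · rcases le_or_gt x n with h2 | h2
      · have h3 := win_lt_zero_iff_of_asc cs hz hx h2
        have h4 := win_ne_zero cs z hx.ne'
        omega
      · rw [win_of_gt cs z h2]; exact hx
  -- The Young factor v of u = a v is moved past the involution a_l, which normalises 𝔖_{l,n-l}: a v
  -- z = a · a_l · (a_l v a_l)(a_l z).
  have hw' : (aElt cs l * v * aElt cs l) * (aElt cs l * z) ∈ young cs 0 :=
    mul_mem (young_le cs l (aElt_conj_mem cs hln hv)) hpos
  obtain ⟨b, hb, s, hs, h⟩ := exists_minReps cs l (inv_mem hw')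
  refine ⟨(a, s⁻¹, b), ha, inv_mem hs, hb, ?_⟩
  show a * v * z = a * aElt cs l * s⁻¹ * b⁻¹
  rw [mul_assoc _ s⁻¹, ← mul_inv_rev, ← h, inv_inv]
  have h1 := aElt_mul_self cs hln
  have h2 : ∀ g : W, aElt cs l * (aElt cs l * g) = g := fun g => by
    rw [← mul_assoc, h1, one_mul]
  simp only [mul_assoc, h2]

/-- The decomposition `w = a a_l v` with `a` a distinguished coset representative and
`v = σ_w b_w⁻¹`. -/
theorem exists_isRep_eq (w : W) : ∃ a, IsRep cs (tLength cs w) a ∧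
    sigmaPart cs w * (bPart cs w)⁻¹ ∈ young cs 0 ∧
    w = a * aElt cs (tLength cs w) * (sigmaPart cs w * (bPart cs w)⁻¹) := by
  have h : IsDecomp cs w (decomp cs w) := Classical.epsilon_spec (exists_isDecomp cs w)
  refine ⟨(decomp cs w).1, isRep_of_mem_minReps cs h.1,
    mul_mem (young_le cs _ h.2.1) (inv_mem h.2.2.1.1), ?_⟩
  rw [← mul_assoc]
  exact h.2.2.2

end Decomposition

/-! ### Braid relations in the Hecke algebra of type B. -/

section HeckeTypeB

variable {n : ℕ} {W : Type*} [Group W] {cs : CoxeterSystem (typeB n) W}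
variable {Γ : Type*} [AddCommGroup Γ] [LinearOrder Γ] [IsOrderedAddMonoid Γ]
variable (L : WeightFunction cs Γ)

/-- The element `T_{s_k}` (with `s_0 = t`), or `1` if `k ≥ n`. -/
noncomputable def tau (k : ℕ) : Hecke L := if h : k < n then Ts L ⟨k, h⟩ else 1

/-- The inverse of `tau`. -/
noncomputable def tauInv (k : ℕ) : Hecke L := if h : k < n then Tinv L ⟨k, h⟩ else 1

theorem tau_of_lt {k : ℕ} (h : k < n) : tau L k = Ts L ⟨k, h⟩ := dif_pos h

theorem tauInv_of_lt {k : ℕ} (h : k < n) : tauInv L k = Tinv L ⟨k, h⟩ := dif_pos h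

theorem tau_mul_tauInv (k : ℕ) : tau L k * tauInv L k = 1 := by
  rw [tau, tauInv]
  split_ifs
  · exact Ts_mul_Tinv L _
  · rw [one_mul]

theorem tauInv_mul_tau (k : ℕ) : tauInv L k * tau L k = 1 := by
  rw [tau, tauInv]
  split_ifs
  · exact Tinv_mul_Ts L _
  · rw [one_mul]

theorem bar_tau_mul (k : ℕ) (h : Hecke L) : bar L (tau L k * h) = tauInv L k * bar L h := by
  rw [tau, tauInv]
  split_ifs
  · exact bar_Ts_mul L _ _
  · rw [one_mul, one_mul]

theorem bar_tauInv_mul (k : ℕ) (h : Hecke L) : bar L (tauInv L k * h) = tau L k * bar L h := by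
  rw [tau, tauInv]
  split_ifs
  · exact bar_Tinv_mul L _ _
  · rw [one_mul, one_mul]

theorem flip_tau (k : ℕ) : flip L (tau L k) = tau L k := by
  rw [tau]
  split_ifs
  · rw [flip_T, cs.inv_simple]
  · exact flip_one L

/-- If `x y = y z` with invertible `x` and `z`, then `x⁻¹ y = y z⁻¹`. -/
theorem inv_mul_eq_mul_inv {R : Type*} [Ring R] {x x' y z z' : R} (hx : x' * x = 1)
    (hz : z * z' = 1) (h : x * y = y * z) : x' * y = y * z' := by
  calc x' * y = x' * (y * z) * z' := by rw [mul_assoc, mul_assoc, hz, mul_one]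
    _ = y * z' := by rw [← h, ← mul_assoc, hx, one_mul]

theorem T_simple_mul_of_asc {i : Fin n} {w : W} (h : Asc cs i w) :
    Ts L i * T L w = T L (cs.simple i * w) :=
  T_simple_mul_of_lt L ((length_lt_iff cs i w).2 h)

theorem tau_comm {i j : ℕ} (h : i + 1 < j) (hj : j < n) : Commute (tau L i) (tau L j) := by
  have hi : i < n := by omega
  have hij : (⟨i, hi⟩ : Fin n) ≠ ⟨j, hj⟩ := fun h' => by
    have := congrArg Fin.val h'
    simp only at this
    omega
  have key : ∀ {u v : Fin n}, u ≠ v → Ts L u * Ts L v = T L (cs.simple u * cs.simple v) := by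
    intro u v huv
    have h1 := asc_simple_mul cs huv (asc_one cs u) (asc_one cs v)
    rw [mul_one] at h1
    exact T_simple_mul_of_asc L h1
  rw [commute_iff_eq, tau_of_lt L hi, tau_of_lt L hj, key hij, key hij.symm]
  congr 1
  apply ext_win cs
  intro x _
  rw [win_mul, win_mul, win_simple, win_simple, win_simple, win_simple]
  exact (Equiv.ext_iff.1 (sgen_comm h) x).symm

/-- Every letter is an ascent of the word behind it, so the product collapses to a single T_w. Braid
relations in H thereby become identities of signed permutations. -/
theorem Ts_mul_three {i j : Fin n} (hij : (i : ℕ) + 1 = j ∨ (j : ℕ) + 1 = i) :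
    Ts L i * Ts L j * Ts L i = T L (cs.simple i * (cs.simple j * cs.simple i)) := by
  have hne : j ≠ i := by rintro rfl; omega
  have h1 := asc_simple_mul cs hne (asc_one cs j) (asc_one cs i)
  have h2 := asc_simple_mul_simple_mul cs hij (asc_one cs i) (asc_one cs j)
  rw [mul_one] at h1 h2
  rw [mul_assoc, T_simple_mul_of_asc L h1, T_simple_mul_of_asc L h2]

theorem tau_braid {i : ℕ} (h0 : i ≠ 0) (hi : i + 1 < n) :
    tau L i * tau L (i + 1) * tau L i = tau L (i + 1) * tau L i * tau L (i + 1) := by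
  rw [tau_of_lt L hi, tau_of_lt L (Nat.lt_of_succ_lt hi), Ts_mul_three L (Or.inl rfl),
    Ts_mul_three L (Or.inr rfl)]
  congr 1
  apply ext_win cs
  intro x _
  simp only [win_mul, win_simple]
  exact (Equiv.ext_iff.1 (sgen_braid h0) x)

theorem tau_braid_four (hn : 1 < n) :
    tau L 0 * tau L 1 * tau L 0 * tau L 1 = tau L 1 * tau L 0 * tau L 1 * tau L 0 := by
  have key : ∀ {i j : Fin n}, ((i : ℕ) = 0 ∧ (j : ℕ) = 1 ∨ (i : ℕ) = 1 ∧ (j : ℕ) = 0) →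
      Ts L i * Ts L j * Ts L i * Ts L j =
        T L (cs.simple i * (cs.simple j * (cs.simple i * cs.simple j))) := by
    intro i j h
    have h1 := asc_simple_mul_three cs h (asc_one cs i) (asc_one cs j)
    rw [mul_one] at h1
    rw [mul_assoc, mul_assoc, ← mul_assoc (Ts L j), Ts_mul_three L (by omega),
      T_simple_mul_of_asc L h1]
  rw [tau_of_lt L hn, tau_of_lt L (show 0 < n by omega), key (Or.inl ⟨rfl, rfl⟩),
    key (Or.inr ⟨rfl, rfl⟩)]
  congr 1
  apply ext_win cs
  intro x _
  simp only [win_mul, win_simple]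
  exact (Equiv.ext_iff.1 sgen_braid_four x).symm

/-- The product `T_{s_1} T_{s_2} ⋯ T_{s_k}`. -/
noncomputable def tauProd : ℕ → Hecke L
  | 0 => 1
  | k + 1 => tauProd k * tau L (k + 1)

/-- The product `T_{s_1}⁻¹ T_{s_2}⁻¹ ⋯ T_{s_k}⁻¹`. -/
noncomputable def tauInvProd : ℕ → Hecke L
  | 0 => 1
  | k + 1 => tauInvProd k * tauInv L (k + 1)

theorem bar_tauProd (k : ℕ) : bar L (tauProd L k) = tauInvProd L k := by
  induction k with
  | zero => exact bar_one L
  | succ k ih =>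
    have := bar_tau_mul L (k + 1) 1
    rw [mul_one, bar_one, mul_one] at this
    rw [tauProd, bar_mul, ih, this, tauInvProd]

theorem bar_tauInvProd (k : ℕ) : bar L (tauInvProd L k) = tauProd L k := by
  induction k with
  | zero => exact bar_one L
  | succ k ih =>
    have := bar_tauInv_mul L (k + 1) 1
    rw [mul_one, bar_one, mul_one] at this
    rw [tauInvProd, bar_mul, ih, this, tauProd]

theorem commute_tauInv {h : Hecke L} {k : ℕ} (hc : Commute h (tau L k)) :
    Commute h (tauInv L k) := by
  have h1 : tau L k * h = h * tau L k := hc.eq.symm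
  exact (inv_mul_eq_mul_inv (tauInv_mul_tau L k) (tau_mul_tauInv L k) h1).symm

theorem commute_tauProd {h : Hecke L} {k : ℕ}
    (hc : ∀ i, 1 ≤ i → i ≤ k → Commute h (tau L i)) : Commute h (tauProd L k) := by
  induction k with
  | zero => exact Commute.one_right h
  | succ k ih =>
    exact (ih fun i h1 h2 => hc i h1 (by omega)).mul_right (hc _ (by omega) le_rfl)

theorem commute_tauInvProd {h : Hecke L} {k : ℕ}
    (hc : ∀ i, 1 ≤ i → i ≤ k → Commute h (tau L i)) : Commute h (tauInvProd L k) := by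
  induction k with
  | zero => exact Commute.one_right h
  | succ k ih =>
    exact (ih fun i h1 h2 => hc i h1 (by omega)).mul_right
      (commute_tauInv L (hc _ (by omega) le_rfl))

/-- Only the braid relation at i, i+1 matters: the earlier factors commute with s_{i+1}, and the
later ones with s_i. -/
theorem tau_mul_tauProd {i k : ℕ} (h0 : i ≠ 0) (hik : i + 1 ≤ k) (hk : k < n) :
    tau L (i + 1) * tauProd L k = tauProd L k * tau L i := by
  induction k, hik using Nat.le_induction with
  | base =>
    obtain ⟨m, rfl⟩ := Nat.exists_eq_succ_of_ne_zero h0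
    have hc : Commute (tau L (m + 1 + 1)) (tauProd L m) :=
      commute_tauProd L fun j h1 h2 => (tau_comm L (by omega) hk).symm
    have hb := tau_braid L h0 hk
    show tau L (m + 1 + 1) * (tauProd L m * tau L (m + 1) * tau L (m + 1 + 1)) = 
      tauProd L m * tau L (m + 1) * tau L (m + 1 + 1) * tau L (m + 1)
    rw [mul_assoc (tauProd L m), ← mul_assoc, hc.eq, mul_assoc, ← mul_assoc (tau L (m + 1 + 1)),
      ← hb]
    simp only [mul_assoc]
  | succ k hik ih =>
    rw [tauProd, ← mul_assoc, ih (by omega), mul_assoc, mul_assoc,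
      (tau_comm L (show i + 1 < k + 1 by omega) hk).eq]

theorem tau_mul_tauInvProd {i k : ℕ} (h0 : i ≠ 0) (hik : i + 1 ≤ k) (hk : k < n) :
    tau L (i + 1) * tauInvProd L k = tauInvProd L k * tau L i := by
  induction k, hik using Nat.le_induction with
  | base =>
    obtain ⟨m, rfl⟩ := Nat.exists_eq_succ_of_ne_zero h0
    have hc : Commute (tau L (m + 1 + 1)) (tauInvProd L m) :=
      commute_tauInvProd L fun j h1 h2 => (tau_comm L (by omega) hk).symm
    have hb := tau_braid L h0 hk
    have h1 : tau L (m + 1 + 1) * (tauInv L (m + 1) * tauInv L (m + 1 + 1)) =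
        tauInv L (m + 1) * tauInv L (m + 1 + 1) * tau L (m + 1) := by
      have h2 : tau L (m + 1) * (tau L (m + 1 + 1) * tau L (m + 1)) =
          tau L (m + 1 + 1) * tau L (m + 1) * tau L (m + 1 + 1) := by rw [← hb, mul_assoc]
      have h3 : tauInv L (m + 1) * tauInv L (m + 1 + 1) *
          (tau L (m + 1 + 1) * tau L (m + 1)) = 1 := by
        rw [mul_assoc, ← mul_assoc (tauInv L (m + 1 + 1)), tauInv_mul_tau, one_mul,
          tauInv_mul_tau]
      have h4 : tau L (m + 1 + 1) * tau L (m + 1) *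
          (tauInv L (m + 1) * tauInv L (m + 1 + 1)) = 1 := by
        rw [mul_assoc, ← mul_assoc (tau L (m + 1)), tau_mul_tauInv, one_mul,
          tau_mul_tauInv]
      calc tau L (m + 1 + 1) * (tauInv L (m + 1) * tauInv L (m + 1 + 1)) =
          tauInv L (m + 1) * tauInv L (m + 1 + 1) *
            (tau L (m + 1 + 1) * tau L (m + 1) * tau L (m + 1 + 1)) *
            (tauInv L (m + 1) * tauInv L (m + 1 + 1)) := by
            rw [← mul_assoc (tauInv L (m + 1) * tauInv L (m + 1 + 1)), h3, one_mul]
        _ = tauInv L (m + 1) * tauInv L (m + 1 + 1) * tau L (m + 1) *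
            (tau L (m + 1 + 1) * tau L (m + 1) *
            (tauInv L (m + 1) * tauInv L (m + 1 + 1))) := by
            rw [← h2]; simp only [mul_assoc]
        _ = _ := by rw [h4, mul_one]
    show tau L (m + 1 + 1) * (tauInvProd L m * tauInv L (m + 1) * tauInv L (m + 1 + 1)) = 
      tauInvProd L m * tauInv L (m + 1) * tauInv L (m + 1 + 1) * tau L (m + 1)
    rw [mul_assoc (tauInvProd L m), ← mul_assoc, hc.eq, mul_assoc, h1]
    simp only [mul_assoc]
  | succ k hik ih =>
    rw [tauInvProd, ← mul_assoc, ih (by omega), mul_assoc, mul_assoc,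
      (commute_tauInv L (tau_comm L (show i + 1 < k + 1 by omega) hk)).eq]

/-! ### The product c_l: bar invariance and commutation with generators. -/

/-- The Kazhdan-Lusztig element of `a_l`, as an explicit product. -/
noncomputable def aHecke : ℕ → Hecke L
  | 0 => 1
  | l + 1 => (tau L 0 * tauProd L l + expo (-L (gen cs 0)) • tauInvProd L l) * aHecke l

theorem commute_aHecke {l j : ℕ} (hl : l < j) (hj : j < n) :
    Commute (tau L j) (aHecke L l) := by
  induction l with
  | zero => exact Commute.one_right _
  | succ l ih =>
    rw [aHecke]
    refine Commute.mul_right (Commute.add_right (Commute.mul_right ?_ ?_)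
      (Commute.smul_right ?_ _)) (ih (by omega))
    · exact (tau_comm L (by omega) hj).symm
    · exact commute_tauProd L fun i h1 h2 => (tau_comm L (by omega) hj).symm
    · exact commute_tauInvProd L fun i h1 h2 => (tau_comm L (by omega) hj).symm

/-- The product `T_{s_{k+1}} ⋯ T_{s_{k+m}}`. -/
noncomputable def tauSeg : ℕ → ℕ → Hecke L
  | _, 0 => 1
  | k, m + 1 => tau L (k + 1) * tauSeg (k + 1) m

theorem commute_tauSeg {h : Hecke L} {k m : ℕ}
    (hc : ∀ i, k < i → i ≤ k + m → Commute h (tau L i)) : Commute h (tauSeg L k m) := by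
  induction m generalizing k with
  | zero => exact Commute.one_right h
  | succ m ih =>
    exact (hc _ (by omega) (by omega)).mul_right (ih fun i h1 h2 => hc i (by omega) (by omega))

theorem tauInvProd_mul_aHecke {l : ℕ}
    (hs : ∀ i, 1 ≤ i → i < l → tau L i * aHecke L l = aHecke L l * tau L (l - i)) {k : ℕ}
    (hk : k < l ∨ k = 0) : ∃ y, tauInvProd L k * aHecke L l = aHecke L l * y := by
  induction k with
  | zero => exact ⟨1, by rw [tauInvProd, one_mul, mul_one]⟩
  | succ k ih =>
    obtain ⟨y, hy⟩ := ih (by omega)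
    have h1 := inv_mul_eq_mul_inv (tauInv_mul_tau L (k + 1)) (tau_mul_tauInv L (l - (k + 1)))
      (hs (k + 1) (by omega) (by omega))
    exact ⟨y * tauInv L (l - (k + 1)), by
      rw [tauInvProd, mul_assoc, h1, ← mul_assoc, hy, mul_assoc]⟩

/-- The difference of the two products telescopes into multiples of words in s_2, …, s_l times
inverses of initial words in s_1, …, s_{l-1}, applied to c_l. The latter can be pushed through c_l,
the former commute with t, and T_t acts on c_l by e^b. Both the eigenvalue and the bar invariance of
c_{l+1} follow from this identity. -/
theorem tau_zero_mul_sub {l : ℕ} (hl : l < n)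
    (hs : ∀ i, 1 ≤ i → i < l → tau L i * aHecke L l = aHecke L l * tau L (l - i))
    (hq : 1 ≤ l → tau L 0 * aHecke L l = expo (L (gen cs 0)) • aHecke L l) :
    tau L 0 * ((tauProd L l - tauInvProd L l) * aHecke L l) =
      expo (L (gen cs 0)) • ((tauProd L l - tauInvProd L l) * aHecke L l) := by
  -- The untouched tail s_{k+1} ⋯ s_l is carried along so that the induction on k can split off one
  -- letter at a time.
  have key : ∀ k m, k + m = l →
      tau L 0 * ((tauProd L k - tauInvProd L k) * (tauSeg L k m * aHecke L l)) =
        expo (L (gen cs 0)) •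
          ((tauProd L k - tauInvProd L k) * (tauSeg L k m * aHecke L l)) := by
    intro k
    induction k with
    | zero =>
      intro m _
      rw [tauProd, tauInvProd, sub_self, zero_mul, mul_zero, smul_zero]
    | succ k ih =>
      intro m hm
      have h1 := ih (m + 1) (by omega)
      have hk1 : k + 1 < n := by omega
      have h2 : tau L (k + 1) - tauInv L (k + 1) = xi L ⟨k + 1, hk1⟩ • (1 : Hecke L) := by
        rw [tau_of_lt L hk1, tauInv_of_lt L hk1, Tinv, sub_sub_cancel]
      have h3 : tauProd L (k + 1) - tauInvProd L (k + 1) =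
          (tauProd L k - tauInvProd L k) * tau L (k + 1) +
            xi L ⟨k + 1, hk1⟩ • tauInvProd L k := by
        have : tauInvProd L k * tauInv L (k + 1) = tauInvProd L k * tau L (k + 1) -
            xi L ⟨k + 1, hk1⟩ • tauInvProd L k := by
          rw [← sub_sub_cancel (tau L (k + 1)) (tauInv L (k + 1)), h2, mul_sub, mul_smul_comm,
            mul_one]
        rw [tauProd, tauInvProd, this, sub_mul]
        abel
      rw [h3, add_mul, mul_add, smul_add, mul_assoc (tauProd L k - tauInvProd L k),
        ← mul_assoc (tau L (k + 1)), ← tauSeg, h1]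
      congr 1
      -- The letters up to k and those from k + 2 on are not adjacent, so the inverse part reaches
      -- c_l directly.
      have c1 : Commute (tauInvProd L k) (tauSeg L (k + 1) m) := by
        refine (commute_tauInvProd L fun i h4 h5 => ?_).symm
        refine (commute_tauSeg L fun j h6 h7 => ?_).symm
        exact tau_comm L (by omega) (by omega)
      have c2 : Commute (tau L 0) (tauSeg L (k + 1) m) :=
        commute_tauSeg L fun j h6 h7 => tau_comm L (by omega) (by omega)
      obtain ⟨y, hy⟩ := tauInvProd_mul_aHecke L hs (k := k) (by omega)
      rw [smul_mul_assoc, mul_smul_comm, smul_comm, ← mul_assoc (tauInvProd L k), c1.eq,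
        mul_assoc, hy, ← mul_assoc, c2.eq, mul_assoc, ← mul_assoc (tau L 0), hq (by omega),
        smul_mul_assoc, mul_smul_comm]
  have := key l 0 rfl
  rwa [tauSeg, one_mul] at this

theorem L_simple_zero (h : 0 < n) : L (cs.simple ⟨0, h⟩) = L (gen cs 0) := by
  rw [gen_of_lt cs h]

theorem tau_zero_mul_tau_zero (hn : 0 < n) (h : Hecke L) :
    tau L 0 * (tau L 0 * h) =
      h + (expo (L (gen cs 0)) - expo (-L (gen cs 0))) • (tau L 0 * h) := by
  rw [← mul_assoc, tau_of_lt L hn, T_simple_mul_self, add_mul, one_mul, smul_mul_assoc, xi,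
    L_simple_zero]

theorem tau_zero_mul_aHecke_succ {l : ℕ} (hl : l < n)
    (hs : ∀ i, 1 ≤ i → i < l → tau L i * aHecke L l = aHecke L l * tau L (l - i))
    (hq : 1 ≤ l → tau L 0 * aHecke L l = expo (L (gen cs 0)) • aHecke L l) :
    tau L 0 * aHecke L (l + 1) = expo (L (gen cs 0)) • aHecke L (l + 1) := by
  have h1 := tau_zero_mul_sub L hl hs hq
  have hq' : expo (L (gen cs 0)) * expo (-L (gen cs 0)) = 1 := by
    rw [expo_mul, add_neg_cancel, expo_zero]
  rw [aHecke, add_mul, smul_mul_assoc, mul_add, mul_assoc,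
    tau_zero_mul_tau_zero L (by omega), mul_smul_comm]
  set X := tauProd L l * aHecke L l
  set Y := tauInvProd L l * aHecke L l
  rw [sub_mul, mul_sub] at h1
  have h2 : tau L 0 * X = tau L 0 * Y + expo (L (gen cs 0)) • (X - Y) := by
    rw [← h1]; abel
  set Q := expo (L (gen cs 0))
  set Q' := expo (-L (gen cs 0))
  rw [smul_add, smul_smul, hq', one_smul, h2]
  have h3 : Q' • Q • (X - Y) = X - Y := by rw [smul_smul, mul_comm, hq', one_smul]
  rw [sub_smul, smul_add Q', h3]
  module

/-- With P and P' the products of the T_{s_i} and of their inverses, bar turns T_t P + e^{-b} P'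
into T_t⁻¹ P' + e^b P. After multiplication by c_l these agree exactly because T_t (P - P') c_l =
e^b (P - P') c_l. -/
theorem bar_aHecke_succ {l : ℕ} (hl : l < n)
    (hs : ∀ i, 1 ≤ i → i < l → tau L i * aHecke L l = aHecke L l * tau L (l - i))
    (hq : 1 ≤ l → tau L 0 * aHecke L l = expo (L (gen cs 0)) • aHecke L l)
    (hb : bar L (aHecke L l) = aHecke L l) :
    bar L (aHecke L (l + 1)) = aHecke L (l + 1) := by
  have h1 := tau_zero_mul_sub L hl hs hq
  have h0 : tauInv L 0 = tau L 0 -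
      (expo (L (gen cs 0)) - expo (-L (gen cs 0))) • (1 : Hecke L) := by
    rw [tauInv_of_lt L (by omega), tau_of_lt L (by omega), Tinv, xi, L_simple_zero]
  rw [aHecke, bar_mul, hb, bar_add, bar_tau_mul, bar_tauProd, bar_smul, bar_tauInvProd, conj_expo,
    neg_neg, h0, add_mul, add_mul, sub_mul, sub_mul, smul_mul_assoc, smul_mul_assoc, smul_mul_assoc,
    smul_mul_assoc, one_mul, mul_assoc, mul_assoc]
  set X := tauProd L l * aHecke L l
  set Y := tauInvProd L l * aHecke L l
  rw [sub_mul, mul_sub] at h1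
  have h2 : tau L 0 * X = tau L 0 * Y + expo (L (gen cs 0)) • (X - Y) := by
    rw [← h1]; abel
  rw [h2]
  module

/-- Moving s_{i+1} through the new left factor lowers its index by one, and c_l then reflects it.
This covers all indices for c_{l+1} except the first. -/
theorem tau_mul_aHecke_succ {l i : ℕ} (hl : l < n) (h0 : i ≠ 0) (hi : i < l)
    (hs : tau L i * aHecke L l = aHecke L l * tau L (l - i)) :
    tau L (i + 1) * aHecke L (l + 1) = aHecke L (l + 1) * tau L (l - i) := by
  have c : Commute (tau L 0) (tau L (i + 1)) := tau_comm L (by omega) (by omega)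
  rw [aHecke, add_mul, mul_add, add_mul]
  congr 1
  · rw [← mul_assoc, ← mul_assoc, ← c.eq, mul_assoc (tau L 0), tau_mul_tauProd L h0 (by omega) hl,
      ← mul_assoc, mul_assoc _ (tau L i), hs]
    simp only [mul_assoc]
  · rw [smul_mul_assoc, mul_smul_comm, smul_mul_assoc, ← mul_assoc,
      tau_mul_tauInvProd L h0 (by omega) hl, mul_assoc, hs, mul_assoc]

/-- The one relation with index 1 that cannot be obtained from another index by symmetry; it is the
order-4 braid relation after expansion. -/
theorem tau_one_mul_aHecke_two (hn : 1 < n) :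
    tau L 1 * aHecke L 2 = aHecke L 2 * tau L 1 := by
  have hb := tau_braid_four L hn
  have h1 : tauInv L 1 = tau L 1 - xi L ⟨1, hn⟩ • (1 : Hecke L) := by
    rw [tauInv_of_lt L hn, tau_of_lt L hn, Tinv]
  have h2 : tau L 1 * tau L 1 = 1 + xi L ⟨1, hn⟩ • tau L 1 := by
    rw [tau_of_lt L hn, T_simple_mul_self]
  have h3 := tau_mul_tauInv L 1
  have h4 := tauInv_mul_tau L 1
  have e : aHecke L 2 = (tau L 0 * tau L 1 + expo (-L (gen cs 0)) • tauInv L 1) *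
      (tau L 0 + expo (-L (gen cs 0)) • (1 : Hecke L)) := by
    simp [aHecke, tauProd, tauInvProd]
  rw [e]
  set A := tau L 0
  set B := tau L 1
  set D := tauInv L 1
  set c := expo (-L (gen cs 0))
  have e1 : B * ((A * B + c • D) * (A + c • (1 : Hecke L))) =
      B * A * B * A + c • (B * A * B) + c • (B * D * A) + (c * c) • (B * D) := by
    simp only [mul_add, add_mul, smul_mul_assoc, mul_smul_comm, mul_one, mul_assoc, smul_smul,
      smul_add]
    abel
  have e2 : (A * B + c • D) * (A + c • (1 : Hecke L)) * B =
      A * B * A * B + c • (A * (B * B)) + c • (D * A * B) + (c * c) • (D * B) := by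
    simp only [mul_add, add_mul, smul_mul_assoc, mul_smul_comm, mul_one, mul_assoc, smul_smul,
      smul_add]
    abel
  rw [e1, e2, h3, h4, hb, h2, h1]
  simp only [mul_add, sub_mul, smul_mul_assoc, mul_smul_comm, mul_one, one_mul, smul_sub, smul_add]
  abel

end HeckeTypeB

/-! ### Degree estimates in the asymptotic range. -/

section DegreeEstimate

variable {n : ℕ} {W : Type*} [Group W] {cs : CoxeterSystem (typeB n) W}
variable {Γ : Type*} [AddCommGroup Γ] [LinearOrder Γ] [IsOrderedAddMonoid Γ]
variable (L : WeightFunction cs Γ)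

/-- The subgroup of `H` generated by the `p T_z` with `p` of degree at most `γ`, where `R z γ`. -/
noncomputable def degSpan (R : W → Γ → Prop) : AddSubgroup (Hecke L) :=
  AddSubgroup.closure {h | ∃ z γ, R z γ ∧ ∃ p ∈ degLE γ, h = p • T L z}

theorem smul_T_mem_degSpan {R : W → Γ → Prop} {z : W} {γ : Γ} (h : R z γ) {p : Coef Γ}
    (hp : p ∈ degLE γ) : p • T L z ∈ degSpan L R :=
  AddSubgroup.subset_closure ⟨z, γ, h, p, hp, rfl⟩

theorem mul_mem_of_mem_degSpan {R : W → Γ → Prop} {S : AddSubgroup (Hecke L)} {k h : Hecke L}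
    (hh : h ∈ degSpan L R)
    (hS : ∀ z γ p, R z γ → p ∈ degLE γ → p • (k * T L z) ∈ S) : k * h ∈ S := by
  induction hh using AddSubgroup.closure_induction with
  | mem x hx =>
    obtain ⟨z, γ, hR, p, hp, rfl⟩ := hx
    rw [mul_smul_comm]
    exact hS z γ p hR hp
  | zero => rw [mul_zero]; exact zero_mem _
  | add x y _ _ hx hy => rw [mul_add]; exact add_mem hx hy
  | neg x _ hx => rw [mul_neg]; exact neg_mem hx

theorem smul_mem_of_mem_degSpan {R : W → Γ → Prop} {S : AddSubgroup (Hecke L)} {h : Hecke L}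
    {δ : Γ} {r : Coef Γ} (hr : r ∈ degLE δ) (hh : h ∈ degSpan L R)
    (hS : ∀ z γ p, R z γ → p ∈ degLE (δ + γ) → p • T L z ∈ S) : r • h ∈ S := by
  induction hh using AddSubgroup.closure_induction with
  | mem x hx =>
    obtain ⟨z, γ, hR, p, hp, rfl⟩ := hx
    rw [smul_smul]
    exact hS z γ _ hR (mul_mem_degLE hr hp)
  | zero => rw [smul_zero]; exact zero_mem _
  | add x y _ _ hx hy => rw [smul_add]; exact add_mem hx hy
  | neg x _ hx => rw [smul_neg]; exact neg_mem hx

variable {L}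

theorem xi_mem_degLE {i : Fin n} {a : Γ} (h : L (cs.simple i) = a) : xi L i ∈ degLE a := by
  have h0 := L.pos i
  rw [xi, h]
  exact sub_mem (expo_mem_degLE le_rfl) (expo_mem_degLE (by
    rw [h] at h0; exact (neg_neg_of_pos h0).le.trans h0.le))

/-- The two positions of the window that are moved by a left ascent within the distinguished
coset representatives. -/
theorem IsRep.ascent_positions {l : ℕ} {a : W} {i : Fin n} (ha : IsRep cs l a)
    (hia : IsRep cs l (cs.simple i * a)) (h : cs.length a < cs.length (cs.simple i * a)) :
    (i : ℕ) ≠ 0 ∧ 0 < win cs a i ∧ win cs a i ≤ l ∧ (l : ℤ) < win cs a (i + 1) := by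
  have hi : (i : ℕ) ≠ 0 := by
    refine ne_zero_of_not_asc cs hia.mem ?_
    rw [← length_gt_iff, cs.simple_mul_simple_cancel_left]
    exact h
  rw [length_lt_iff, asc_iff cs hi] at h
  have h1 := win_pos cs ha.mem (x := i) (by omega)
  refine ⟨hi, h1, ?_⟩
  by_contra hc
  have h2 := hia.win_lt h1 h (win_le cs a (by have := i.2; omega)) (by omega)
  rw [mul_inv_rev, win_mul, win_mul, win_inv_win, win_inv_win, cs.inv_simple, win_simple,
    win_simple, sgen_eq (y := i + 1) (by omega), sgen_eq (y := i) (by omega)] at h2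
  omega

/-- A left ascent among representatives compares a position ≤ l with one > l; here the first carries
a negative and the second a positive entry, so each letter of a increases the length and no ξ
appears. -/
theorem T_mul_T_of_neg {l : ℕ} {a z : W} (ha : IsRep cs l a)
    (hz : ∀ x : ℤ, l < x → 0 < win cs z x)
    (hz' : ∀ x : ℤ, 0 < x → x ≤ l → win cs z x < 0) : T L a * T L z = T L (a * z) := by
  induction a using length_induction cs with
  | h1 => rw [T_one, one_mul, one_mul]
  | hs i a h ih =>
    have ha' : IsRep cs l a := by
      have := ha.simple_mul (i := i) (by rwa [cs.simple_mul_simple_cancel_left])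
      rwa [cs.simple_mul_simple_cancel_left] at this
    obtain ⟨hi, h1, h2, h3⟩ := ha'.ascent_positions ha h
    rw [← T_simple_mul_of_lt L h, mul_assoc, ih ha', mul_assoc]
    apply T_simple_mul_of_asc
    rw [asc_iff cs hi, win_mul, win_mul]
    exact (hz' _ h1 h2).trans (hz _ h3)

/-- The bound for the number of times that a coefficient can be multiplied by `ξ` in the product
`T_a T_z`. -/
noncomputable def potential (cs : CoxeterSystem (typeB n) W) (l : ℕ) (a y : W) : ℤ :=
  ∑ x ∈ Finset.Icc (1 : ℤ) l, if 0 < win cs y x then win cs a⁻¹ x - x else 0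

theorem potential_one (l : ℕ) (y : W) : potential cs l 1 y = 0 :=
  Finset.sum_eq_zero fun x _ => by rw [inv_one, win_one, sub_self, ite_self]

/-- Multiplying letter by letter, a factor ξ can arise only when the entry at the position ≤ l that
is being moved is positive. The letter also moves that position one step further from its origin, so
the number of ξ's is bounded by the total displacement of the positive entries. -/
theorem T_mul_T_mem {l : ℕ} {a z : W} {α : Γ}
    (hα : ∀ i : Fin n, (i : ℕ) ≠ 0 → L (cs.simple i) = α)
    (ha : IsRep cs l a) (hz : ∀ x : ℤ, l < x → 0 < win cs z x) :
    T L a * T L z ∈ degSpan L fun v γ => ∃ y, v = a * y ∧ (∀ x : ℤ, l < x → 0 < win cs y x) ∧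
      negCount cs y = negCount cs z ∧ ∃ c : ℤ, c ≤ potential cs l a y ∧ γ = c • α := by
  induction a using length_induction cs with
  | h1 =>
    rw [T_one, one_mul, ← one_smul (Coef Γ) (T L z)]
    refine smul_T_mem_degSpan L (γ := 0) ⟨z, (one_mul z).symm, hz, rfl, 0,
      (potential_one l z).ge, (zero_smul ℤ α).symm⟩ ?_
    rw [← expo_zero]
    exact expo_mem_degLE le_rfl
  | hs i a h ih =>
    have ha' : IsRep cs l a := by
      have := ha.simple_mul (i := i) (by rwa [cs.simple_mul_simple_cancel_left])
      rwa [cs.simple_mul_simple_cancel_left] at this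
    obtain ⟨hi, h1, h2, h3⟩ := ha'.ascent_positions ha h
    rw [← T_simple_mul_of_lt L h, mul_assoc]
    refine mul_mem_of_mem_degSpan L (ih ha') ?_
    rintro _ _ p ⟨y, rfl, hy, hyz, c, hc, rfl⟩ hp
    have hwin : ∀ x, win cs (cs.simple i * a)⁻¹ x = sgen i (win cs a⁻¹ x) := fun x => by
      rw [mul_inv_rev, win_mul, cs.inv_simple, win_simple]
    have hge : ∀ x : ℤ, 0 < x → x ≤ l → win cs a⁻¹ x ≤ win cs (cs.simple i * a)⁻¹ x := by
      intro x hx hxl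
      rw [hwin]
      have h4 := sgen_apply hi (win cs a⁻¹ x)
      have h5 := win_pos cs (inv_mem ha'.mem) hx
      rcases h4 with h4 | h4 | h4 | h4 | h4
      · omega
      · exfalso
        rw [← h4.1, win_win_inv] at h3
        omega
      · omega
      · omega
      · exact h4.2.2.2.2.ge
    have hmain : p • T L (cs.simple i * a * y) ∈ degSpan L fun v γ => ∃ y, v = cs.simple i * a * y ∧
        (∀ x : ℤ, l < x → 0 < win cs y x) ∧ negCount cs y = negCount cs z ∧
        ∃ c : ℤ, c ≤ potential cs l (cs.simple i * a) y ∧ γ = c • α := by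
      refine smul_T_mem_degSpan L ⟨y, rfl, hy, hyz, c, hc.trans ?_, rfl⟩ hp
      refine Finset.sum_le_sum fun x hx => ?_
      rw [Finset.mem_Icc] at hx
      have := hge x (by omega) hx.2
      split_ifs <;> omega
    rcases lt_or_gt_of_ne (cs.length_simple_mul_ne (a * y) i) with h4 | h4
    swap
    · rw [T_simple_mul_of_lt L h4, ← mul_assoc]
      exact hmain
    rw [T_simple_mul_of_gt L h4, ← mul_assoc, smul_add, smul_smul]
    refine add_mem hmain ?_
    rw [length_gt_iff, asc_iff cs hi, not_lt, win_mul, win_mul] at h4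
    have h5 := hy _ h3
    -- The term that carries ξ is rewritten relative to the longer representative s_i a. Its y is
    -- modified by exchanging the entries at the two positions that s_i compares, both of which are
    -- positive.
    have e : a * y = cs.simple i * a * (a⁻¹ * (cs.simple i * (a * y))) := by
      rw [mul_assoc (cs.simple i), mul_inv_cancel_left, cs.simple_mul_simple_cancel_left]
    have hy' : ∀ x, win cs (a⁻¹ * (cs.simple i * (a * y))) x =
        win cs y (win cs a (sgen i (win cs a⁻¹ x))) := fun x => by
      rw [win_mul, win_simple_mul, win_mul]
    have hy1 : win cs (a⁻¹ * (cs.simple i * (a * y))) (win cs a i) =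
        win cs y (win cs a (i + 1)) := by
      rw [hy', win_inv_win, sgen_eq (y := i + 1) (by omega)]
    have hy2 : win cs (a⁻¹ * (cs.simple i * (a * y))) (win cs a (i + 1)) =
        win cs y (win cs a i) := by
      rw [hy', win_inv_win, sgen_eq (y := i) (by omega)]
    have hy3 : ∀ x : ℤ, 0 < x → x ≠ win cs a i → x ≠ win cs a (i + 1) →
        win cs (a⁻¹ * (cs.simple i * (a * y))) x = win cs y x := by
      intro x hx hx1 hx2
      have h6 := win_pos cs (inv_mem ha'.mem) hx
      rw [hy', sgen_eq (y := win cs a⁻¹ x), win_win_inv]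
      refine Or.inr ⟨hi, Or.inr (Or.inr (Or.inr (Or.inr ⟨?_, ?_, by omega, by omega, rfl⟩)))⟩
      · intro h7; rw [← h7, win_win_inv] at hx1; exact hx1 rfl
      · intro h7; rw [← h7, win_win_inv] at hx2; exact hx2 rfl
    rw [e]
    refine smul_T_mem_degSpan L (γ := (c + 1) • α) ⟨_, rfl, ?_, ?_, c + 1, ?_, rfl⟩ (by
      rw [add_smul, one_smul]
      exact mul_mem_degLE hp (xi_mem_degLE (hα i hi)))
    · intro x hx
      by_cases hx2 : x = win cs a (i + 1)
      · rw [hx2, hy2]; omega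
      · rw [hy3 x (by omega) (by omega) hx2]; exact hy x hx
    · rw [negCount_young_mul cs (inv_mem ha'.mem), negCount_simple_mul cs hi,
        negCount_young_mul cs ha'.mem, hyz]
    -- Strictness comes from the position sent to i by a⁻¹: it is now sent to i + 1 and its entry is
    -- still positive, which pays for the new ξ.
    · refine Int.add_one_le_iff.2 (lt_of_le_of_lt hc ?_)
      refine Finset.sum_lt_sum (fun x hx => ?_) ⟨win cs a i, ?_, ?_⟩
      · rw [Finset.mem_Icc] at hx
        have h6 := hge x (by omega) hx.2
        by_cases hx1 : x = win cs a i
        · rw [hx1, hy1, if_pos h5, if_pos (by omega), ← hx1]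
          omega
        · rw [hy3 x (by omega) hx1 (by omega)]
          split_ifs <;> omega
      · rw [Finset.mem_Icc]; omega
      · rw [hy1, if_pos h5, if_pos (by omega), hwin, win_inv_win, sgen_eq (y := i + 1) (by omega)]
        omega

theorem card_pos_add_negCount {l : ℕ} (hl : l ≤ n) {y : W}
    (hy : ∀ x : ℤ, l < x → 0 < win cs y x) :
    ((Finset.Icc (1 : ℤ) l).filter fun x => 0 < win cs y x).card + negCount cs y = l := by
  have h1 : (Finset.Icc (1 : ℤ) n).filter (fun x => win cs y x < 0) =
      (Finset.Icc (1 : ℤ) l).filter fun x => ¬0 < win cs y x := by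
    ext x
    simp only [Finset.mem_filter, Finset.mem_Icc]
    constructor
    · rintro ⟨h1, h2⟩
      have := mt (hy x) (by omega)
      omega
    · rintro ⟨h1, h2⟩
      have := win_ne_zero cs y (x := x) (by omega)
      omega
  rw [negCount, h1, Finset.card_filter_add_card_filter_not]
  simp

/-- Since the entries beyond l are positive, exactly m = l - `negCount cs y` entries on [1, l] are
positive, and only these contribute. -/
theorem potential_le {l : ℕ} (hl : l ≤ n) {a y : W} {K : ℤ}
    (hK : ∀ x : ℤ, 0 < x → x ≤ l → win cs a⁻¹ x - x ≤ K)
    (hy : ∀ x : ℤ, l < x → 0 < win cs y x) {m : ℕ} (hm : negCount cs y + m = l) :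
    potential cs l a y ≤ m * K := by
  have h1 := card_pos_add_negCount hl hy
  rw [potential, ← Finset.sum_filter]
  refine (Finset.sum_le_card_nsmul _ _ K fun x hx => ?_).trans (le_of_eq ?_)
  · rw [Finset.mem_filter, Finset.mem_Icc] at hx
    exact hK x (by omega) hx.1.2
  · rw [nsmul_eq_mul]
    congr 2
    omega

theorem T_ascProd {k : ℕ} (hk : k < n) : tauProd L k = T L (ascProd cs k) := by
  induction k with
  | zero => rw [tauProd, ascProd, T_one]
  | succ k ih =>
    rw [tauProd, ascProd, ih (by omega), tau_of_lt L hk, gen_of_lt cs hk]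
    apply T_mul_simple_of_lt
    rw [length_mul_lt_iff, asc_iff cs (show k + 1 ≠ 0 by omega),
      win_ascProd_inv cs (by omega) (by positivity),
      win_ascProd_inv cs (by omega) (by positivity)]
    push_cast
    split_ifs <;> omega

/-- The terms that occur in `C_{a_l} T_w` besides the leading one. -/
def LowerTerm (cs : CoxeterSystem (typeB n) W) (α β : Γ) (l : ℕ) (v : W) (γ : Γ) : Prop :=
  (∀ x : ℤ, l < x → 0 < win cs v x) ∧
    ∃ m : ℕ, m ≠ 0 ∧ negCount cs v + m = l ∧ γ = (m : ℤ) • (((l : ℤ) - 1) • α - β)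

/-- T_s⁻¹ is T_s - ξ_s: at a descent the ξ cancels, at an ascent it costs one α. Letters up to s_l
do not touch positions beyond l + 1 and create no signs. -/
theorem tauInvProd_mul_mem {l k : ℕ} {α : Γ}
    (hα : ∀ i : Fin n, (i : ℕ) ≠ 0 → L (cs.simple i) = α) (h0 : 0 ≤ α) (hk : k ≤ l) (hl : l < n)
    {z : W} (hz : ∀ x : ℤ, (l : ℤ) + 1 < x → 0 < win cs z x) {γ : Γ} {p : Coef Γ}
    (hp : p ∈ degLE γ) : p • (tauInvProd L k * T L z) ∈ degSpan L fun v δ =>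
      (∀ x : ℤ, (l : ℤ) + 1 < x → 0 < win cs v x) ∧ negCount cs v = negCount cs z ∧
        δ = γ + (k : ℤ) • α := by
  induction k generalizing z γ p with
  | zero =>
    rw [tauInvProd, one_mul]
    exact smul_T_mem_degSpan L ⟨hz, rfl, by simp⟩ hp
  | succ k ih =>
    have hk1 : k + 1 < n := by omega
    have hi : ((⟨k + 1, hk1⟩ : Fin n) : ℕ) ≠ 0 := Nat.succ_ne_zero k
    have e : ∀ δ, δ = γ + ((k + 1 : ℕ) : ℤ) • α ↔ δ = γ + α + (k : ℤ) • α := fun δ => by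
      rw [Nat.cast_succ, add_smul, one_smul, add_assoc, add_comm α]
    simp only [e]
    have hp' : p ∈ degLE (γ + α) := degLE_mono (le_add_of_nonneg_right h0) hp
    have h1 := ih (by omega) (z := cs.simple ⟨k + 1, hk1⟩ * z) (fun x hx => by
      rw [win_simple_mul, sgen_eq (y := x) (by push_cast; omega)]
      exact hz x hx) hp'
    rw [negCount_simple_mul cs hi] at h1
    rw [tauInvProd, mul_assoc, tauInv_of_lt L hk1, Tinv, sub_mul, smul_mul_assoc, one_mul]
    rcases lt_or_gt_of_ne (cs.length_simple_mul_ne z ⟨k + 1, hk1⟩) with h2 | h2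
    · rwa [T_simple_mul_of_gt L h2, add_sub_cancel_right]
    · rw [T_simple_mul_of_lt L h2, mul_sub, smul_sub, mul_smul_comm, smul_smul]
      exact sub_mem h1 (ih (by omega) hz (mul_mem_degLE hp (xi_mem_degLE (hα _ hi))))

/-- Induction on l along the recursion for c_l, with D the previous error. T_t T_{s_1 ⋯ s_l} takes
the leading term to the next one, and takes D to terms with the same number m of missing signs, each
missing sign allowing one more α. The summand with e^{-β} omits t, so m grows by one, and its
inverse factors gain at most lα. -/
theorem aHecke_mul_T_sub_mem {α β : Γ} (hα : ∀ i : Fin n, (i : ℕ) ≠ 0 → L (cs.simple i) = α)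
    (hβ : L (gen cs 0) = β) (h0 : 0 ≤ α) {l : ℕ} (hl : l ≤ n) {w : W} (hw : w ∈ young cs 0) :
    aHecke L l * T L w - T L (aElt cs l * w) ∈ degSpan L (LowerTerm cs α β l) := by
  induction l with
  | zero =>
    rw [aHecke, aElt, one_mul, one_mul, sub_self]
    exact zero_mem _
  | succ l ih =>
    have hln : l < n := hl
    have hD := ih hln.le
    set D := aHecke L l * T L w - T L (aElt cs l * w) with hDdef
    have hz : ∀ x : ℤ, (l : ℤ) < x → 0 < win cs (aElt cs l * w) x := by
      intro x hx
      rw [win_mul, win_aElt cs hln.le (by omega), if_neg (by omega)]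
      exact win_pos cs hw (by omega)
    have hz' : ∀ x : ℤ, 0 < x → x ≤ l → win cs (aElt cs l * w) x < 0 := by
      intro x hx hxl
      rw [win_mul, win_lt_zero_iff cs hw, win_aElt_lt_zero_iff cs hln.le hx]
      exact hxl
    have hneg : negCount cs (aElt cs l * w) = l := by
      rw [negCount_mul_young cs hw, negCount_aElt cs hln.le]
    have hrep := isRep_ascProd cs hln
    have asc0 : ∀ y : W, (∀ x : ℤ, (l : ℤ) < x → 0 < win cs y x) →
        0 < win cs (ascProd cs l * y) 1 := by
      intro y hy
      rw [win_mul, win_ascProd cs hln one_pos, if_pos rfl]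
      exact hy _ (by omega)
    have h00 : (0 : ℕ) < n := by omega
    have up : ∀ y : W, (∀ x : ℤ, (l : ℤ) < x → 0 < win cs y x) →
        tau L 0 * T L (ascProd cs l * y) = T L (gen cs 0 * (ascProd cs l * y)) := by
      intro y hy
      rw [tau_of_lt L h00, gen_of_lt cs h00]
      apply T_simple_mul_of_asc
      exact (asc_zero_iff cs _).2 (asc0 y hy)
    have lead : tau L 0 * (tauProd L l * T L (aElt cs l * w)) = T L (aElt cs (l + 1) * w) := by
      rw [T_ascProd hln, T_mul_T_of_neg hrep hz hz', up _ hz, aElt_succ cs hln]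
      simp only [mul_assoc]
    have hQ : expo (-L (gen cs 0)) ∈ degLE (-β) := by
      rw [hβ]; exact expo_mem_degLE le_rfl
    have split : aHecke L (l + 1) * T L w - T L (aElt cs (l + 1) * w) =
        tau L 0 * (tauProd L l * D) + (expo (-L (gen cs 0)) • (tauInvProd L l * D) +
          expo (-L (gen cs 0)) • (tauInvProd L l * T L (aElt cs l * w))) := by
      have h1 : aHecke L l * T L w = D + T L (aElt cs l * w) := by rw [hDdef]; abel
      rw [aHecke, mul_assoc, h1, add_mul, smul_mul_assoc, mul_add, mul_assoc, mul_assoc, mul_add,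
        lead, smul_add]
      abel
    rw [split]
    refine add_mem ?_ (add_mem ?_ ?_)
    · rw [← mul_assoc]
      refine mul_mem_of_mem_degSpan L hD ?_
      rintro z _ p ⟨hz1, m, hm0, hm, rfl⟩ hp
      rw [mul_assoc, T_ascProd hln, ← mul_smul_comm]
      have h1 := T_mul_T_mem hα hrep hz1
      refine mul_mem_of_mem_degSpan L (R := fun v γ => ∃ y, v = ascProd cs l * y ∧
        (∀ x : ℤ, l < x → 0 < win cs y x) ∧ negCount cs y = negCount cs z ∧
        γ = (m : ℤ) • (((l : ℤ) - 1) • α - β) + (m : ℤ) • α)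
        (smul_mem_of_mem_degSpan L hp h1 ?_) ?_
      · rintro _ _ r ⟨y, rfl, hy1, hy2, c, hc, rfl⟩ hr
        refine smul_T_mem_degSpan L ⟨y, rfl, hy1, hy2, rfl⟩ (degLE_mono ?_ hr)
        -- The inverse of s_1 ⋯ s_l shifts every position of [1, l] by one only.
        have h2 : potential cs l (ascProd cs l) y ≤ m * 1 := by
          refine potential_le hln.le (fun x hx hxl => ?_) hy1 (by omega)
          rw [win_ascProd_inv cs hln hx, if_pos hxl]
          omega
        rw [mul_one] at h2
        exact add_le_add le_rfl (zsmul_le_zsmul_left h0 (hc.trans h2))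
      · rintro _ _ r ⟨y, rfl, hy1, hy2, rfl⟩ hr
        rw [up y hy1]
        refine smul_T_mem_degSpan L (γ := (m : ℤ) • ((((l + 1 : ℕ) : ℤ) - 1) • α - β))
          ⟨?_, m, hm0, ?_, rfl⟩ (by
            convert hr using 2
            push_cast
            module)
        · intro x hx
          push_cast at hx
          rw [win_gen_mul cs h00, sgen_eq (k := 0) (y := x) (by omega), win_mul,
            win_ascProd cs hln (by omega), if_neg (by omega), if_neg (by omega)]
          exact hy1 x (by omega)
        · rw [gen_of_lt cs h00, negCount_simple_zero_mul cs rfl (asc0 y hy1),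
            negCount_young_mul cs hrep.mem]
          omega
    · refine smul_mem_of_mem_degSpan L hQ (R := fun v γ =>
        (∀ x : ℤ, (l : ℤ) + 1 < x → 0 < win cs v x) ∧ ∃ m : ℕ, m ≠ 0 ∧ negCount cs v + m = l ∧
          γ = (m : ℤ) • (((l : ℤ) - 1) • α - β) + (l : ℤ) • α) ?_ ?_
      · refine mul_mem_of_mem_degSpan L hD ?_
        rintro z _ p ⟨hz1, m, hm0, hm, rfl⟩ hp
        have h1 := tauInvProd_mul_mem hα h0 le_rfl hln (z := z) (fun x hx => hz1 x (by omega)) hp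
        rw [← one_smul (Coef Γ) (p • _)]
        refine smul_mem_of_mem_degSpan L (δ := 0) ?_ h1 ?_
        · rw [← expo_zero]; exact expo_mem_degLE le_rfl
        · rintro v _ r ⟨h2, h3, rfl⟩ hr
          rw [zero_add] at hr
          exact smul_T_mem_degSpan L ⟨h2, m, hm0, by omega, rfl⟩ hr
      · rintro v _ r ⟨h2, m, hm0, hm, rfl⟩ hr
        refine smul_T_mem_degSpan L (γ := ((m + 1 : ℕ) : ℤ) • ((((l + 1 : ℕ) : ℤ) - 1) • α - β))
          ⟨by push_cast; exact h2, m + 1, by omega, by omega, rfl⟩ (degLE_mono ?_ hr)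
        -- The allowed exponent exceeds the actual one by mα, which is ≥ 0.
        have h3 : ((m + 1 : ℕ) : ℤ) • ((((l + 1 : ℕ) : ℤ) - 1) • α - β) =
            -β + ((m : ℤ) • (((l : ℤ) - 1) • α - β) + (l : ℤ) • α) + (m : ℤ) • α := by
          push_cast
          module
        rw [h3]
        exact le_add_of_nonneg_right (zsmul_nonneg h0 (by omega))
    · have h1 := tauInvProd_mul_mem hα h0 le_rfl hln (z := aElt cs l * w)
        (fun x hx => hz x (by omega)) hQ
      rw [← one_smul (Coef Γ) (expo (-L (gen cs 0)) • _)]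
      refine smul_mem_of_mem_degSpan L (δ := 0) ?_ h1 ?_
      · rw [← expo_zero]; exact expo_mem_degLE le_rfl
      · rintro v _ r ⟨h2, h3, rfl⟩ hr
        rw [zero_add] at hr
        refine smul_T_mem_degSpan L (γ := ((1 : ℕ) : ℤ) • ((((l + 1 : ℕ) : ℤ) - 1) • α - β))
          ⟨by push_cast; exact h2, 1, one_ne_zero, by omega, rfl⟩ ?_
        convert hr using 2
        push_cast
        module

/-- A term with m missing signs starts in degree m((l-1)α - β), and T_a raises it by at most
m(n-l)α. The sum m((n-1)α - β) is negative, and this is where the asymptotic hypothesis enters. -/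
theorem T_mul_aHecke_mul_T_sub_mem {α β : Γ}
    (hα : ∀ i : Fin n, (i : ℕ) ≠ 0 → L (cs.simple i) = α) (hβ : L (gen cs 0) = β) (h0 : 0 ≤ α)
    (hαβ : (n - 1) • α < β) {l : ℕ} (hl : l ≤ n) {a w : W} (ha : IsRep cs l a)
    (hw : w ∈ young cs 0) :
    T L a * aHecke L l * T L w - T L (a * aElt cs l * w) ∈ negH L := by
  have hz : ∀ x : ℤ, (l : ℤ) < x → 0 < win cs (aElt cs l * w) x := by
    intro x hx
    rw [win_mul, win_aElt cs hl (by omega), if_neg (by omega)]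
    exact win_pos cs hw (by omega)
  have hz' : ∀ x : ℤ, 0 < x → x ≤ l → win cs (aElt cs l * w) x < 0 := by
    intro x hx hxl
    rw [win_mul, win_lt_zero_iff cs hw, win_aElt_lt_zero_iff cs hl hx]
    exact hxl
  rw [mul_assoc, mul_assoc, ← T_mul_T_of_neg ha hz hz', ← mul_sub]
  refine mul_mem_of_mem_degSpan L (aHecke_mul_T_sub_mem hα hβ h0 hl hw) ?_
  rintro z _ p ⟨hz1, m, hm0, hm, rfl⟩ hp
  refine smul_mem_of_mem_degSpan L hp (T_mul_T_mem hα ha hz1) ?_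
  rintro _ _ r ⟨y, rfl, hy1, hy2, c, hc, rfl⟩ hr
  refine smul_T_mem_negH L (degLE_le_negPart ?_ hr) _
  have h2 : potential cs l a y ≤ m * (n - l) := by
    refine potential_le hl (fun x hx hxl => ?_) hy1 (by omega)
    obtain ⟨k, hk⟩ : ∃ k : ℕ, x + k = l := ⟨(l - x).toNat, by omega⟩
    -- As a⁻¹ increases on [1, l] with values at most n, the l - x entries behind x force a⁻¹(x) ≤ n
    -- - (l - x), so every displacement is at most n - l.
    have key : ∀ k : ℕ, ∀ x : ℤ, 0 < x → x + k = l → win cs a⁻¹ x + k ≤ n := by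
      intro k
      induction k with
      | zero =>
        intro x hx hk
        have := win_le cs a⁻¹ (x := x) (by push_cast at hk; omega)
        push_cast
        omega
      | succ k ih =>
        intro x hx hk
        push_cast at hk ⊢
        have h3 := ih (x + 1) (by omega) (by omega)
        have h4 := ha.win_lt hx (show x < x + 1 by omega) (by omega) (Or.inl (by omega))
        omega
    have := key k x hx hk
    omega
  have h3 : c • α ≤ ((m : ℤ) * (n - l)) • α := zsmul_le_zsmul_left h0 (hc.trans h2)
  -- Since m ≠ 0, also n ≥ 1, so the truncated n - 1 in the hypothesis is the integer n - 1.
  have hl1 : 1 ≤ l := by omega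
  have h4 : (m : ℤ) • (((l : ℤ) - 1) • α - β) + ((m : ℤ) * (n - l)) • α =
      (m : ℤ) • ((n - 1) • α - β) := by
    have : (n - 1) • α = ((n : ℤ) - 1) • α := by
      rw [← natCast_zsmul]
      congr 1
      omega
    rw [this]
    module
  refine lt_of_le_of_lt (add_le_add le_rfl h3) ?_
  rw [h4]
  have h5 : (n - 1) • α - β < 0 := sub_neg.2 hαβ
  rw [natCast_zsmul]
  exact nsmul_neg h5 hm0

end DegreeEstimate

/-! ### C_{a a_l w} compared with T_a C_{a_l} C_w. -/

section Cells

variable {n : ℕ} {W : Type*} [Group W] {cs : CoxeterSystem (typeB n) W}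
variable {Γ : Type*} [AddCommGroup Γ] [LinearOrder Γ] [IsOrderedAddMonoid Γ]

/-- The weight function is in the asymptotic range, and takes the value `α` on the generators
`s_1, …, s_{n-1}`. -/
structure IsAsymptotic (L : WeightFunction cs Γ) (α : Γ) : Prop where
  simple : ∀ i : Fin n, (i : ℕ) ≠ 0 → L (cs.simple i) = α
  nonneg : 0 ≤ α
  lt : (n - 1) • α < L (gen cs 0)

variable {L : WeightFunction cs Γ} {α : Γ}

theorem IsAsymptotic.T_mul_sub_mem (hL : IsAsymptotic L α) {l : ℕ} (hl : l ≤ n) {a w : W}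
    (ha : IsRep cs l a) (hw : w ∈ young cs 0) :
    T L a * aHecke L l * T L w - T L (a * aElt cs l * w) ∈ negH L :=
  T_mul_aHecke_mul_T_sub_mem hL.simple rfl hL.nonneg hL.lt hl ha hw

theorem IsAsymptotic.C_aElt (hL : IsAsymptotic L α) {l : ℕ} (hl : l ≤ n)
    (hb : bar L (aHecke L l) = aHecke L l) : C L (aElt cs l) = aHecke L l := by
  refine C_eq_of L hb ?_
  have := hL.T_mul_sub_mem hl (isRep_one cs l) (one_mem _)
  rwa [T_one, one_mul, mul_one, one_mul, mul_one] at this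

/-- The three relations are proved together because each step uses all of them at l. Index 1 is the
only one not supplied by the recursion, and it comes from the last index by symmetry. -/
theorem IsAsymptotic.relations (hL : IsAsymptotic L α) {l : ℕ} (hl : l ≤ n) :
    (∀ i, 1 ≤ i → i < l → tau L i * aHecke L l = aHecke L l * tau L (l - i)) ∧
      (1 ≤ l → tau L 0 * aHecke L l = expo (L (gen cs 0)) • aHecke L l) ∧
      bar L (aHecke L l) = aHecke L l := by
  induction l with
  | zero => exact ⟨by omega, by omega, bar_one L⟩
  | succ l ih =>
    obtain ⟨hs, hq, hb⟩ := ih (by omega)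
    have hb' := bar_aHecke_succ L hl hs hq hb
    have key : ∀ i, i ≠ 0 → i < l →
        tau L (i + 1) * aHecke L (l + 1) = aHecke L (l + 1) * tau L (l - i) := fun i h0 hi =>
      tau_mul_aHecke_succ L hl h0 hi (hs i (by omega) hi)
    refine ⟨fun i h1 hi => ?_, fun _ => tau_zero_mul_aHecke_succ L hl hs hq, hb'⟩
    obtain rfl | ⟨j, rfl, hj⟩ : i = 1 ∨ ∃ j, i = j + 1 ∧ j ≠ 0 := by
      rcases Nat.lt_or_ge 1 i with h | h
      · exact Or.inr ⟨i - 1, by omega, by omega⟩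
      · left; omega
    -- Bar invariance and the degree estimate already identify c_{l+1} with C_{a_{l+1}}, and a_{l+1}
    -- is an involution. Flipping the relation at index l then yields the one at index 1.
    · have hflip : flip L (aHecke L (l + 1)) = aHecke L (l + 1) := by
        rw [← hL.C_aElt hl hb', flip_C, aElt_inv cs hl]
      rcases Nat.lt_or_ge l 2 with h | h
      · obtain rfl : l = 1 := by omega
        exact tau_one_mul_aHecke_two L (by omega)
      · have h2 := congrArg (flip L) (key (l - 1) (by omega) (by omega))
        rw [flip_mul, flip_mul, hflip, flip_tau, flip_tau] at h2
        rw [show l - (l - 1) = 1 by omega, show l - 1 + 1 = l by omega] at h2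
        rw [← h2, show l + 1 - 1 = l by omega]
    · rw [key j hj (by omega), show l + 1 - (j + 1) = l - j by omega]

theorem IsAsymptotic.exists_Ts_mul_aHecke (hL : IsAsymptotic L α) {l : ℕ} (hl : l ≤ n) {i : Fin n}
    (hi : i ∈ youngGens n l) :
    ∃ j ∈ youngGens n l, Ts L i * aHecke L l = aHecke L l * Ts L j := by
  have h0 : (i : ℕ) ≠ 0 := hi.1
  have h1 : (i : ℕ) ≠ l := hi.2
  rcases Nat.lt_or_ge i l with h | h
  · have h2 := (hL.relations hl).1 i (by omega) h
    refine ⟨⟨l - i, by omega⟩, ⟨show l - (i : ℕ) ≠ 0 by omega, show l - (i : ℕ) ≠ l by omega⟩, ?_⟩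
    rwa [tau_of_lt L i.2, tau_of_lt L (k := l - i) (by omega)] at h2
  · have h2 := commute_aHecke L (l := l) (j := i) (by omega) i.2
    rw [tau_of_lt L i.2] at h2
    exact ⟨i, hi, h2.eq⟩

theorem mul_mem_of_mem_span {S : Set (Hecke L)} {N : Submodule (Coef Γ) (Hecke L)} {k h : Hecke L}
    (hh : h ∈ Submodule.span (Coef Γ) S) (hS : ∀ x ∈ S, k * x ∈ N) : k * h ∈ N := by
  have key : Submodule.span (Coef Γ) S ≤ N.comap (LinearMap.mulLeft (Coef Γ) k) :=
    Submodule.span_le.2 hS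
  exact key hh

/-! ### The Kazhdan-Lusztig basis of the parabolic subalgebra of the symmetric group -/

theorem Ts_mul_mem_span_young {i : Fin n} (hi : (i : ℕ) ≠ 0) {h : Hecke L}
    (hh : h ∈ Submodule.span (Coef Γ) (T L '' (young cs 0 : Set W))) :
    Ts L i * h ∈ Submodule.span (Coef Γ) (T L '' (young cs 0 : Set W)) := by
  refine mul_mem_of_mem_span hh ?_
  rintro _ ⟨y, hy, rfl⟩
  have h1 : T L (cs.simple i * y) ∈ Submodule.span (Coef Γ) (T L '' (young cs 0 : Set W)) :=
    Submodule.subset_span ⟨_, mul_mem (simple_mem_young_zero cs hi) hy, rfl⟩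
  rcases lt_or_gt_of_ne (cs.length_simple_mul_ne y i) with h2 | h2
  · rw [T_simple_mul_of_gt L h2]
    exact add_mem h1 (Submodule.smul_mem _ _ (Submodule.subset_span ⟨y, hy, rfl⟩))
  · rwa [T_simple_mul_of_lt L h2]

theorem exists_simple_mul {a : W} (ha : a ∈ young cs 0) (h : cs.length a ≠ 0) :
    ∃ i : Fin n, (i : ℕ) ≠ 0 ∧ cs.length (cs.simple i * a) + 1 = cs.length a := by
  obtain ⟨i, hi⟩ := cs.exists_leftDescent_of_ne_one (w := a) (by rintro rfl; simp at h)
  have h1 := cs.isLeftDescent_iff.1 hi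
  refine ⟨i, ne_zero_of_not_asc cs ha ?_, h1⟩
  rw [← length_gt_iff]
  omega

/-- The triangularity criterion for the family T_u, u ∈ 𝔖_n, itself: its purpose is that C_u for u ∈
𝔖_n lies in the parabolic subalgebra. -/
theorem young_triangular (L : WeightFunction cs Γ) (k : ℕ) :
    Submodule.span (Coef Γ) (C L '' ((fun u : young cs 0 => (u : W)) '' {u | cs.length (u : W) < k}))
      = Submodule.span (Coef Γ) ((fun u : young cs 0 => T L u) '' {u | cs.length (u : W) < k}) ∧
    ∀ u : young cs 0, cs.length (u : W) ≤ k → C L u - T L u ∈ Submodule.span (Coef Γ)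
      ((fun u : young cs 0 => T L u) '' {v | cs.length (v : W) < cs.length (u : W)}) := by
  refine kl_triangular L (fun u : young cs 0 => T L u) (fun u => (u : W))
    (fun u => cs.length (u : W)) (fun u => ?_) (fun u hu => ?_) (fun u hu => ?_) k
  · rw [sub_self]; exact zero_mem _
  · rw [cs.length_eq_zero_iff.1 hu, T_one, bar_one]
  · obtain ⟨i, hi, h1⟩ := exists_simple_mul u.2 hu
    refine ⟨i, ⟨cs.simple i * u, mul_mem (simple_mem_young_zero cs hi) u.2⟩, h1, ?_, ?_⟩
    · show Ts L i * T L (cs.simple i * u) = T L u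
      rw [T_simple_mul_of_lt L (by rw [cs.simple_mul_simple_cancel_left]; omega),
        cs.simple_mul_simple_cancel_left]
    · intro k h hh
      refine mul_mem_of_mem_span hh ?_
      · rintro _ ⟨v, hv, rfl⟩
        have hv' : cs.length (v : W) < k := hv
        have h2 := cs.length_simple_mul (v : W) i
        have h3 : T L (cs.simple i * v) ∈ Submodule.span (Coef Γ)
            ((fun u : young cs 0 => T L u) '' {u | cs.length (u : W) < k + 1}) :=
          Submodule.subset_span ⟨⟨cs.simple i * v, mul_mem (simple_mem_young_zero cs hi) v.2⟩,
            show cs.length (cs.simple i * v) < k + 1 by omega, rfl⟩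
        show Ts L i * T L v ∈ _
        rcases lt_or_gt_of_ne (cs.length_simple_mul_ne (v : W) i) with h4 | h4
        · rw [T_simple_mul_of_gt L h4]
          exact add_mem h3 (Submodule.smul_mem _ _ (Submodule.subset_span
            ⟨v, show cs.length (v : W) < k + 1 by omega, rfl⟩))
        · rwa [T_simple_mul_of_lt L h4]

theorem C_mem_span_T {w : W} (hw : w ∈ young cs 0) :
    C L w ∈ Submodule.span (Coef Γ) (T L '' (young cs 0 : Set W)) := by
  have h1 := (young_triangular L (cs.length w)).2 ⟨w, hw⟩ le_rfl
  have h2 : C L w = (C L w - T L w) + T L w := by abel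
  rw [h2]
  refine add_mem (Submodule.span_mono ?_ h1) (Submodule.subset_span ⟨w, hw, rfl⟩)
  rintro _ ⟨u, -, rfl⟩
  exact ⟨u, u.2, rfl⟩

theorem span_C_young (L : WeightFunction cs Γ) :
    Submodule.span (Coef Γ) (C L '' (young cs 0 : Set W)) =
      Submodule.span (Coef Γ) (T L '' (young cs 0 : Set W)) := by
  refine le_antisymm (Submodule.span_le.2 ?_) (Submodule.span_le.2 ?_)
  · rintro _ ⟨w, hw, rfl⟩
    exact C_mem_span_T hw
  · rintro _ ⟨w, hw, rfl⟩
    have h1 : T L w ∈ Submodule.span (Coef Γ)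
        ((fun u : young cs 0 => T L u) '' {u | cs.length (u : W) < cs.length w + 1}) :=
      Submodule.subset_span ⟨⟨w, hw⟩, Nat.lt_succ_self (cs.length w), rfl⟩
    rw [← (young_triangular L (cs.length w + 1)).1] at h1
    refine Submodule.span_mono ?_ h1
    rintro _ ⟨_, ⟨u, -, rfl⟩, rfl⟩
    exact ⟨u, u.2, rfl⟩

theorem mem_young_of_leftStep {l : ℕ} {x y : W} (h : LeftStep L (youngGens n l) x y)
    (hy : y ∈ young cs 0) : x ∈ young cs 0 :=
  mem_of_leftStep L h (fun _ hi => Ts_mul_mem_span_young hi.1 (C_mem_span_T hy)) (C_mem_span_T hy)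
    (span_C_young L).ge

theorem mem_young_of_relLeftLE {l : ℕ} {x y : W} (h : RelLeftLE L (youngGens n l) x y)
    (hy : y ∈ young cs 0) : x ∈ young cs 0 := by
  induction h using Relation.ReflTransGen.head_induction_on with
  | refl => exact hy
  | head h1 _ ih => exact mem_young_of_leftStep h1 ih

/-- C_w - T_w involves only T_u with u ∈ 𝔖_n and coefficients in A_{<0}, so the estimate for each
T_a c_l T_u carries over. -/
theorem IsAsymptotic.T_mul_C_sub_mem (hL : IsAsymptotic L α) {l : ℕ} (hl : l ≤ n) {a w : W}
    (ha : IsRep cs l a) (hw : w ∈ young cs 0) :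
    T L a * aHecke L l * C L w - T L (a * aElt cs l * w) ∈ negH L := by
  have h1 : (T L).repr (C L w - T L w) ∈ Finsupp.supported (Coef Γ) (Coef Γ) (young cs 0 : Set W) :=
    (T L).mem_span_image.1
      (sub_mem (C_mem_span_T hw) (Submodule.subset_span ⟨w, hw, rfl⟩))
  have h2 : T L a * aHecke L l * C L w - T L (a * aElt cs l * w) =
      (T L a * aHecke L l * T L w - T L (a * aElt cs l * w)) +
        T L a * aHecke L l * (C L w - T L w) := by
    rw [mul_sub]; abel
  rw [h2]
  refine add_mem (hL.T_mul_sub_mem hl ha hw) ?_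
  rw [← (T L).linearCombination_repr (C L w - T L w), Finsupp.linearCombination_apply, Finsupp.sum,
    Finset.mul_sum]
  refine sum_mem fun u hu => ?_
  have h3 : (T L).repr (C L w - T L w) u ∈ negPart Γ := C_sub_T_mem L w u
  have h4 : T L a * aHecke L l * T L u =
      (T L a * aHecke L l * T L u - T L (a * aElt cs l * u)) + T L (a * aElt cs l * u) := by abel
  rw [mul_smul_comm, h4, smul_add]
  exact add_mem (smul_mem_negH L h3 (hL.T_mul_sub_mem hl ha (h1 hu))) (smul_T_mem_negH L h3 _)

/-! ### The basis of the modules generated by a left cell -/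

/-- The index set of the elements `T_a C_{a_l} C_{w'}` with `w'` below `w`. -/
abbrev CellIndex (L : WeightFunction cs Γ) (l : ℕ) (w : W) : Type _ :=
  {p : W × W // IsRep cs l p.1 ∧ RelLeftLE L (youngGens n l) p.2 w}

/-- The element `T_a C_{a_l} C_{w'}`. -/
noncomputable def cellElt (L : WeightFunction cs Γ) (l : ℕ) (w : W) (p : CellIndex L l w) :
    Hecke L :=
  T L p.1.1 * aHecke L l * C L p.1.2

/-- The element `a a_l w'`. -/
def cellPos (L : WeightFunction cs Γ) (l : ℕ) (w : W) (p : CellIndex L l w) : W :=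
  p.1.1 * aElt cs l * p.1.2

/-- The part of the module generated by a left cell that is given by the `a` of length less
than `k`. -/
noncomputable def cellFilt (L : WeightFunction cs Γ) (l : ℕ) (w : W) (k : ℕ) :
    Submodule (Coef Γ) (Hecke L) :=
  Submodule.span (Coef Γ) (cellElt L l w '' {p | cs.length p.1.1 < k})

theorem cellElt_mem_cellFilt {l : ℕ} {a w w' : W} {k : ℕ} (ha : IsRep cs l a)
    (hw : RelLeftLE L (youngGens n l) w' w) (hk : cs.length a < k) :
    T L a * aHecke L l * C L w' ∈ cellFilt L l w k :=
  Submodule.subset_span ⟨⟨(a, w'), ha, hw⟩, hk, rfl⟩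

/-- By Deodhar's lemma T_{s_i} either changes a to another representative or passes through T_a as
some T_{s_j} with s_j ∈ Σ_{l,n-l}. -/
theorem IsAsymptotic.Ts_mul_cellElt_mem (hL : IsAsymptotic L α) {l : ℕ} (hl : l ≤ n) {i : Fin n}
    (hi : (i : ℕ) ≠ 0) {a w w' : W} {k : ℕ} (ha : IsRep cs l a)
    (hw : RelLeftLE L (youngGens n l) w' w) (hk : cs.length a < k) :
    Ts L i * (T L a * aHecke L l * C L w') ∈ cellFilt L l w (k + 1) := by
  have h0 := cs.length_simple_mul a i
  rw [← mul_assoc, ← mul_assoc]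
  rcases lt_or_gt_of_ne (cs.length_simple_mul_ne a i) with h1 | h1
  · rw [T_simple_mul_of_gt L h1, add_mul, add_mul, smul_mul_assoc, smul_mul_assoc]
    exact add_mem (cellElt_mem_cellFilt (ha.simple_mul h1) hw (by omega))
      (Submodule.smul_mem _ _ (cellElt_mem_cellFilt ha hw (by omega)))
  rw [T_simple_mul_of_lt L h1]
  rcases ha.simple_mul_or hi h1 with h2 | ⟨j, hj, h2⟩
  · exact cellElt_mem_cellFilt h2 hw (by omega)
  -- The generator crosses c_l, becomes another element of Σ_{l,n-l}, and acts on C_{w'} inside the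
  -- set of elements below w. This is where the relative pre-order enters.
  obtain ⟨j', hj', h3⟩ := hL.exists_Ts_mul_aHecke hl hj
  rw [h2, ← T_mul_simple_of_lt L (ha.lt j hj), mul_assoc (T L a), h3, ← mul_assoc, mul_assoc]
  have h4 := Ts_mul_mem_span L (I := youngGens n l)
    (P := {u | RelLeftLE L (youngGens n l) u w}) (fun x y hxy hy => Relation.ReflTransGen.head hxy hy)
    hj' (Submodule.subset_span ⟨w', hw, rfl⟩)
  refine mul_mem_of_mem_span h4 ?_
  · rintro _ ⟨u, hu, rfl⟩
    exact cellElt_mem_cellFilt ha hu (by omega)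

theorem IsAsymptotic.Ts_mul_mem_cellFilt (hL : IsAsymptotic L α) {l : ℕ} (hl : l ≤ n) {i : Fin n}
    (hi : (i : ℕ) ≠ 0) {w : W} {k : ℕ} {h : Hecke L} (hh : h ∈ cellFilt L l w k) :
    Ts L i * h ∈ cellFilt L l w (k + 1) := by
  refine mul_mem_of_mem_span hh ?_
  · rintro _ ⟨⟨⟨a, w'⟩, ha, hw⟩, hp, rfl⟩
    exact hL.Ts_mul_cellElt_mem hl hi ha hw hp

/-- The triangularity criterion ranked by ℓ(a): for a = 1 the product c_l C_{w'} is bar fixed, and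
for a ≠ 1 a left descent of a gives the required predecessor. -/
theorem IsAsymptotic.cell_triangular (hL : IsAsymptotic L α) {l : ℕ} (hl : l ≤ n) {w : W}
    (hw : w ∈ young cs 0) (k : ℕ) :
    Submodule.span (Coef Γ) (C L '' (cellPos L l w '' {p | cs.length p.1.1 < k})) =
        cellFilt L l w k ∧
      ∀ p : CellIndex L l w, cs.length p.1.1 ≤ k →
        C L (cellPos L l w p) - cellElt L l w p ∈ cellFilt L l w (cs.length p.1.1) := by
  refine kl_triangular L (cellElt L l w) (cellPos L l w) (fun p => cs.length p.1.1)
    (fun p => ?_) (fun p hp => ?_) (fun p hp => ?_) k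
  · exact hL.T_mul_C_sub_mem hl p.2.1 (mem_young_of_relLeftLE p.2.2 hw)
  · rw [cellElt, cs.length_eq_zero_iff.1 hp, T_one, one_mul, bar_mul, bar_C, (hL.relations hl).2.2]
  · obtain ⟨⟨a, w'⟩, ha, hw'⟩ := p
    replace ha : IsRep cs l a := ha
    obtain ⟨i, hi, h1⟩ : ∃ i : Fin n, (i : ℕ) ≠ 0 ∧
        cs.length (cs.simple i * a) + 1 = cs.length a := exists_simple_mul ha.mem hp
    refine ⟨i, ⟨(cs.simple i * a, w'), ha.simple_mul (by omega), hw'⟩, h1, ?_,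
      fun k h hh => hL.Ts_mul_mem_cellFilt hl hi hh⟩
    show Ts L i * (T L (cs.simple i * a) * aHecke L l * C L w') = T L a * aHecke L l * C L w'
    rw [← mul_assoc, ← mul_assoc, T_simple_mul_of_lt L (by
      rw [cs.simple_mul_simple_cancel_left]; omega), cs.simple_mul_simple_cancel_left]

theorem IsAsymptotic.C_sub_mem_cellFilt (hL : IsAsymptotic L α) {l : ℕ} (hl : l ≤ n) {a w : W}
    (ha : IsRep cs l a) (hw : w ∈ young cs 0) :
    C L (a * aElt cs l * w) - T L a * aHecke L l * C L w ∈ cellFilt L l w (cs.length a) :=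
  (hL.cell_triangular hl hw (cs.length a)).2 ⟨(a, w), ha, Relation.ReflTransGen.refl⟩ le_rfl

theorem IsAsymptotic.C_aElt_mul (hL : IsAsymptotic L α) {l : ℕ} (hl : l ≤ n) {w : W}
    (hw : w ∈ young cs 0) : C L (aElt cs l * w) = aHecke L l * C L w := by
  have h1 := hL.T_mul_C_sub_mem hl (isRep_one cs l) hw
  rw [T_one, one_mul, one_mul] at h1
  refine C_eq_of L ?_ h1
  rw [bar_mul, bar_C, (hL.relations hl).2.2]

/-- The elements `a a_l w'` with `w'` below `w`. -/
def cellSet (L : WeightFunction cs Γ) (l : ℕ) (w : W) : Set W :=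
  {z | ∃ a w', IsRep cs l a ∧ RelLeftLE L (youngGens n l) w' w ∧ z = a * aElt cs l * w'}

theorem IsAsymptotic.cellFilt_le (hL : IsAsymptotic L α) {l : ℕ} (hl : l ≤ n) {w : W}
    (hw : w ∈ young cs 0) (k : ℕ) :
    cellFilt L l w k ≤ Submodule.span (Coef Γ) (C L '' cellSet L l w) := by
  rw [← (hL.cell_triangular hl hw k).1]
  refine Submodule.span_mono (Set.image_mono ?_)
  rintro _ ⟨⟨⟨a, w'⟩, ha, hw'⟩, -, rfl⟩
  exact ⟨a, w', ha, hw', rfl⟩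

theorem IsAsymptotic.exists_mem_cellFilt (hL : IsAsymptotic L α) {l : ℕ} (hl : l ≤ n) {w z : W}
    (hw : w ∈ young cs 0) (hz : z ∈ cellSet L l w) : ∃ k, C L z ∈ cellFilt L l w k := by
  obtain ⟨a, w', ha, hw', rfl⟩ := hz
  refine ⟨cs.length a + 1, ?_⟩
  rw [← (hL.cell_triangular hl hw _).1]
  exact Submodule.subset_span ⟨_, ⟨⟨(a, w'), ha, hw'⟩, Nat.lt_succ_self _, rfl⟩, rfl⟩

theorem IsAsymptotic.Ts_mul_mem_span_cellSet (hL : IsAsymptotic L α) {l : ℕ} (hl : l ≤ n)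
    {i : Fin n} (hi : (i : ℕ) ≠ 0) {w : W} (hw : w ∈ young cs 0) {h : Hecke L}
    (hh : h ∈ Submodule.span (Coef Γ) (C L '' cellSet L l w)) :
    Ts L i * h ∈ Submodule.span (Coef Γ) (C L '' cellSet L l w) := by
  refine mul_mem_of_mem_span hh ?_
  · rintro _ ⟨z, hz, rfl⟩
    obtain ⟨k, hk⟩ := hL.exists_mem_cellFilt hl hw hz
    exact hL.cellFilt_le hl hw _ (hL.Ts_mul_mem_cellFilt hl hi hk)

/-! ### The filtration by t-length. -/

/-- The span of the `C_z` with at least `m` occurrences of `t` in `z`. -/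
noncomputable def tIdeal (L : WeightFunction cs Γ) (m : ℕ) : Submodule (Coef Γ) (Hecke L) :=
  Submodule.span (Coef Γ) (C L '' {z | m ≤ tLength cs z})

theorem tLength_of_mem_cellSet {l : ℕ} (hl : l ≤ n) {w z : W} (hw : w ∈ young cs 0)
    (hz : z ∈ cellSet L l w) : tLength cs z = l := by
  obtain ⟨a, w', ha, hw', rfl⟩ := hz
  exact tLength_mul_aElt_mul cs hl ha.mem (mem_young_of_relLeftLE hw' hw)

theorem span_cellSet_le_tIdeal {l m : ℕ} (hl : l ≤ n) (hm : m ≤ l) {w : W} (hw : w ∈ young cs 0) :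
    Submodule.span (Coef Γ) (C L '' cellSet L l w) ≤ tIdeal L m :=
  Submodule.span_mono (Set.image_mono fun _ hz => hm.trans (tLength_of_mem_cellSet hl hw hz).ge)

theorem tIdeal_anti {m m' : ℕ} (h : m ≤ m') : tIdeal L m' ≤ tIdeal L m :=
  Submodule.span_mono (Set.image_mono fun _ hz => le_trans h hz)

theorem exists_mem_cellSet (L : WeightFunction cs Γ) (z : W) :
    ∃ w ∈ young cs 0, z ∈ cellSet L (tLength cs z) w := by
  obtain ⟨a, ha, hw, h⟩ := exists_isRep_eq cs z
  exact ⟨_, hw, a, _, ha, Relation.ReflTransGen.refl, h⟩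

/-- Each z lies in some `cellSet` of its own t-length, whose span is stable under T_s for s ≠ t. -/
theorem IsAsymptotic.Ts_mul_mem_tIdeal_of_ne (hL : IsAsymptotic L α) {i : Fin n}
    (hi : (i : ℕ) ≠ 0) {m : ℕ} {h : Hecke L} (hh : h ∈ tIdeal L m) : Ts L i * h ∈ tIdeal L m := by
  refine mul_mem_of_mem_span hh ?_
  · rintro _ ⟨z, hz, rfl⟩
    obtain ⟨w, hw, h1⟩ := exists_mem_cellSet L z
    exact span_cellSet_le_tIdeal (tLength_le cs z) hz hw
      (hL.Ts_mul_mem_span_cellSet (tLength_le cs z) hi hw (Submodule.subset_span ⟨z, h1, rfl⟩))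

end Cells

/-! ### The action of T_t and the upper bound for the left pre-order. -/

section Action

variable {n : ℕ} {W : Type*} [Group W] {cs : CoxeterSystem (typeB n) W}
variable {Γ : Type*} [AddCommGroup Γ] [LinearOrder Γ] [IsOrderedAddMonoid Γ]
variable {L : WeightFunction cs Γ} {α : Γ}

/-- The window of u increases from position 2 on, so it is determined by its first value k + 1. Its
use: s_2, …, s_{n-1} commute with t, so the action of T_t on T_u only has to be computed for these
u. -/
theorem exists_eq_ascProd (hn : 0 < n) {u : W} (hu : u ∈ young cs 0)
    (h : ∀ i : Fin n, 2 ≤ (i : ℕ) → Asc cs i u) : ∃ k < n, u = ascProd cs k := by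
  have hinc : ∀ x : ℕ, 2 ≤ x → x < n → win cs u x < win cs u (x + 1) := fun x hx hxn =>
    (asc_iff cs (by omega) u).1 (h ⟨x, hxn⟩ hx)
  have hlow : ∀ x : ℕ, x + 2 ≤ n → (x : ℤ) + 1 ≤ win cs u (x + 2) := by
    intro x
    induction x with
    | zero =>
      intro _
      have := win_pos cs hu (x := 2) (by omega)
      push_cast
      omega
    | succ x ih =>
      intro hx
      have h1 := ih (by omega)
      have h2 := hinc (x + 2) (by omega) (by omega)
      push_cast at h2 ⊢
      rw [show (x : ℤ) + 1 + 2 = x + 2 + 1 by ring]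
      omega
  have hup : ∀ m x : ℕ, 2 ≤ x → x + m = n → win cs u x ≤ x := by
    intro m
    induction m with
    | zero =>
      intro x _ hx
      have := win_le cs u (x := x) (by omega)
      omega
    | succ m ih =>
      intro x h2 hx
      have h3 := ih (x + 1) (by omega) (by omega)
      have h4 := hinc x h2 (by omega)
      push_cast at h3
      omega
  have h1 := win_pos cs hu (x := 1) one_pos
  have h2 := win_le cs u (x := 1) (by omega)
  obtain ⟨k, hk⟩ : ∃ k : ℕ, win cs u 1 = k + 1 := ⟨(win cs u 1 - 1).toNat, by omega⟩
  have hkn : k < n := by omega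
  refine ⟨k, hkn, ?_⟩
  rw [eq_comm, ← inv_mul_eq_one]
  refine eq_one_of_asc cs fun i => ?_
  by_cases hi : (i : ℕ) = 0
  · rw [hi]
    exact (asc_zero_iff cs _).2 (win_pos cs (mul_mem (inv_mem (ascProd_mem cs hkn)) hu) one_pos)
  have hin := i.2
  rw [asc_iff cs hi, win_mul, win_mul, win_ascProd_inv cs hkn (by omega),
    win_ascProd_inv cs hkn (by omega)]
  have hne : ∀ x : ℤ, x ≠ 1 → win cs u x ≠ k + 1 := fun x hx h3 =>
    hx (win_injective cs u (h3.trans hk.symm))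
  rcases lt_trichotomy (i : ℕ) k with h3 | h3 | h3
  · rw [if_pos (by omega), if_pos (by omega)]
    have := hinc (i + 1) (by omega) (by omega)
    push_cast at this
    exact this
  · rw [if_pos (by omega), if_neg (by omega), if_pos (by omega), hk]
    have h4 := hup (n - (i + 1)) (i + 1) (by omega) (by omega)
    have h5 := hne (i + 1) (by omega)
    push_cast at h4
    omega
  · rcases Nat.lt_or_ge (k + 1) i with h4 | h4
    · rw [if_neg (by omega), if_neg (by omega), if_neg (by omega), if_neg (by omega)]
      exact hinc i (by omega) (by omega)
    · rw [if_neg (by omega), if_pos (by omega), if_neg (by omega), if_neg (by omega), hk]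
      have h5 := hlow (i - 1) (by omega)
      have h6 := hne (i + 1) (by omega)
      rw [show (((i : ℕ) - 1 : ℕ) : ℤ) + 2 = i + 1 by omega] at h5
      omega

theorem IsRep.eq_zero_or_eq {l k : ℕ} (hk : k < n) (h : IsRep cs l (ascProd cs k)) :
    k = 0 ∨ k = l := by
  by_contra hc
  have h1 := h.lt ⟨k, hk⟩ ⟨show k ≠ 0 by omega, show k ≠ l by omega⟩
  rw [length_mul_lt_iff, asc_iff cs (show k ≠ 0 by omega), win_ascProd_inv cs hk (by omega),
    win_ascProd_inv cs hk (by omega), if_pos le_rfl, if_neg (by omega), if_pos rfl] at h1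
  omega

theorem tauInvProd_mul_mem_of_stable {N : Submodule (Coef Γ) (Hecke L)}
    (hN : ∀ i : Fin n, (i : ℕ) ≠ 0 → ∀ h ∈ N, Ts L i * h ∈ N) {k : ℕ} (hk : k < n) {h : Hecke L}
    (hh : h ∈ N) : tauInvProd L k * h ∈ N := by
  induction k generalizing h with
  | zero => rwa [tauInvProd, one_mul]
  | succ k ih =>
    rw [tauInvProd, mul_assoc, tauInv_of_lt L hk]
    refine ih (by omega) ?_
    rw [Tinv, sub_mul, smul_mul_assoc, one_mul]
    exact sub_mem (hN ⟨k + 1, hk⟩ (Nat.succ_ne_zero k) _ hh) (Submodule.smul_mem _ _ hh)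

theorem tau_zero_mul_Ts_mul {i : Fin n} (hi : 2 ≤ (i : ℕ)) (h : Hecke L) :
    tau L 0 * (Ts L i * h) = Ts L i * (tau L 0 * h) := by
  have h1 := tau_comm L (i := 0) (j := i) (by omega) i.2
  rw [tau_of_lt L i.2] at h1
  rw [← mul_assoc, h1.eq, mul_assoc]

theorem tau_zero_mul_tauProd_mul (l : ℕ) (h : Hecke L) :
    tau L 0 * (tauProd L l * (aHecke L l * h)) =
      aHecke L (l + 1) * h - expo (-L (gen cs 0)) • (tauInvProd L l * (aHecke L l * h)) := by
  rw [aHecke, add_mul, smul_mul_assoc, add_mul, smul_mul_assoc]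
  simp only [mul_assoc]
  rw [add_sub_cancel_right]

theorem IsAsymptotic.aHecke_mul_mem (hL : IsAsymptotic L α) {l : ℕ} (hl : l ≤ n) {h : Hecke L}
    (hh : h ∈ Submodule.span (Coef Γ) (C L '' (young cs 0 : Set W))) :
    aHecke L l * h ∈ tIdeal L l := by
  refine mul_mem_of_mem_span hh ?_
  rintro _ ⟨u, hu, rfl⟩
  rw [← hL.C_aElt_mul hl hu]
  refine Submodule.subset_span ⟨_, ?_, rfl⟩
  have := tLength_mul_aElt_mul cs hl (one_mem (young cs 0)) hu
  rw [one_mul] at this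
  exact this.ge

/-- Left descents s_i of a with i ≥ 2 are commuted past T_t; what remains is a = s_1 ⋯ s_k, and
being a representative forces k = 0 or k = l. -/
theorem IsAsymptotic.tau_zero_mul_mem (hL : IsAsymptotic L α) (hn : 0 < n) {l : ℕ} (hl : l ≤ n)
    {a w w' : W} (hw : w ∈ young cs 0) (ha : IsRep cs l a)
    (hw' : RelLeftLE L (youngGens n l) w' w) :
    tau L 0 * (T L a * (aHecke L l * C L w')) ∈
      Submodule.span (Coef Γ) (C L '' cellSet L l w) ⊔ tIdeal L (l + 1) := by
  induction hm : cs.length a using Nat.strong_induction_on generalizing a with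
  | _ m ih =>
    subst hm
    by_cases h : ∀ i : Fin n, 2 ≤ (i : ℕ) → Asc cs i a
    · have hE : aHecke L l * C L w' ∈ Submodule.span (Coef Γ) (C L '' cellSet L l w) := by
        rw [← hL.C_aElt_mul hl (mem_young_of_relLeftLE hw' hw)]
        exact Submodule.subset_span ⟨_, ⟨1, w', isRep_one cs l, hw', by rw [one_mul]⟩, rfl⟩
      obtain ⟨k, hk, rfl⟩ := exists_eq_ascProd hn ha.mem h
      -- For k = l the recursion of c_{l+1} gives a term with l + 1 occurrences of t plus a term in
      -- the cell module; this includes l = 0. For k = 0 ≠ l, T_t acts on c_l as a scalar.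
      by_cases hkl : k = l
      · subst hkl
        rw [← T_ascProd hk, tau_zero_mul_tauProd_mul]
        refine sub_mem (Submodule.mem_sup_right (hL.aHecke_mul_mem hk ?_))
          (Submodule.mem_sup_left (Submodule.smul_mem _ _ (tauInvProd_mul_mem_of_stable
            (fun i hi h hh => hL.Ts_mul_mem_span_cellSet hl hi hw hh) hk hE)))
        exact Submodule.subset_span ⟨w', mem_young_of_relLeftLE hw' hw, rfl⟩
      · obtain rfl : k = 0 := by have := ha.eq_zero_or_eq hk; omega
        rw [ascProd, T_one, one_mul, ← mul_assoc, (hL.relations hl).2.1 (by omega), smul_mul_assoc]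
        exact Submodule.mem_sup_left (Submodule.smul_mem _ _ hE)
    · push Not at h
      obtain ⟨i, hi, h1⟩ := h
      rw [← length_gt_iff] at h1
      have h2 := ih _ h1 (ha.simple_mul h1) rfl
      have h3 : T L a = Ts L i * T L (cs.simple i * a) := by
        rw [T_simple_mul_of_lt L (by rwa [cs.simple_mul_simple_cancel_left]),
          cs.simple_mul_simple_cancel_left]
      rw [h3, mul_assoc, tau_zero_mul_Ts_mul hi]
      obtain ⟨p, hp, r, hr, h4⟩ := Submodule.mem_sup.1 h2
      rw [← h4, mul_add]
      exact add_mem (Submodule.mem_sup_left (hL.Ts_mul_mem_span_cellSet hl (by omega) hw hp))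
        (Submodule.mem_sup_right (hL.Ts_mul_mem_tIdeal_of_ne (by omega) hr))

theorem IsAsymptotic.Ts_mul_C_mem (hL : IsAsymptotic L α) {l : ℕ} (hl : l ≤ n) {w z : W}
    (hw : w ∈ young cs 0) (hz : z ∈ cellSet L l w) (i : Fin n) :
    Ts L i * C L z ∈ Submodule.span (Coef Γ) (C L '' cellSet L l w) ⊔ tIdeal L (l + 1) := by
  by_cases hi : (i : ℕ) = 0
  · obtain ⟨k, hk⟩ := hL.exists_mem_cellFilt hl hw hz
    refine mul_mem_of_mem_span hk ?_
    rintro _ ⟨⟨⟨a, w'⟩, ha, hw'⟩, -, rfl⟩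
    have h1 := hL.tau_zero_mul_mem i.pos hl hw ha hw'
    rw [tau_of_lt L i.pos, show (⟨0, i.pos⟩ : Fin n) = i from Fin.ext hi.symm, ← mul_assoc (T L a)]
      at h1
    exact h1
  · exact Submodule.mem_sup_left (hL.Ts_mul_mem_span_cellSet hl hi hw
      (Submodule.subset_span ⟨z, hz, rfl⟩))

theorem IsAsymptotic.Ts_mul_mem_tIdeal (hL : IsAsymptotic L α) (i : Fin n) {m : ℕ} {h : Hecke L}
    (hh : h ∈ tIdeal L m) : Ts L i * h ∈ tIdeal L m := by
  refine mul_mem_of_mem_span hh ?_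
  rintro _ ⟨z, hz, rfl⟩
  obtain ⟨w, hw, h1⟩ := exists_mem_cellSet L z
  have hz' : m ≤ tLength cs z := hz
  have h2 := hL.Ts_mul_C_mem (tLength_le cs z) hw h1 i
  exact sup_le (span_cellSet_le_tIdeal (tLength_le cs z) hz' hw) (tIdeal_anti (by omega)) h2

/-- The cell module together with all larger t-lengths is stable under every T_s, so no chain of
steps downwards leaves it. This carries the implication from left to right. -/
theorem IsAsymptotic.mem_of_leftLE (hL : IsAsymptotic L α) {l : ℕ} (hl : l ≤ n) {w x y : W}
    (hw : w ∈ young cs 0) (h : LeftLE L x y) (hy : y ∈ cellSet L l w) :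
    x ∈ cellSet L l w ∪ {z | l + 1 ≤ tLength cs z} := by
  induction h using Relation.ReflTransGen.head_induction_on with
  | refl => exact Or.inl hy
  | head h1 _ ih =>
    refine mem_of_leftStep L (P := Submodule.span (Coef Γ) (C L '' cellSet L l w) ⊔ tIdeal L (l + 1))
      h1 (fun i _ => ?_) ?_ (by rw [tIdeal, Set.image_union, Submodule.span_union])
    · rcases ih with h2 | h2
      · exact hL.Ts_mul_C_mem hl hw h2 i
      · exact Submodule.mem_sup_right
          (hL.Ts_mul_mem_tIdeal i (Submodule.subset_span ⟨_, h2, rfl⟩))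
    · rcases ih with h2 | h2
      · exact Submodule.mem_sup_left (Submodule.subset_span ⟨_, h2, rfl⟩)
      · exact Submodule.mem_sup_right (Submodule.subset_span ⟨_, h2, rfl⟩)

/-! ### The specialised module and the sign-change operators. -/

/-- The left ideal generated by the kernel of the augmentation and the `C_z` with more than `l`
occurrences of `t` in `z`. Modulo this ideal the `T_a C_{a_l} C_w` span a representation of `W`. -/
noncomputable def augIdealSup (L : WeightFunction cs Γ) (l : ℕ) : Submodule (Coef Γ) (Hecke L) :=
  augH L ⊔ tIdeal L (l + 1)

theorem IsAsymptotic.mul_mem_augIdealSup (hL : IsAsymptotic L α) {l : ℕ} (k : Hecke L)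
    {h : Hecke L} (hh : h ∈ augIdealSup L l) : k * h ∈ augIdealSup L l := by
  induction k using hecke_induction with
  | h0 => rw [zero_mul]; exact zero_mem _
  | one => rwa [one_mul]
  | add x y hx hy => rw [add_mul]; exact add_mem hx hy
  | smul c x hx => rw [smul_mul_assoc]; exact Submodule.smul_mem _ _ hx
  | mul i x hx =>
    obtain ⟨p, hp, r, hr, h1⟩ := Submodule.mem_sup.1 hx
    rw [mul_assoc, ← h1, mul_add]
    exact add_mem (Submodule.mem_sup_left (mul_mem_augH L _ hp))
      (Submodule.mem_sup_right (hL.Ts_mul_mem_tIdeal i hr))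

theorem tauProd_sub_tauInvProd_mem (L : WeightFunction cs Γ) {k : ℕ} (hk : k < n) :
    tauProd L k - tauInvProd L k ∈ augH L := by
  induction k with
  | zero => rw [tauProd, tauInvProd, sub_self]; exact zero_mem _
  | succ k ih =>
    have h1 : tauProd L (k + 1) - tauInvProd L (k + 1) =
        (tauProd L k - tauInvProd L k) * tau L (k + 1) +
          tauInvProd L k * (tau L (k + 1) - tauInv L (k + 1)) := by
      rw [tauProd, tauInvProd, sub_mul, mul_sub]; abel
    rw [h1]
    refine add_mem (mem_augH_mul L (ih (by omega)) _) (mul_mem_augH L _ ?_)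
    rw [tau_of_lt L hk, tauInv_of_lt L hk, Tinv, sub_sub_cancel]
    exact xi_smul_mem_augH L _ _

theorem exists_tauProd_mul_aHecke {l : ℕ}
    (hs : ∀ i, 1 ≤ i → i < l → tau L i * aHecke L l = aHecke L l * tau L (l - i)) {k : ℕ}
    (hk : k < l) : ∃ y, tauProd L k * aHecke L l = aHecke L l * y := by
  induction k with
  | zero => exact ⟨1, by rw [tauProd, one_mul, mul_one]⟩
  | succ k ih =>
    obtain ⟨y, hy⟩ := ih (by omega)
    exact ⟨y * tau L (l - (k + 1)), by
      rw [tauProd, mul_assoc, hs (k + 1) (by omega) hk, ← mul_assoc, hy, mul_assoc]⟩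

/-- The generators s_{l+1}, …, s_{l+m} commute with c_l, so only s_1 ⋯ s_l stays in front of it; y
collects the others and acts within the parabolic subalgebra. -/
theorem exists_tauProd_add_mul_aHecke {l m : ℕ} (hm : l + m < n) :
    ∃ y : Hecke L, (∀ h ∈ Submodule.span (Coef Γ) (T L '' (young cs 0 : Set W)),
        y * h ∈ Submodule.span (Coef Γ) (T L '' (young cs 0 : Set W))) ∧
      tauProd L (l + m) * aHecke L l = tauProd L l * (aHecke L l * y) := by
  induction m with
  | zero => exact ⟨1, fun h hh => by rwa [one_mul], by rw [mul_one, add_zero]⟩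
  | succ m ih =>
    obtain ⟨y, hy, h1⟩ := ih (by omega)
    have hm' : l + m + 1 < n := hm
    refine ⟨y * tau L (l + m + 1), fun h hh => ?_, ?_⟩
    · rw [mul_assoc, tau_of_lt L hm']
      exact hy _ (Ts_mul_mem_span_young (Nat.succ_ne_zero _) hh)
    · rw [← add_assoc, tauProd, mul_assoc, (commute_aHecke L (l := l) (by omega) hm').eq, ← mul_assoc,
        h1, mul_assoc, mul_assoc]

/-- Again T_u reduces to s_1 ⋯ s_k. If k < l, the word passes through c_l and T_t contributes e^b ↦
1. If k ≥ l, the recursion for c_{l+1} replaces T_t by -e^{-b} ↦ -1 up to larger t-length, and the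
T_{s_i} agree with their inverses after specialisation. -/
theorem IsAsymptotic.tau_zero_mul_sub_mem (hL : IsAsymptotic L α) (hn : 0 < n) {l : ℕ} (hl : l ≤ n)
    {u w : W} (hu : u ∈ young cs 0) (hw : w ∈ young cs 0) :
    tau L 0 * (T L u * (aHecke L l * C L w)) -
      (if win cs u 1 ≤ l then 1 else -1 : ℤ) • (T L u * (aHecke L l * C L w)) ∈
        augIdealSup L l := by
  induction hm : cs.length u using Nat.strong_induction_on generalizing u with
  | _ m ih =>
    subst hm
    by_cases h : ∀ i : Fin n, 2 ≤ (i : ℕ) → Asc cs i u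
    · obtain ⟨k, hk, rfl⟩ := exists_eq_ascProd hn hu h
      rw [win_ascProd cs hk one_pos, if_pos rfl, ← T_ascProd hk, ← mul_assoc (tauProd L k)]
      obtain ⟨hs, hq, -⟩ := hL.relations hl
      rcases Nat.lt_or_ge k l with h1 | h1
      · obtain ⟨y, hy⟩ := exists_tauProd_mul_aHecke hs h1
        rw [if_pos (by omega), hy, ← mul_assoc, ← mul_assoc, hq (by omega), smul_mul_assoc,
          smul_mul_assoc, one_smul]
        refine Submodule.mem_sup_left ?_
        have := smul_mem_augH L (c := expo (L (gen cs 0)) - 1)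
          (by rw [map_sub, augmentation_expo, map_one, sub_self]) (aHecke L l * y * C L w)
        rwa [sub_smul, one_smul] at this
      · obtain ⟨m, rfl⟩ := Nat.exists_eq_add_of_le h1
        obtain ⟨y, hy, h2⟩ := exists_tauProd_add_mul_aHecke (L := L) hk
        have h3 := hy _ (C_mem_span_T hw)
        rw [← span_C_young] at h3
        rw [if_neg (by omega), h2, mul_assoc, mul_assoc, tau_zero_mul_tauProd_mul, neg_smul,
          one_smul, sub_neg_eq_add]
        set X := aHecke L l * (y * C L w)
        have e : aHecke L (l + 1) * (y * C L w) - expo (-L (gen cs 0)) • (tauInvProd L l * X) +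
            tauProd L l * X = ((tauProd L l - tauInvProd L l) * X +
              (1 - expo (-L (gen cs 0))) • (tauInvProd L l * X)) +
                aHecke L (l + 1) * (y * C L w) := by
          rw [sub_mul, sub_smul, one_smul]; abel
        rw [e]
        refine add_mem (Submodule.mem_sup_left (add_mem
          (mem_augH_mul L (tauProd_sub_tauInvProd_mem L (by omega)) _) (smul_mem_augH L ?_ _)))
          (Submodule.mem_sup_right (hL.aHecke_mul_mem (by omega) h3))
        rw [map_sub, augmentation_expo, map_one, sub_self]
    · push Not at h
      obtain ⟨i, hi, h1⟩ := h
      rw [← length_gt_iff] at h1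
      have h2 := ih _ h1 (mul_mem (simple_mem_young_zero cs (by omega)) hu) rfl
      rw [win_simple_mul, sgen_eq (y := 1) (by omega)] at h2
      have h3 : T L u = Ts L i * T L (cs.simple i * u) := by
        rw [T_simple_mul_of_lt L (by rwa [cs.simple_mul_simple_cancel_left]),
          cs.simple_mul_simple_cancel_left]
      rw [h3, mul_assoc, tau_zero_mul_Ts_mul hi, ← mul_smul_comm, ← mul_sub]
      exact hL.mul_mem_augIdealSup _ h2

/-- A multiple of `T_r`, for the reflection `r` that changes the sign of `k + 1`. -/
noncomputable def signRefl (L : WeightFunction cs Γ) (k : ℕ) : Hecke L :=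
  T L (ascProd cs k)⁻¹ * (tau L 0 * T L (ascProd cs k))

/-- Conjugation by s_1 ⋯ s_k moves position k + 1 to position 1, where the sign is already known. -/
theorem IsAsymptotic.signRefl_mul_sub_mem (hL : IsAsymptotic L α) {l k : ℕ} (hl : l ≤ n)
    (hk : k < n) {d w : W} (hd : d ∈ young cs 0) (hw : w ∈ young cs 0) :
    signRefl L k * (T L d * (aHecke L l * C L w)) -
      (if win cs d (k + 1) ≤ l then 1 else -1 : ℤ) • (T L d * (aHecke L l * C L w)) ∈
        augIdealSup L l := by
  set X := aHecke L l * C L w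
  set c := ascProd cs k
  have h1 := hL.tau_zero_mul_sub_mem (by omega) hl (mul_mem (ascProd_mem cs hk) hd) hw
  rw [win_mul, win_ascProd cs hk one_pos, if_pos rfl] at h1
  set ε : ℤ := if win cs d (k + 1) ≤ l then 1 else -1
  have h2 := mem_augH_mul L (T_mul_T_sub_mem L c d) X
  have h3 := mem_augH_mul L (T_mul_T_sub_mem L c⁻¹ (c * d)) X
  rw [inv_mul_cancel_left] at h3
  have e : signRefl L k * (T L d * X) - ε • (T L d * X) =
      (T L c⁻¹ * (tau L 0 * ((T L c * T L d - T L (c * d)) * X)) +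
        ε • ((T L c⁻¹ * T L (c * d) - T L d) * X)) +
        T L c⁻¹ * (tau L 0 * (T L (c * d) * X) - ε • (T L (c * d) * X)) := by
    rw [signRefl]
    simp only [sub_mul, mul_sub, smul_sub, mul_assoc, mul_smul_comm]
    abel
  rw [e]
  exact add_mem (Submodule.mem_sup_left (add_mem (mul_mem_augH L _ (mul_mem_augH L _ h2))
    (zsmul_mem h3 _))) (hL.mul_mem_augIdealSup _ h1)

/-- A multiple of a projector that isolates the elements with a given set of sign changes. -/
noncomputable def signProj (L : WeightFunction cs Γ) : ℕ → Hecke L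
  | 0 => 1
  | k + 1 => (1 + signRefl L k) * signProj L k

theorem IsAsymptotic.signProj_mul_sub_mem (hL : IsAsymptotic L α) {l k : ℕ} (hl : l ≤ n)
    (hk : k ≤ n) {d w : W} (hd : d ∈ young cs 0) (hw : w ∈ young cs 0) :
    signProj L k * (T L d * (aHecke L l * C L w)) -
      (∏ j ∈ Finset.range k, (1 + if win cs d (j + 1) ≤ l then 1 else -1 : ℤ)) •
        (T L d * (aHecke L l * C L w)) ∈ augIdealSup L l := by
  induction k with
  | zero =>
    rw [signProj, one_mul, Finset.prod_range_zero, one_smul, sub_self]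
    exact zero_mem _
  | succ k ih =>
    have h1 := hL.signRefl_mul_sub_mem hl hk hd hw
    rw [Finset.prod_range_succ, signProj]
    set X := T L d * (aHecke L l * C L w)
    set ε : ℤ := if win cs d (k + 1) ≤ l then 1 else -1
    set c : ℤ := ∏ j ∈ Finset.range k, (1 + if win cs d (j + 1) ≤ l then 1 else -1 : ℤ)
    have e : (1 + signRefl L k) * signProj L k * X - (c * (1 + ε)) • X =
        (1 + signRefl L k) * (signProj L k * X - c • X) + c • (signRefl L k * X - ε • X) := by
      simp only [mul_sub, add_mul, one_mul, mul_smul_comm, smul_sub, mul_assoc, mul_add, mul_one,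
        add_smul, mul_smul, smul_add]
      abel
    rw [e]
    exact add_mem (hL.mul_mem_augIdealSup _ (ih (by omega))) (zsmul_mem h1 _)

/-- After specialisation T_{a⁻¹} T_{a'} is T_{a⁻¹a'}. For distinct representatives a⁻¹a' does not
preserve [1, l], so some j ≤ l has eigenvalue -1 and its factor 1 + r_j vanishes. -/
theorem IsAsymptotic.signProj_mul_mem (hL : IsAsymptotic L α) {l : ℕ} (hl : l ≤ n) {a a' w : W}
    (ha : IsRep cs l a) (ha' : IsRep cs l a') (hne : a' ≠ a) (hw : w ∈ young cs 0) :
    signProj L l * T L a⁻¹ * (T L a' * aHecke L l * C L w) ∈ augIdealSup L l := by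
  have hd : a⁻¹ * a' ∈ young cs 0 := mul_mem (inv_mem ha.mem) ha'.mem
  have h1 := hL.signProj_mul_sub_mem hl hl hd hw
  have h2 : ∏ j ∈ Finset.range l, (1 + if win cs (a⁻¹ * a') (j + 1) ≤ l then 1 else -1 : ℤ) = 0 := by
    by_contra hc
    apply hne
    replace hc := Finset.prod_ne_zero_iff.1 hc
    have h3 : a⁻¹ * a' ∈ young cs l := by
      refine mem_young_of_win cs (fun x hx => win_pos cs hd hx) fun x hx hxl => ?_
      obtain ⟨j, rfl⟩ : ∃ j : ℕ, x = j + 1 := ⟨(x - 1).toNat, by omega⟩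
      by_contra h4
      exact hc j (Finset.mem_range.2 (by omega)) (by rw [if_neg h4]; rfl)
    have h4 := ha.eq_one h3 (by rwa [mul_inv_cancel_left])
    exact (inv_mul_eq_one.1 h4).symm
  rw [h2, zero_smul, sub_zero] at h1
  have e : signProj L l * T L a⁻¹ * (T L a' * aHecke L l * C L w) =
      signProj L l * ((T L a⁻¹ * T L a' - T L (a⁻¹ * a')) * (aHecke L l * C L w)) +
        signProj L l * (T L (a⁻¹ * a') * (aHecke L l * C L w)) := by
    simp only [sub_mul, mul_sub, mul_assoc]
    abel
  rw [e]
  exact add_mem (Submodule.mem_sup_left (mul_mem_augH L _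
    (mem_augH_mul L (T_mul_T_sub_mem L _ _) _))) h1

/-- The correction terms of C_{a a_l w} belong to strictly shorter a' and are killed; the leading
term becomes c_l C_w, on which all l factors act as 2. -/
theorem IsAsymptotic.signProj_mul_C_sub_mem (hL : IsAsymptotic L α) {l : ℕ} (hl : l ≤ n) {a w : W}
    (ha : IsRep cs l a) (hw : w ∈ young cs 0) :
    signProj L l * T L a⁻¹ * C L (a * aElt cs l * w) - (2 ^ l : ℤ) • C L (aElt cs l * w) ∈
      augIdealSup L l := by
  have h1 := hL.signProj_mul_sub_mem hl hl (one_mem (young cs 0)) hw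
  have h2 : ∏ j ∈ Finset.range l, (1 + if win cs (1 : W) (j + 1) ≤ l then 1 else -1 : ℤ) = 2 ^ l := by
    rw [Finset.prod_congr rfl (g := fun _ => 2), Finset.prod_const, Finset.card_range]
    intro j hj
    have := Finset.mem_range.1 hj
    rw [win_one, if_pos (by omega)]
    rfl
  rw [h2, T_one, one_mul, ← hL.C_aElt_mul hl hw] at h1
  have h3 : signProj L l * T L a⁻¹ *
      (C L (a * aElt cs l * w) - T L a * aHecke L l * C L w) ∈ augIdealSup L l := by
    refine mul_mem_of_mem_span (hL.C_sub_mem_cellFilt hl ha hw) ?_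
    rintro _ ⟨⟨⟨a', w'⟩, ha', hw'⟩, hlt, rfl⟩
    refine hL.signProj_mul_mem hl ha ha' ?_ (mem_young_of_relLeftLE hw' hw)
    replace hlt : cs.length a' < cs.length a := hlt
    rintro rfl
    exact lt_irrefl _ hlt
  have h4 : T L a⁻¹ * T L a - 1 ∈ augH L := by
    have := T_mul_T_sub_mem L a⁻¹ a
    rwa [inv_mul_cancel, T_one] at this
  have e : signProj L l * T L a⁻¹ * C L (a * aElt cs l * w) - (2 ^ l : ℤ) • C L (aElt cs l * w) =
      signProj L l * T L a⁻¹ * (C L (a * aElt cs l * w) - T L a * aHecke L l * C L w) +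
        (signProj L l * ((T L a⁻¹ * T L a - 1) * C L (aElt cs l * w)) +
        (signProj L l * C L (aElt cs l * w) - (2 ^ l : ℤ) • C L (aElt cs l * w))) := by
    rw [hL.C_aElt_mul hl hw]
    simp only [sub_mul, mul_sub, mul_assoc, one_mul]
    abel
  rw [e]
  exact add_mem h3 (add_mem (Submodule.mem_sup_left (mul_mem_augH L _ (mem_augH_mul L h4 _))) h1)

/-! ### Lower bounds for the left pre-order. -/

theorem coeff_of_mem_augIdealSup {l : ℕ} {z : W} (hz : tLength cs z = l) {h : Hecke L}
    (hh : h ∈ augIdealSup L l) : augmentation Γ ((C L).repr h z) = 0 := by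
  obtain ⟨p, hp, r, hr, rfl⟩ := Submodule.mem_sup.1 hh
  have h1 : (C L).repr r z = 0 := by
    by_contra hc
    have h2 : l + 1 ≤ tLength cs z := (C L).mem_span_image.1 hr (Finsupp.mem_support_iff.2 hc)
    omega
  rw [map_add, Finsupp.add_apply, h1, add_zero, coeff_of_mem_augH L hp]

/-- The coefficient of C_{a_l w} in the projected C_{a a_l w} has augmentation 2^l, hence is
non-zero before specialisation too. -/
theorem IsAsymptotic.aElt_mul_leftLE (hL : IsAsymptotic L α) {l : ℕ} (hl : l ≤ n) {a w : W}
    (ha : IsRep cs l a) (hw : w ∈ young cs 0) :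
    LeftLE L (aElt cs l * w) (a * aElt cs l * w) := by
  refine leftLE_of_coeff_ne L (signProj L l * T L a⁻¹) fun h0 => ?_
  have hz : tLength cs (aElt cs l * w) = l := by
    have := tLength_mul_aElt_mul cs hl (one_mem (young cs 0)) hw
    rwa [one_mul] at this
  have h1 := coeff_of_mem_augIdealSup hz (hL.signProj_mul_C_sub_mem hl ha hw)
  rw [map_sub, map_zsmul, Module.Basis.repr_self, Finsupp.sub_apply, h0, zero_sub,
    Finsupp.smul_apply, Finsupp.single_eq_same, map_neg, map_zsmul, map_one, neg_eq_zero,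
    smul_eq_mul, mul_one] at h1
  exact pow_ne_zero l two_ne_zero h1

/-- In T_a C_{a_l w} the coefficient of C_{a a_l w} is 1: by uniqueness of the decomposition, no
correction term with a shorter a' can be this element. -/
theorem IsAsymptotic.mul_aElt_mul_leftLE (hL : IsAsymptotic L α) {l : ℕ} (hl : l ≤ n) {a w : W}
    (ha : IsRep cs l a) (hw : w ∈ young cs 0) :
    LeftLE L (a * aElt cs l * w) (aElt cs l * w) := by
  refine leftLE_of_coeff_ne L (T L a) fun h0 => ?_
  have h1 := hL.C_sub_mem_cellFilt hl ha hw
  rw [← (hL.cell_triangular hl hw _).1] at h1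
  have h2 : (C L).repr (C L (a * aElt cs l * w) - T L a * aHecke L l * C L w)
      (a * aElt cs l * w) = 0 := by
    by_contra hc
    obtain ⟨⟨⟨a', w'⟩, ha', hw'⟩, hlt, h3⟩ :=
      (C L).mem_span_image.1 h1 (Finsupp.mem_support_iff.2 hc)
    replace h3 : a' * aElt cs l * w' = a * aElt cs l * w := h3
    have h4 := (IsRep.eq_of_mul_aElt_mul cs hl ha' ha (mem_young_of_relLeftLE hw' hw) hw h3).1
    have h5 : cs.length a' < cs.length a := hlt
    exact h5.ne (congrArg cs.length h4)
  rw [hL.C_aElt_mul hl hw, ← mul_assoc] at h0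
  rw [map_sub, Finsupp.sub_apply, h0, Module.Basis.repr_self, Finsupp.single_eq_same, sub_zero] at h2
  exact one_ne_zero h2

theorem IsAsymptotic.coeff_aHecke_mul (hL : IsAsymptotic L α) {l : ℕ} (hl : l ≤ n) (w : W)
    {h : Hecke L} (hh : h ∈ Submodule.span (Coef Γ) (C L '' (young cs 0 : Set W))) :
    (C L).repr (aHecke L l * h) (aElt cs l * w) = (C L).repr h w := by
  induction hh using Submodule.span_induction with
  | mem x hx =>
    obtain ⟨u, hu, rfl⟩ := hx
    rw [← hL.C_aElt_mul hl hu, Module.Basis.repr_self, Module.Basis.repr_self,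
      Finsupp.single_apply_left (mul_right_injective _)]
  | zero => rw [mul_zero, map_zero]; rfl
  | add x y _ _ hx hy => rw [mul_add, map_add, map_add, Finsupp.add_apply, Finsupp.add_apply, hx, hy]
  | smul c x _ hx =>
    rw [mul_smul_comm, map_smul, map_smul, Finsupp.smul_apply, Finsupp.smul_apply, hx]

theorem IsAsymptotic.exists_aHecke_mul_Ts (hL : IsAsymptotic L α) {l : ℕ} (hl : l ≤ n) {i : Fin n}
    (hi : i ∈ youngGens n l) : ∃ j, aHecke L l * Ts L i = Ts L j * aHecke L l := by
  have h0 : (i : ℕ) ≠ 0 := hi.1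
  have h1 : (i : ℕ) ≠ l := hi.2
  rcases Nat.lt_or_ge i l with h | h
  · have h2 := (hL.relations hl).1 (l - i) (by omega) (by omega)
    rw [show l - (l - (i : ℕ)) = i by omega, tau_of_lt L i.2, tau_of_lt L (k := l - i) (by omega)]
      at h2
    exact ⟨_, h2.symm⟩
  · have h2 := commute_aHecke L (l := l) (j := i) (by omega) i.2
    rw [tau_of_lt L i.2] at h2
    exact ⟨i, h2.eq.symm⟩

/-- Left multiplication by c_l sends C_u to C_{a_l u} for u ∈ 𝔖_n and preserves coefficients. As c_l
T_s = T_{s'} c_l for s ∈ Σ_{l,n-l}, a relative step is carried to a left multiple of C_{a_l v}. -/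
theorem IsAsymptotic.aElt_mul_leftLE_aElt_mul (hL : IsAsymptotic L α) {l : ℕ} (hl : l ≤ n)
    {w w' : W} (hw : w ∈ young cs 0) (h : RelLeftLE L (youngGens n l) w' w) :
    LeftLE L (aElt cs l * w') (aElt cs l * w) := by
  induction h using Relation.ReflTransGen.head_induction_on with
  | refl => exact Relation.ReflTransGen.refl
  | @head u v h1 h2 ih =>
    refine Relation.ReflTransGen.trans ?_ ih
    have hv := mem_young_of_relLeftLE h2 hw
    obtain ⟨i, hi, h3⟩ := h1
    obtain ⟨j, h4⟩ := hL.exists_aHecke_mul_Ts hl hi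
    refine leftLE_of_coeff_ne L (Ts L j + expo (-L (cs.simple i)) • (1 : Hecke L)) ?_
    have h5 : C L (cs.simple i) * C L v ∈ Submodule.span (Coef Γ) (C L '' (young cs 0 : Set W)) := by
      rw [span_C_young, C_simple, add_mul, smul_mul_assoc, one_mul]
      exact add_mem (Ts_mul_mem_span_young hi.1 (C_mem_span_T hv))
        (Submodule.smul_mem _ _ (C_mem_span_T hv))
    have h6 : (Ts L j + expo (-L (cs.simple i)) • (1 : Hecke L)) * C L (aElt cs l * v) =
        aHecke L l * (C L (cs.simple i) * C L v) := by
      rw [hL.C_aElt_mul hl hv, C_simple, add_mul, ← mul_assoc, ← h4, add_mul, mul_add, mul_assoc,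
        smul_mul_assoc, one_mul, smul_mul_assoc, one_mul, mul_smul_comm]
    rw [h6, hL.coeff_aHecke_mul hl u h5]
    exact h3

end Action

end KazhdanLusztig

theorem theorem5p10 {n : ℕ} (hn : 2 ≤ n)
    {W : Type*} [Group W] (cs : CoxeterSystem (KazhdanLusztig.typeB n) W)
    {Γ : Type*} [AddCommGroup Γ] [LinearOrder Γ] [IsOrderedAddMonoid Γ]
    (L : KazhdanLusztig.WeightFunction cs Γ) (a b : Γ)
    (hLt : L (KazhdanLusztig.gen cs 0) = b)
    (hLs : ∀ k : ℕ, 1 ≤ k → k ≤ n - 1 → L (KazhdanLusztig.gen cs k) = a)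
    (hab : (n - 1) • a < b)
    (x y : W) (l : ℕ) (hx : KazhdanLusztig.tLength cs x = l)
    (hy : KazhdanLusztig.tLength cs y = l) :
    KazhdanLusztig.LeftLE L x y ↔
      KazhdanLusztig.RelLeftLE L (KazhdanLusztig.youngGens n l)
        (KazhdanLusztig.sigmaPart cs x * (KazhdanLusztig.bPart cs x)⁻¹)
        (KazhdanLusztig.sigmaPart cs y * (KazhdanLusztig.bPart cs y)⁻¹) := by
  have hs : ∀ i : Fin n, (i : ℕ) ≠ 0 → L (cs.simple i) = a := fun i hi => by
    have := hLs i (by omega) (by omega)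
    rwa [KazhdanLusztig.gen_of_lt cs i.2] at this
  have hL : KazhdanLusztig.IsAsymptotic L a :=
    -- Since n ≥ 2, s_1 exists and a = L(s_1) is positive.
    ⟨hs, (hs ⟨1, hn⟩ one_ne_zero) ▸ (L.pos ⟨1, hn⟩).le, hLt.symm ▸ hab⟩
  have hl : l ≤ n := hx ▸ KazhdanLusztig.tLength_le cs x
  obtain ⟨c, hc, hw, hxe⟩ := KazhdanLusztig.exists_isRep_eq cs x
  obtain ⟨d, hd, hv, hye⟩ := KazhdanLusztig.exists_isRep_eq cs y
  rw [hx] at hc hxe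
  rw [hy] at hd hye
  generalize KazhdanLusztig.sigmaPart cs x * (KazhdanLusztig.bPart cs x)⁻¹ = w at hw hxe ⊢
  generalize KazhdanLusztig.sigmaPart cs y * (KazhdanLusztig.bPart cs y)⁻¹ = v at hv hye ⊢
  constructor
  · intro h
    rcases hL.mem_of_leftLE hl hv h ⟨d, v, hd, Relation.ReflTransGen.refl, hye⟩ with h1 | h1
    · obtain ⟨c', w', hc', hw', h2⟩ := h1
      rw [hxe] at h2
      rw [(KazhdanLusztig.IsRep.eq_of_mul_aElt_mul cs hl hc hc' hw
        (KazhdanLusztig.mem_young_of_relLeftLE hw' hv) h2).2]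
      exact hw'
    -- Larger t-length is excluded since x and y have the same one.
    · have h2 : l + 1 ≤ KazhdanLusztig.tLength cs x := h1
      omega
  · intro h
    rw [hxe, hye]
    -- The chain c a_l w ≤ a_l w ≤ a_l v ≤ d a_l v.
    exact (hL.mul_aElt_mul_leftLE hl hc hw).trans
      ((hL.aElt_mul_leftLE_aElt_mul hl hv h).trans (hL.aElt_mul_leftLE hl hd hv))
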